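/- Let $N,d\ge 1$ be integers with $(N,d)\neq(3,2)$, and with $N\le 2$ if $d=1$. Let $T^N(\mathbb R^d)=\bigoplus_{k=0}^N(\mathbb R^d)^{\otimes k}$ be the truncated tensor algebra with bracket $[X,Y]=X\otimes Y-Y\otimes X$, let $[\mathbb R^d]^1=\mathbb R^d$, $[\mathbb R^d]^{k+1}=[\mathbb R^d,[\mathbb R^d]^k]$, and let $\mathfrak g_N=\bigoplus_{k=1}^N[\mathbb R^d]^k\subset T^N(\mathbb R^d)$ be the Lie algebra of the group of signatures $G_N=\exp\mathfrak g_N$. Put $m_k=\dim[\mathbb R^d]^k$ for $1\le k\le N$ and $m_0=0$. Let $$\{X^N_1,\dots,X^N_{m_N},X^{N-1}_1,\dots,X^{N-1}_{m_{N-1}},\dots,X^1_1,\dots,X^1_{m_1}\}$$ be a basis of $\mathfrak g_N$, in this order, such that $X^k_1,\dots,X^k_{m_k}$ is a basis of the layer $[\mathbb R^d]^k$ for each $k$ (such a basis is a strong Malcev basis), and let $(\ell^k_i)$ be the dual basis of $\mathfrak g_N^*$. The index of $X^k_i$ and $\ell^k_i$ is written $(k,i)$. For $\ell\in\mathfrak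 g_N^*$ let $\mathcal O_\ell=\{\ell\circ e^{-\operatorname{ad}X}: X\in\mathfrak g_N\}$ be its coadjoint orbit. For an index $j$ let $\mathfrak g_N^*(j)$ be the span of the dual basis elements that come after $j$ in the list, so that $\mathfrak g_N^*/\mathfrak g_N^*(j)$ is the span of those up to $j$, and let $d_j$ be the maximum over $\ell\in\mathfrak g_N^*$ of the dimension of the image of $\mathcal O_\ell$ in $\mathfrak g_N^*/\mathfrak g_N^*(j)$. The functional $\ell$ is in general position if the image of $\mathcal O_\ell$ in $\mathfrak g_N^*/\mathfrak g_N^*(j)$ has dimension $d_j$ for all $j$; let $U$ be the set of functionals in general position. Let $S$ be the set of jump indices, that is, of the $j$ such that $d_j$ is greater than its value at the preceding index (than $0$ for the first index), and let $T$ be the complement of $S$ in the set of all indices. For $1\le k\le N-1$ and $m\ge 0$ let $B_\ell^k(m)$ be the matrix with entries $\ell([X^k_i,X^{N-k}_j])$, $1\le i\le m_k$, $1\le j\le \min\{m,m_{N-k}\}$, let $\dim(k,m)=\max_{\ell\in\mathfrak g_N^*}\operatorname{rank}B_\ell^k(m)$, and let $B_\ell^k=B_\ell^k(m_k)$. Then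 $$S=\bigcup_{k=1}^{N-1}\{(k,1),\dots,(k,\dim(k,m_k))\},$$ $$T=\begin{cases}\displaystyle\bigcup_{N/2<k\le N}\{(k,m_{N-k}+1),\dots,(k,m_k)\} & \text{if } N \text{ is odd or } m_{N/2} \text{ is even},\\[1ex] \displaystyle\bigcup_{N/2<k\le N}\{(k,m_{N-k}+1),\dots,(k,m_k)\}\cup\{(N/2,m_{N/2})\} & \text{if } N \text{ is even and } m_{N/2} \text{ is odd},\end{cases}$$ and $U$ is the set of all $\ell\in\mathfrak g_N^*$ such that $\operatorname{rank}B_\ell^k=\dim(k,m_k)$ for all $1\le k\le\lfloor N/2\rfloor$ and, if $N$ is even and $m_{N/2}$ is odd, the first $m_{N/2}-1$ rows of $B_\ell^{N/2}$ are linearly independent. -/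

import Mathlib

noncomputable section

namespace SignatureGroup

/-! ### The truncated tensor algebra and the Lie algebra of the group of signatures -/

/-- The augmentation ideal of the tensor algebra of `ℝ^d`: the tensors without constant term. -/
abbrev augIdeal (d : ℕ) : Ideal (TensorAlgebra ℝ (Fin d → ℝ)) :=
  RingHom.ker (TensorAlgebra.algebraMapInv : TensorAlgebra ℝ (Fin d → ℝ) →ₐ[ℝ] ℝ)

/-- The `N`-step truncated tensor algebra `T^N(ℝ^d) = ⨁_{k ≤ N} (ℝ^d)^{⊗ k}`: the tensor algebra
in which all tensors of degree at least `N + 1` (they form the power `N + 1` of the augmentation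
ideal) are set to zero. -/
abbrev TruncTensor (d N : ℕ) : Type :=
  TensorAlgebra ℝ (Fin d → ℝ) ⧸ (augIdeal d) ^ (N + 1)

/-- The commutator bracket `[X, Y] = X ⊗ Y - Y ⊗ X`. -/
instance (d N : ℕ) : LieRing (TruncTensor d N) := LieRing.ofAssociativeRing

instance (d N : ℕ) : LieAlgebra ℝ (TruncTensor d N) := LieAlgebra.ofAssociativeAlgebra

/-- The inclusion of `ℝ^d` in `T^N(ℝ^d)`. -/
def incl (d N : ℕ) : (Fin d → ℝ) →ₗ[ℝ] TruncTensor d N :=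
  (Ideal.Quotient.mkₐ ℝ ((augIdeal d) ^ (N + 1))).toLinearMap ∘ₗ TensorAlgebra.ι ℝ

/-- The layers `[ℝ^d]^k`: `[ℝ^d]^1 = ℝ^d` and `[ℝ^d]^{k+1} = [ℝ^d, [ℝ^d]^k]`, with `[ℝ^d]^0 = 0`. -/
def layer (d N : ℕ) : ℕ → Submodule ℝ (TruncTensor d N)
  | 0 => ⊥
  | 1 => LinearMap.range (incl d N)
  | k + 2 => Submodule.span ℝ
      {z | ∃ v : Fin d → ℝ, ∃ y ∈ layer d N (k + 1), z = ⁅incl d N v, y⁆}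

/-- `m_k = dim [ℝ^d]^k`; it is `0` for `k = 0`. -/
def layerDim (d N k : ℕ) : ℕ := Module.finrank ℝ (layer d N k)

/-- `⁅[ℝ^d]^i, [ℝ^d]^j⁆ ⊆ [ℝ^d]^{i+j}`. -/
theorem lie_mem_layer (d N : ℕ) : ∀ (i j : ℕ) (x y : TruncTensor d N),
    x ∈ layer d N i → y ∈ layer d N j → ⁅x, y⁆ ∈ layer d N (i + j) := by
  have key : ∀ (j : ℕ) (v : Fin d → ℝ) (y : TruncTensor d N),
      y ∈ layer d N j → ⁅incl d N v, y⁆ ∈ layer d N (j + 1) := by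
    intro j v y hy
    cases j with
    | zero =>
      have hy0 : y = 0 := by simpa [layer] using hy
      subst hy0
      rw [lie_zero]
      exact Submodule.zero_mem _
    | succ k => exact Submodule.subset_span ⟨v, y, hy, rfl⟩
  intro i
  induction i with
  | zero =>
    intro j x y hx hy
    have hx0 : x = 0 := by simpa [layer] using hx
    subst hx0
    rw [zero_lie]
    exact Submodule.zero_mem _
  | succ i ih =>
    intro j x y hx hy
    cases i with
    | zero =>
      obtain ⟨v, rfl⟩ : ∃ v, incl d N v = x := by simpa [layer] using hx
      rw [show 0 + 1 + j = j + 1 by omega]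
      exact key j v y hy
    | succ k =>
      have hx' : x ∈ Submodule.span ℝ
        {z | ∃ v : Fin d → ℝ, ∃ y ∈ layer d N (k + 1), z = ⁅incl d N v, y⁆} := hx
      induction hx' using Submodule.span_induction with
      | mem z hz =>
        obtain ⟨v, w, hw, rfl⟩ := hz
        rw [lie_lie]
        refine Submodule.sub_mem _ ?_ ?_
        · have h := key _ v _ (ih j w y hw hy)
          rwa [show k + 1 + j + 1 = k + 1 + 1 + j by omega] at h
        · have h := ih (j + 1) w _ hw (key j v y hy)
          rwa [show k + 1 + (j + 1) = k + 1 + 1 + j by omega] at h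
      | zero => rw [zero_lie]; exact Submodule.zero_mem _
      | add a b ha hb iha ihb =>
        rw [add_lie]
        exact Submodule.add_mem _ (iha ha) (ihb hb)
      | smul c a ha iha =>
        rw [smul_lie]
        exact Submodule.smul_mem _ c (iha ha)

/-- The Lie algebra `𝔤_N(ℝ^d) = ℝ^d ⊕ [ℝ^d, ℝ^d] ⊕ ⋯` of the group of signatures `G_N(ℝ^d)`, as a
Lie subalgebra of `T^N(ℝ^d)` (the layers `[ℝ^d]^k` vanish in `T^N(ℝ^d)` for `k > N`). -/
def gN (d N : ℕ) : LieSubalgebra ℝ (TruncTensor d N) where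
  toSubmodule := ⨆ k : ℕ, layer d N k
  lie_mem' := by
    intro x y hx hy
    change ⁅x, y⁆ ∈ (⨆ k : ℕ, layer d N k)
    have hx' : x ∈ (⨆ k : ℕ, layer d N k) := hx
    have hy' : y ∈ (⨆ k : ℕ, layer d N k) := hy
    induction hx' using Submodule.iSup_induction' with
    | mem i a ha =>
      induction hy' using Submodule.iSup_induction' with
      | mem j b hb => exact Submodule.mem_iSup_of_mem (i + j) (lie_mem_layer d N i j a b ha hb)
      | zero => rw [lie_zero]; exact Submodule.zero_mem _
      | add b c hb hc ihb ihc =>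
        rw [lie_add]
        exact Submodule.add_mem _ (ihb hb) (ihc hc)
    | zero => rw [zero_lie]; exact Submodule.zero_mem _
    | add a b ha hb iha ihb =>
      rw [add_lie]
      exact Submodule.add_mem _ (iha ha) (ihb hb)

/-! ### The coadjoint action -/

/-- `Ad (exp X) = ∑_n (ad X)^n / n!` on `𝔤_N`. All terms with `n ≥ N` vanish, since `𝔤_N` is
nilpotent of step `N`. -/
def AdExp {d N : ℕ} (X : gN d N) : Module.End ℝ (gN d N) :=
  ∑ n ∈ Finset.range (N + 1), ((n.factorial : ℝ)⁻¹) • (LieAlgebra.ad ℝ (gN d N) X) ^ n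

/-- The coadjoint orbit `(Ad^* G_N) ℓ`, where `((Ad^* exp X) ℓ)(Y) = ℓ (Ad (exp (-X)) Y)` and
`G_N = exp 𝔤_N`. -/
def coadjointOrbit {d N : ℕ} (ℓ : Module.Dual ℝ (gN d N)) : Set (Module.Dual ℝ (gN d N)) :=
  Set.range fun X : gN d N => ℓ ∘ₗ AdExp (-X)

/-! ### Bases adapted to the layers, orbits in general position, jump indices -/

/-- The index `(k, i)` of the basis element `X_i^k`, for `0 ≤ k ≤ N` and `i = 1, …, m_k`. As always
with `Fin`, the second component is counted from `0`: `⟨k, i⟩` stands for the pair `(k, i + 1)`.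
There is no index with `k = 0`, since `m_0 = 0`. -/
abbrev Idx (d N : ℕ) : Type := Σ k : Fin (N + 1), Fin (layerDim d N k)

/-- `q` stands strictly before `p` in the list
`(N, 1), …, (N, m_N), (N - 1, 1), …, (N - 1, m_{N-1}), …, (1, 1), …, (1, m_1)`. -/
def Before {d N : ℕ} (q p : Idx d N) : Prop :=
  p.1 < q.1 ∨ (q.1 = p.1 ∧ (q.2 : ℕ) < (p.2 : ℕ))

open Classical in
/-- The indices strictly before `p`. -/
def strictlyBefore {d N : ℕ} (p : Idx d N) : Finset (Idx d N) :=
  Finset.univ.filter fun q => Before q p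

open Classical in
/-- The indices up to `p`, with `p` included. -/
def upTo {d N : ℕ} (p : Idx d N) : Finset (Idx d N) := insert p (strictlyBefore p)

/-- `X` is adapted to the layers: for each `k`, the elements `X_1^k, …, X_{m_k}^k` span the `k`-th
layer. Such a basis, listed in the order of `Before`, is a strong Malcev basis. -/
def IsLayered {d N : ℕ} (X : Module.Basis (Idx d N) ℝ (gN d N)) : Prop :=
  ∀ k : Fin (N + 1),
    Submodule.span ℝ (Set.range fun i => (X ⟨k, i⟩ : TruncTensor d N)) = layer d N k

/-- For an initial segment `s = {1, …, j}` of the indices, the dimension of the image of the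
coadjoint orbit of `ℓ` in `𝔤^* / 𝔤^*(j)`, where `𝔤^*(j)` is the span of the dual basis elements
with an index outside `s`. The quotient `𝔤^* / 𝔤^*(j) = span {ℓ_1, …, ℓ_j}` is identified with
`ℝ^j` by the coordinates `ℓ' ↦ (ℓ' (X_1), …, ℓ' (X_j))`. The image of the orbit is a submanifold;
its dimension is expressed as the Hausdorff dimension, which agrees with the manifold dimension. -/
def orbitDim {d N : ℕ} (X : Module.Basis (Idx d N) ℝ (gN d N)) (ℓ : Module.Dual ℝ (gN d N))
    (s : Finset (Idx d N)) : ENNReal :=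
  dimH ((fun (ℓ' : Module.Dual ℝ (gN d N)) (q : s) => ℓ' (X q)) '' coadjointOrbit ℓ)

/-- The maximal dimension of coadjoint orbits in `𝔤^* / 𝔤^*(j)`, for `s = {1, …, j}`. -/
def maxOrbitDim {d N : ℕ} (X : Module.Basis (Idx d N) ℝ (gN d N)) (s : Finset (Idx d N)) :
    ENNReal :=
  ⨆ ℓ : Module.Dual ℝ (gN d N), orbitDim X ℓ s

/-- `ℓ` is in general position: its orbit has maximal dimension in `𝔤^* / 𝔤^*(j)` for all `j`. -/
def InGeneralPosition {d N : ℕ} (X : Module.Basis (Idx d N) ℝ (gN d N))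
    (ℓ : Module.Dual ℝ (gN d N)) : Prop :=
  ∀ (p : Idx d N) (ℓ' : Module.Dual ℝ (gN d N)), orbitDim X ℓ' (upTo p) ≤ orbitDim X ℓ (upTo p)

/-- The set `S` of jump indices: the `j` at which the maximal dimension `d_j` of orbits in
`𝔤^* / 𝔤^*(j)` is greater than `d_{j-1}` (with `d_0 = 0`). -/
def jumpSet {d N : ℕ} (X : Module.Basis (Idx d N) ℝ (gN d N)) : Set (Idx d N) :=
  {p | maxOrbitDim X (strictlyBefore p) < maxOrbitDim X (upTo p)}

/-- The set `T` of the indices that are not jump indices. -/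
def nonJumpSet {d N : ℕ} (X : Module.Basis (Idx d N) ℝ (gN d N)) : Set (Idx d N) :=
  (jumpSet X)ᶜ

/-! ### The matrices `B_ℓ^k(m)` -/

/-- The matrix `B_ℓ^k(m)` with entries `ℓ ([X_i^k, X_j^{N-k}])`, for `i = 1, …, m_k` and
`j = 1, …, m`, where `j ≤ m_{N-k}` (so all columns are there if `m ≥ m_{N-k}`).
Note that `k.rev = N - k` in `Fin (N + 1)`. -/
def bracketMatrix {d N : ℕ} (X : Module.Basis (Idx d N) ℝ (gN d N)) (ℓ : Module.Dual ℝ (gN d N))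
    (k : Fin (N + 1)) (m : ℕ) :
    Matrix (Fin (layerDim d N k)) {j : Fin (layerDim d N k.rev) // (j : ℕ) < m} ℝ :=
  Matrix.of fun i j => ℓ ⁅X ⟨k, i⟩, X ⟨k.rev, j.1⟩⁆

/-- `dim(k, m) = max_ℓ rank B_ℓ^k(m)`. -/
def maxRank {d N : ℕ} (X : Module.Basis (Idx d N) ℝ (gN d N)) (k : Fin (N + 1)) (m : ℕ) : ℕ :=
  ⨆ ℓ : Module.Dual ℝ (gN d N), (bracketMatrix X ℓ k m).rank

end SignatureGroup

end

/-! Let `M` be the skew matrix with entries ℓ([X_p, X_q]). The proof turns orbit dimensions into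
ranks of columns of `M` and then does linear algebra with `M`.

The image of the orbit in the quotient by 𝔤*(j) is parametrized by Z ↦ (ℓ(e^{-ad Z} X_q)) over q up
to j. Its derivative at any point is, up to invertible maps, Z ↦ (ℓ([Z, X_q])), because the X_q up
to j span an ideal. The rank is therefore constant, and by the constant rank theorem the dimension
of the image is the rank of the columns of `M` up to j (`dimH_range_orbit`, `orbitDim_eq_finrank`).

Entries of `M` vanish when the two levels add up to more than N. The blocks with levels k and N - k
form an antidiagonal on which only the last layer of ℓ matters. Two facts about Lie elements control
these blocks. Nonzero Lie elements of different degrees never commute, and commuting ones of the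
same degree are proportional (`eq_zero_of_commute_of_lt`, `exists_smul_eq_of_commute`). Consequently
m_j ≤ m_{N-j} for 2j ≤ N (`layerDim_le_layerDim_sub`); this is what fails in the excluded cases.

The number of jumps in level k is `jumpCount`: m_k below the middle, m_{N-k} above it, and m_k
rounded down to an even number in the middle, where the block is skew. No initial segment of columns
has larger rank than the number of these indices in it (`finrank_span_formCol_le`): late rows
vanish, and a skew block of odd size is singular.

Equality is attained (`exists_jumpColsIndependent`). Take ℓ supported on the last layer with the
jump columns of maximal rank. If a vector b on the jump indices is in the kernel, a perturbation
argument (`apply_mem_range_of_maximal_rank`) shows that every left kernel vector a satisfies ℓ'([a,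
b]) = 0 for all ℓ', so that a and b commute. Counting dimensions produces an a that cannot commute
with b.

Hence general position means that the jump columns are independent. Block triangularity splits this
into one condition for each antidiagonal block, and these are the rank conditions on B_ℓ^k
(`jumpColsIndependent_iff`). -/

noncomputable section

namespace SignatureGroup

open Module Set Filter Topology

/-! ### Hausdorff dimension of the image of a map of constant rank. -/

section ConstantRank

variable {E F : Type*} [NormedAddCommGroup E] [NormedSpace ℝ E] [FiniteDimensional ℝ E]
  [NormedAddCommGroup F] [NormedSpace ℝ F] [FiniteDimensional ℝ F]

/-- The image of a continuously differentiable map has at least the dimension of the range of its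
derivative at any point. -/
theorem finrank_range_fderiv_le_dimH {f : E → F} (hf : ContDiff ℝ 1 f) (x : E) :
    (finrank ℝ (LinearMap.range (fderiv ℝ f x).toLinearMap) : ENNReal) ≤ dimH (range f) := by
  set A := fderiv ℝ f x with hA
  -- After a linear projection onto the range of the derivative, the map is a submersion at `x`, so
  -- its image contains an open set. The projection is Lipschitz and cannot raise the dimension.
  obtain ⟨π₀, hπ₀⟩ := LinearMap.exists_leftInverse_of_injective
    (LinearMap.range A.toLinearMap).subtype (Submodule.ker_subtype _)
  set π := LinearMap.toContinuousLinearMap π₀ with hπ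
  have hstrict : HasStrictFDerivAt f A x := (hf.contDiffAt).hasStrictFDerivAt one_ne_zero
  have hcomp : HasStrictFDerivAt (fun y => π (f y)) (π.comp A) x :=
    π.hasStrictFDerivAt.comp x hstrict
  have hsurj : LinearMap.range (π.comp A).toLinearMap = ⊤ := by
    rw [LinearMap.range_eq_top]
    rintro ⟨_, z, rfl⟩
    refine ⟨z, ?_⟩
    have := LinearMap.congr_fun hπ₀ ⟨A z, z, rfl⟩
    simpa [π] using this
  have hnhds := hcomp.map_nhds_eq_of_surj hsurj
  have hmem : range (fun y => π (f y)) ∈ 𝓝 (π (f x)) := by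
    rw [← hnhds]
    exact mem_map.2 (univ_mem' fun y => ⟨y, rfl⟩)
  rw [← Real.dimH_of_mem_nhds hmem, range_comp' π f]
  exact π.lipschitz.dimH_image_le _

/-- A continuously differentiable map of constant rank `r` maps some neighbourhood of any point to
a set of dimension at most `r`. -/
theorem exists_mem_nhds_dimH_image_le {f : E → F} (hf : ContDiff ℝ 1 f) {r : ℕ}
    (hr : ∀ x, finrank ℝ (LinearMap.range (fderiv ℝ f x).toLinearMap) = r) (x₀ : E) :
    ∃ U ∈ 𝓝 x₀, dimH (f '' U) ≤ r := by
  set A := fderiv ℝ f x₀ with hA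
  set R := LinearMap.range A.toLinearMap with hR
  set K := LinearMap.ker A.toLinearMap with hK
  obtain ⟨π₀, hπ₀⟩ := LinearMap.exists_leftInverse_of_injective R.subtype (Submodule.ker_subtype _)
  obtain ⟨κ₀, hκ₀⟩ := LinearMap.exists_leftInverse_of_injective K.subtype (Submodule.ker_subtype _)
  set π := LinearMap.toContinuousLinearMap π₀ with hπ
  set κ := LinearMap.toContinuousLinearMap κ₀ with hκ
  have hπR : ∀ y (hy : y ∈ R), π y = ⟨y, hy⟩ := fun y hy => LinearMap.congr_fun hπ₀ ⟨y, hy⟩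
  have hκK : ∀ y (hy : y ∈ K), κ y = ⟨y, hy⟩ := fun y hy => LinearMap.congr_fun hκ₀ ⟨y, hy⟩
  -- `Φ` is a local diffeomorphism at `x₀`. In the coordinates it defines, `f` turns out to depend
  -- on the `R` component only.
  let Φ : E → R × K := fun x => (π (f x), κ x)
  let D : E → E →L[ℝ] R × K := fun x => (π.comp (fderiv ℝ f x)).prod κ
  have hΦ : ContDiff ℝ 1 Φ := (π.contDiff.comp hf).prodMk κ.contDiff
  have hΦD : ∀ x, HasFDerivAt Φ (D x) x := fun x =>
    (π.hasFDerivAt.comp x (hf.differentiable one_ne_zero x).hasFDerivAt).prodMk κ.hasFDerivAt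
  have hDcont : Continuous D := by
    have h : D = fderiv ℝ Φ := funext fun x => (hΦD x).fderiv.symm
    exact h ▸ hΦ.continuous_fderiv one_ne_zero
  have hinj : Function.Injective (D x₀).toLinearMap := by
    rw [← LinearMap.ker_eq_bot, LinearMap.ker_eq_bot']
    intro z hz
    have h1 : π (A z) = 0 := congrArg Prod.fst hz
    have h2 : κ z = 0 := congrArg Prod.snd hz
    rw [hπR (A z) ⟨z, rfl⟩] at h1
    have h3 : z ∈ K := congrArg Subtype.val h1
    rw [hκK z h3] at h2
    exact congrArg Subtype.val h2
  have hdim : finrank ℝ E = finrank ℝ (R × K) := by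
    rw [finrank_prod, hR, hK, LinearMap.finrank_range_add_finrank_ker]
  let D₀ : E ≃L[ℝ] R × K :=
    (LinearMap.linearEquivOfInjective (D x₀).toLinearMap hinj hdim).toContinuousLinearEquiv
  have hD₀ : (D₀ : E →L[ℝ] R × K) = D x₀ := by ext1 z; rfl
  have hcd : ContDiffAt ℝ 1 Φ x₀ := hΦ.contDiffAt
  have hder : HasFDerivAt Φ (D₀ : E →L[ℝ] R × K) x₀ := hD₀ ▸ hΦD x₀
  let e := hcd.toOpenPartialHomeomorph Φ hder one_ne_zero
  have heΦ : ∀ x, e x = Φ x := fun x => rfl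
  have hx₀ : x₀ ∈ e.source := hcd.mem_toOpenPartialHomeomorph_source hder one_ne_zero
  have hsymm : ContDiffAt ℝ 1 e.symm (Φ x₀) := hcd.to_localInverse hder one_ne_zero
  -- near `x₀`, the projection `π` is injective on the range of the derivative
  have hgood : ∀ᶠ x in 𝓝 x₀, ∀ w, π (fderiv ℝ f x w) = 0 → fderiv ℝ f x w = 0 := by
    have h1 : ∀ᶠ x in 𝓝 x₀, D x ∈ range ((↑) : (E ≃L[ℝ] R × K) → E →L[ℝ] R × K) :=
      hDcont.continuousAt.eventually (hD₀ ▸ ContinuousLinearEquiv.nhds D₀)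
    filter_upwards [h1] with x ⟨D₁, hD₁⟩ w hw
    have hsurj : Function.Surjective
        (π.toLinearMap ∘ₗ (LinearMap.range (fderiv ℝ f x).toLinearMap).subtype) := by
      intro u
      refine ⟨⟨fderiv ℝ f x (D₁.symm (u, 0)), _, rfl⟩, ?_⟩
      have h2 : D x (D₁.symm (u, 0)) = (u, 0) := by
        rw [← hD₁]; exact D₁.apply_symm_apply _
      exact congrArg Prod.fst h2
    -- Constant rank enters here: a surjection between spaces of equal dimension is injective.
    have hinj' := (LinearMap.injective_iff_surjective_of_finrank_eq_finrank
      ((hr x).trans (hr x₀).symm)).2 hsurj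
    have := @hinj' ⟨fderiv ℝ f x w, w, rfl⟩ 0 (by simpa using hw)
    exact congrArg Subtype.val this
  have hΦx₀ : Φ x₀ ∈ e.target := e.map_source hx₀
  have hsx₀ : e.symm (Φ x₀) = x₀ := e.left_inv hx₀
  have hev : ∀ᶠ y in 𝓝 (Φ x₀), y ∈ e.target ∧ ContDiffAt ℝ 1 e.symm y ∧
      ∀ w, π (fderiv ℝ f (e.symm y) w) = 0 → fderiv ℝ f (e.symm y) w = 0 := by
    refine Filter.Eventually.and (e.open_target.mem_nhds hΦx₀) ((hsymm.eventually (by simp)).and ?_)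
    have : Tendsto e.symm (𝓝 (Φ x₀)) (𝓝 x₀) := by
      have := hsymm.continuousAt.tendsto
      rwa [hsx₀] at this
    exact this.eventually hgood
  obtain ⟨ε, hε, hball⟩ := Metric.eventually_nhds_iff_ball.1 hev
  obtain ⟨u₀, v₀, hΦ₀⟩ : ∃ u₀ v₀, Φ x₀ = (u₀, v₀) := ⟨_, _, rfl⟩
  rw [hΦ₀, ← ball_prod_same] at hball
  -- Moving `v` alone leaves `π ∘ f` fixed, since `e.symm` inverts `Φ`. As `π` is injective on the
  -- range of the derivative, `f` does not move either.
  have hconst : ∀ u ∈ Metric.ball u₀ ε, ∀ v ∈ Metric.ball v₀ ε,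
      f (e.symm (u, v)) = f (e.symm (u, v₀)) := by
    intro u hu v hv
    have hder0 : ∀ v ∈ Metric.ball v₀ ε,
        HasFDerivAt (fun v => f (e.symm (u, v))) (0 : K →L[ℝ] F) v := by
      intro v hv
      obtain ⟨hy, hsm, hz⟩ := hball (u, v) ⟨hu, hv⟩
      have hs : HasFDerivAt e.symm (fderiv ℝ e.symm (u, v)) (u, v) :=
        (hsm.differentiableAt one_ne_zero).hasFDerivAt
      have hid : (D (e.symm (u, v))).comp (fderiv ℝ e.symm (u, v)) =
          ContinuousLinearMap.id ℝ (R × K) := by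
        refine ((hΦD _).comp (u, v) hs).unique ((hasFDerivAt_id (u, v)).congr_of_eventuallyEq ?_)
        filter_upwards [e.open_target.mem_nhds hy] with z hz
        exact e.right_inv hz
      have hin : HasFDerivAt (fun v : K => (u, v)) (ContinuousLinearMap.inr ℝ R K) v :=
        hasFDerivAt_prodMk_right u v
      have htot := ((hf.differentiable one_ne_zero (e.symm (u, v))).hasFDerivAt.comp (u, v)
        hs).comp v hin
      refine htot.congr_fderiv ?_
      ext1 w
      refine hz _ ?_
      have := DFunLike.congr_fun hid (0, w)
      exact congrArg Prod.fst this
    have hopen : IsOpen (Metric.ball v₀ ε) := Metric.isOpen_ball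
    refine hopen.is_const_of_fderiv_eq_zero (𝕜 := ℝ) (convex_ball v₀ ε).isPreconnected
      (fun v hv => (hder0 v hv).differentiableAt.differentiableWithinAt)
      (fun v hv => (hder0 v hv).fderiv) hv (Metric.mem_ball_self hε)
  refine ⟨e.source ∩ e ⁻¹' (Metric.ball u₀ ε ×ˢ Metric.ball v₀ ε), ?_, ?_⟩
  · refine inter_mem (e.open_source.mem_nhds hx₀) ((e.continuousAt hx₀) ?_)
    rw [heΦ, hΦ₀, ball_prod_same]
    exact Metric.ball_mem_nhds _ hε
  · have hsub : f '' (e.source ∩ e ⁻¹' (Metric.ball u₀ ε ×ˢ Metric.ball v₀ ε)) ⊆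
        (fun u => f (e.symm (u, v₀))) '' Metric.ball u₀ ε := by
      rintro _ ⟨x, ⟨hxs, hxb⟩, rfl⟩
      refine ⟨(e x).1, hxb.1, ?_⟩
      change f (e.symm ((e x).1, v₀)) = f x
      rw [← hconst _ hxb.1 _ hxb.2]
      congr 1
      exact e.left_inv hxs
    have hsm : ContDiffOn ℝ 1 (fun u => f (e.symm (u, v₀))) (Metric.ball u₀ ε) := by
      intro u hu
      have h1 := (hball (u, v₀) ⟨hu, Metric.mem_ball_self hε⟩).2.1
      have h2 : ContDiffAt ℝ 1 (fun u : R => (u, v₀)) u := contDiffAt_id.prodMk contDiffAt_const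
      exact (hf.contDiffAt.comp u (h1.comp u h2)).contDiffWithinAt
    calc dimH (f '' (e.source ∩ e ⁻¹' (Metric.ball u₀ ε ×ˢ Metric.ball v₀ ε)))
        ≤ dimH ((fun u => f (e.symm (u, v₀))) '' Metric.ball u₀ ε) := dimH_mono hsub
      _ ≤ dimH (Metric.ball u₀ ε) := hsm.dimH_image_le (convex_ball _ _) Subset.rfl
      _ ≤ dimH (univ : Set R) := dimH_mono (subset_univ _)
      _ = r := by rw [Real.dimH_univ_eq_finrank, hR, hr x₀]

/-- The image of a continuously differentiable map of constant rank `r` has dimension `r`. -/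
theorem dimH_range_of_constant_rank {f : E → F} (hf : ContDiff ℝ 1 f) {r : ℕ}
    (hr : ∀ x, finrank ℝ (LinearMap.range (fderiv ℝ f x).toLinearMap) = r) :
    dimH (range f) = r := by
  refine le_antisymm ?_ (hr 0 ▸ finrank_range_fderiv_le_dimH hf 0)
  choose U hU hUr using exists_mem_nhds_dimH_image_le hf hr
  obtain ⟨s, hs, hcover⟩ := TopologicalSpace.countable_cover_nhds hU
  rw [← image_univ, ← hcover, image_iUnion₂, dimH_bUnion hs]
  exact iSup₂_le fun x _ => hUr x

end ConstantRank

end SignatureGroup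

end

noncomputable section

namespace SignatureGroup

open Module Set Filter Topology

/-! ### Truncated exponential series and their derivative. -/

section TruncatedExp

variable {A : Type*} [Ring A] [Algebra ℝ A]

/-- The exponential series, truncated after `P` terms. -/
def truncExp (P : ℕ) (x : A) : A := ∑ n ∈ Finset.range P, ((n.factorial : ℝ)⁻¹) • x ^ n

/-- The series `(e^x - 1) / x`, truncated after `P` terms. -/
def truncExpDiv (P : ℕ) (x : A) : A :=
  ∑ n ∈ Finset.range P, (((n + 1).factorial : ℝ)⁻¹) • x ^ n

theorem isNilpotent_sum_smul_pow {x : A} (hx : IsNilpotent x) (P : ℕ) (c : ℕ → ℝ) :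
    IsNilpotent (∑ n ∈ Finset.range P, c n • x ^ (n + 1)) := by
  have h : ∑ n ∈ Finset.range P, c n • x ^ (n + 1) =
      x * ∑ n ∈ Finset.range P, c n • x ^ n := by
    rw [Finset.mul_sum]
    exact Finset.sum_congr rfl fun n _ => by rw [mul_smul_comm, pow_succ']
  rw [h]
  refine Commute.isNilpotent_mul_right ?_ hx
  exact Commute.sum_right _ _ _ fun n _ => ((Commute.refl x).pow_right n).smul_right _

theorem isUnit_truncExp {x : A} (hx : IsNilpotent x) (P : ℕ) : IsUnit (truncExp (P + 1) x) := by
  rw [truncExp, Finset.sum_range_succ']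
  simpa using (isNilpotent_sum_smul_pow hx P fun n => ((n + 1).factorial : ℝ)⁻¹).isUnit_add_one

theorem isUnit_truncExpDiv {x : A} (hx : IsNilpotent x) (P : ℕ) :
    IsUnit (truncExpDiv (P + 1) x) := by
  rw [truncExpDiv, Finset.sum_range_succ']
  simpa using
    (isNilpotent_sum_smul_pow hx P fun n => ((n + 1 + 1).factorial : ℝ)⁻¹).isUnit_add_one

theorem truncExp_eq_of_pow_eq_zero {x : A} {M P : ℕ} (hx : x ^ M = 0) (hP : M ≤ P) :
    truncExp P x = truncExp M x := by
  refine (Finset.sum_subset (Finset.range_mono hP) fun n _ hn => ?_).symm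
  rw [pow_eq_zero_of_le (by simpa using hn) hx, smul_zero]

/-- The derivative of the `n`-th power in terms of iterated commutators `D k = (ad x)^k y`. -/
theorem sum_pow_mul_mul_pow {A : Type*} [Ring A] (x : A) (D : ℕ → A) (hD : ∀ k, D (k + 1) = x * D k - D k * x) (n : ℕ) :
    ∑ i ∈ Finset.range n, x ^ (n - 1 - i) * D 0 * x ^ i =
      ∑ k ∈ Finset.range n, n.choose (k + 1) • (D k * x ^ (n - 1 - k)) := by
  -- Moving `x` past `D k` creates the next commutator; collecting terms is then Pascal's rule.
  have hrec : ∀ k, x * D k = D (k + 1) + D k * x := fun k => by rw [hD]; abel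
  induction n with
  | zero => simp
  | succ n ih =>
    have h1 : ∑ i ∈ Finset.range (n + 1), x ^ (n + 1 - 1 - i) * D 0 * x ^ i =
        x * (∑ i ∈ Finset.range n, x ^ (n - 1 - i) * D 0 * x ^ i) + D 0 * x ^ n := by
      rw [Finset.sum_range_succ, Finset.mul_sum]
      congr 1
      · refine Finset.sum_congr rfl fun i hi => ?_
        have : n + 1 - 1 - i = (n - 1 - i) + 1 := by have := Finset.mem_range.1 hi; omega
        rw [this, pow_succ']
        simp only [mul_assoc]
      · simp
    have h2 : x * ∑ k ∈ Finset.range n, n.choose (k + 1) • (D k * x ^ (n - 1 - k)) =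
        ∑ k ∈ Finset.range n, n.choose (k + 1) • (D (k + 1) * x ^ (n - 1 - k)) +
        ∑ k ∈ Finset.range n, n.choose (k + 1) • (D k * x ^ (n - k)) := by
      rw [Finset.mul_sum, ← Finset.sum_add_distrib]
      refine Finset.sum_congr rfl fun k hk => ?_
      have : n - k = (n - 1 - k) + 1 := by have := Finset.mem_range.1 hk; omega
      rw [mul_smul_comm, ← mul_assoc, hrec, add_mul, smul_add, this, pow_succ', mul_assoc]
    have h3 : ∑ k ∈ Finset.range n, n.choose (k + 1) • (D k * x ^ (n - k)) =
        ∑ k ∈ Finset.range (n + 1), n.choose (k + 1) • (D k * x ^ (n - k)) := by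
      rw [Finset.sum_range_succ]; simp
    have h4 : ∑ k ∈ Finset.range n, n.choose (k + 1) • (D (k + 1) * x ^ (n - 1 - k)) +
        D 0 * x ^ n = ∑ k ∈ Finset.range (n + 1), n.choose k • (D k * x ^ (n - k)) := by
      rw [Finset.sum_range_succ']
      simp only [Nat.choose_zero_right, one_smul, Nat.sub_zero]
      congr 1
      refine Finset.sum_congr rfl fun k hk => ?_
      rw [show n - (k + 1) = n - 1 - k by omega]
    rw [h1, ih, h2, add_right_comm, h4, h3, ← Finset.sum_add_distrib]
    refine Finset.sum_congr rfl fun k _ => ?_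
    rw [Nat.choose_succ_succ, add_smul, Nat.add_sub_cancel]

/-- The derivative of the exponential series at a nilpotent element `x` in the direction `D 0`, in
terms of the iterated commutators `D k = (ad x)^k (D 0)`. -/
theorem deriv_truncExp (x : A) (D : ℕ → A) (hD : ∀ k, D (k + 1) = x * D k - D k * x) {M : ℕ}
    (hx : x ^ M = 0) (hDM : ∀ k, M ≤ k → D k = 0) :
    ∑ n ∈ Finset.range (2 * M + 1),
        ((n.factorial : ℝ)⁻¹) • ∑ i ∈ Finset.range n, x ^ (n - 1 - i) * D 0 * x ^ i =
      (∑ k ∈ Finset.range M, (((k + 1).factorial : ℝ)⁻¹) • D k) * truncExp M x := by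
  -- The binomial coefficient divided by (n + 1)! splits as 1/(k + 1)! times 1/m! with k + m = n, so
  -- the double sum is a product of two series. The range up to 2M contains every pair k, m < M; all
  -- other terms vanish.
  let g : ℕ → ℕ → A := fun k m =>
    (((k + 1).factorial : ℝ)⁻¹ * ((m.factorial : ℝ)⁻¹)) • (D k * x ^ m)
  have h1 : ∀ n ∈ Finset.range (2 * M), (((n + 1).factorial : ℝ)⁻¹) •
      ∑ i ∈ Finset.range (n + 1), x ^ (n + 1 - 1 - i) * D 0 * x ^ i =
      ∑ k ∈ Finset.range (n + 1), g k (n - k) := by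
    intro n _
    rw [sum_pow_mul_mul_pow x D hD, Finset.smul_sum]
    refine Finset.sum_congr rfl fun k hk => ?_
    have hk' : k + 1 ≤ n + 1 := by have := Finset.mem_range.1 hk; omega
    rw [← Nat.cast_smul_eq_nsmul ℝ, smul_smul, Nat.cast_choose ℝ hk', Nat.add_sub_cancel,
      Nat.add_sub_add_right]
    congr 1
    field_simp
  rw [Finset.sum_range_succ', Finset.sum_congr rfl h1, Finset.sum_range_diag_flip]
  simp only [Finset.range_zero, Finset.sum_empty, smul_zero, add_zero]
  rw [truncExp, Finset.sum_mul, two_mul, Finset.sum_range_add]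
  have h2 : ∑ k ∈ Finset.range M, ∑ m ∈ Finset.range (M + M - (M + k)), g (M + k) m = 0 :=
    Finset.sum_eq_zero fun k _ => Finset.sum_eq_zero fun m _ => by
      simp only [g]
      rw [hDM (M + k) (by omega), zero_mul, smul_zero]
  rw [h2, add_zero]
  refine Finset.sum_congr rfl fun k hk => ?_
  rw [Finset.mul_sum]
  have hle : M ≤ M + M - k := by have := Finset.mem_range.1 hk; omega
  rw [← Finset.sum_subset (Finset.range_mono hle) fun m _ hm => by
    simp only [g]
    rw [pow_eq_zero_of_le (by simpa using hm) hx, mul_zero, smul_zero]]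
  refine Finset.sum_congr rfl fun m _ => ?_
  simp only [g]
  rw [smul_mul_smul_comm]

end TruncatedExp

/-! ### Orbits of a nilpotent Lie algebra in coordinates. -/

section OrbitDimension

variable {E : Type*} [NormedAddCommGroup E] [NormedSpace ℝ E]

theorem contDiff_truncExp (a : E →L[ℝ] E →L[ℝ] E) (P : ℕ) :
    ContDiff ℝ 1 fun x => truncExp P (-a x) := by
  unfold truncExp
  refine ContDiff.sum fun n _ => ContDiff.const_smul _ ?_
  exact (a.contDiff.neg).pow n

/-- The derivative of `x ↦ exp (-ad x)`. -/
theorem fderiv_truncExp (a : E →L[ℝ] E →L[ℝ] E) (M : ℕ)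
    (hjac : ∀ x y, a (a x y) = a x * a y - a y * a x) (hnil : ∀ x, (-a x) ^ M = 0) (x z : E) :
    fderiv ℝ (fun x => truncExp (2 * M + 1) (-a x)) x z =
      -a (truncExpDiv M (-a x) z) * truncExp M (-a x) := by
  -- Because `a` respects brackets, the iterated commutators of `-a x` with `-a z` are again values
  -- of `-a`.
  let D : ℕ → E →L[ℝ] E := fun k => -a (((-a x) ^ k) z)
  have hD : ∀ k, D (k + 1) = (-a x) * D k - D k * (-a x) := by
    intro k
    have h : ((-a x) ^ (k + 1)) z = -(a x (((-a x) ^ k) z)) := by rw [pow_succ']; rfl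
    simp only [D]
    rw [h, map_neg, hjac]
    noncomm_ring
  have hDM : ∀ k, M ≤ k → D k = 0 := fun k hk => by
    simp only [D]
    rw [pow_eq_zero_of_le hk (hnil x)]
    simp
  have h5 := deriv_truncExp (-a x) D hD (hnil x) hDM
  have h6 : ∑ k ∈ Finset.range M, (((k + 1).factorial : ℝ)⁻¹) • D k =
      -a (truncExpDiv M (-a x) z) := by
    simp only [D, truncExpDiv, sum_apply, map_sum, smul_neg, Finset.sum_neg_distrib, smul_apply,
      map_smul]
  rw [h6] at h5
  rw [← h5]
  have h1 : ∀ n, HasFDerivAt (fun x => (-a x) ^ n) _ x := fun n =>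
    (a.hasFDerivAt.neg (x := x)).pow' n
  have h2 := (HasFDerivAt.fun_sum (u := Finset.range (2 * M + 1)) fun n _ =>
    (h1 n).const_smul ((n.factorial : ℝ)⁻¹)).fderiv
  refine (congrArg (fun T : E →L[ℝ] E →L[ℝ] E => T z) h2).trans ?_
  rw [sum_apply]
  refine Finset.sum_congr rfl fun n _ => ?_
  rw [smul_apply, sum_apply]
  rfl

/-- Let `a` be the adjoint representation of a nilpotent Lie algebra `E`, and let `Y` span an ideal.
The restrictions to `Y` of the functionals in the coadjoint orbit of `ℓ` form a set whose dimension
is the rank of the form `ℓ [·, ·]` on `E × Y`. -/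
theorem dimH_range_orbit [FiniteDimensional ℝ E] (a : E →L[ℝ] E →L[ℝ] E) (M : ℕ)
    (hjac : ∀ x y, a (a x y) = a x * a y - a y * a x) (hnil : ∀ x, a x ^ M = 0)
    {σ : Type*} [Fintype σ] (Y : σ → E)
    (hY : ∀ x q, a x (Y q) ∈ Submodule.span ℝ (range Y)) (ℓ : E →L[ℝ] ℝ)
    (Λ : E →ₗ[ℝ] σ → ℝ) (hΛ : ∀ z q, Λ z q = ℓ (a z (Y q))) :
    dimH (range fun (x : E) (q : σ) => ℓ (truncExp M (-a x) (Y q))) =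
      finrank ℝ (LinearMap.range Λ) := by
  have hnil' : ∀ x, (-a x) ^ M = 0 := fun x => by rw [neg_pow, hnil, mul_zero]
  have htrunc : ∀ x, truncExp M (-a x) = truncExp (2 * M + 1) (-a x) := fun x =>
    (truncExp_eq_of_pow_eq_zero (hnil' x) (by omega)).symm
  simp only [htrunc]
  rcases Nat.eq_zero_or_pos M with rfl | hM
  -- For `M = 0` the nilpotency hypothesis says that the identity is zero.
  · have h1 : ∀ y : E, y = 0 := fun y => by
      have := congrArg (fun T : E →L[ℝ] E => T y) (hnil 0)
      simpa using this
    have : Subsingleton E := ⟨fun y z => (h1 y).trans (h1 z).symm⟩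
    have h2 : Λ = 0 := LinearMap.ext fun z => by rw [h1 z, map_zero, map_zero]
    rw [dimH_subsingleton (Set.subsingleton_range _), h2, LinearMap.range_zero, finrank_bot]
    simp
  set f : E → σ → ℝ := fun x q => ℓ (truncExp (2 * M + 1) (-a x) (Y q)) with hf
  -- the derivative
  have hcd : ContDiff ℝ 1 f := by
    rw [contDiff_pi]
    intro q
    exact ℓ.contDiff.comp ((contDiff_truncExp a _).clm_apply contDiff_const)
  have hder : ∀ x z q, fderiv ℝ f x z q =
      - ℓ (a (truncExpDiv M (-a x) z) (truncExp M (-a x) (Y q))) := by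
    intro x z q
    have h1 := ((contDiff_truncExp a (2 * M + 1)).differentiable one_ne_zero x).hasFDerivAt
    have h2 := (ℓ.hasFDerivAt.comp x (h1.clm_apply (hasFDerivAt_const (Y q) x))).fderiv
    have h3 : fderiv ℝ f x z q = fderiv ℝ (fun x => f x q) x z := by
      rw [fderiv_apply (hcd.differentiable one_ne_zero x) q]; rfl
    rw [h3]
    refine (congrArg (fun T : E →L[ℝ] ℝ => T z) h2).trans ?_
    have h4 := congrArg (fun T : E →L[ℝ] E => ℓ (T (Y q))) (fderiv_truncExp a M hjac hnil' x z)
    simpa using h4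
  refine dimH_range_of_constant_rank hcd fun x => ?_
  -- the rank of the derivative
  obtain ⟨P, rfl⟩ : ∃ P, M = P + 1 := ⟨M - 1, by omega⟩
  have hxn : IsNilpotent (-a x) := ⟨_, hnil' x⟩
  obtain ⟨u, hu⟩ := isUnit_truncExp hxn P
  obtain ⟨v, hv⟩ := isUnit_truncExpDiv hxn P
  set S := Submodule.span ℝ (range Y) with hS
  have haS : ∀ x, ∀ y ∈ S, a x y ∈ S := by
    intro x y hy
    have : S ≤ S.comap (a x).toLinearMap := by
      rw [hS, Submodule.span_le]; rintro _ ⟨q, rfl⟩; exact hY x q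
    exact this hy
  have huS : ∀ y ∈ S, (u : E →L[ℝ] E) y ∈ S := by
    intro y hy
    have hpow : ∀ n, ((-a x) ^ n) y ∈ S := by
      intro n
      induction n with
      | zero => simpa using hy
      | succ n ih =>
        rw [pow_succ']
        exact S.neg_mem (haS x _ ih)
    rw [hu, truncExp, sum_apply]
    exact Submodule.sum_mem _ fun n _ => Submodule.smul_mem _ _ (hpow n)
  have huinj : Function.Injective (u : E →L[ℝ] E) := by
    refine Function.LeftInverse.injective (g := ((u⁻¹ : (E →L[ℝ] E)ˣ) : E →L[ℝ] E)) fun y => ?_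
    rw [← mul_apply_eq_comp, Units.inv_mul]; rfl
  have hvinj : Function.Injective (v : E →L[ℝ] E) := by
    refine Function.LeftInverse.injective (g := ((v⁻¹ : (E →L[ℝ] E)ˣ) : E →L[ℝ] E)) fun y => ?_
    rw [← mul_apply_eq_comp, Units.inv_mul]; rfl
  have huS' : S.map (u : E →L[ℝ] E).toLinearMap = S := by
    refine Submodule.eq_of_le_of_finrank_eq ?_ ?_
    · rintro _ ⟨y, hy, rfl⟩; exact huS y hy
    · exact (LinearEquiv.finrank_eq (Submodule.equivMapOfInjective _ huinj S)).symm
  -- The derivative in direction `z` has coordinates -ℓ([v z, u Y_q]). The unit `u` maps the ideal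
  -- `S` onto itself, so it does not affect whether all of them vanish. Only the change of variable
  -- `v` remains, and it preserves the dimension of the kernel.
  have hker : LinearMap.ker (fderiv ℝ f x).toLinearMap =
      (LinearMap.ker Λ).comap (v : E →L[ℝ] E).toLinearMap := by
    ext z
    have e1 : z ∈ LinearMap.ker (fderiv ℝ f x).toLinearMap ↔
        S.map (u : E →L[ℝ] E).toLinearMap ≤
          LinearMap.ker (ℓ.toLinearMap ∘ₗ (a ((v : E →L[ℝ] E) z)).toLinearMap) := by
      rw [hS, Submodule.map_span, Submodule.span_le, LinearMap.mem_ker, ← range_comp]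
      constructor
      · rintro h _ ⟨q, rfl⟩
        have := congrFun h q
        rw [ContinuousLinearMap.coe_coe, hder] at this
        rw [hu, hv]
        simpa using this
      · intro h
        funext q
        have := h ⟨q, rfl⟩
        rw [hu, hv] at this
        rw [ContinuousLinearMap.coe_coe, hder]
        simpa using this
    rw [e1, huS', hS, Submodule.span_le, Submodule.mem_comap, LinearMap.mem_ker]
    constructor
    · intro h
      funext q
      rw [hΛ]
      exact h ⟨q, rfl⟩
    · rintro h _ ⟨q, rfl⟩
      have := congrFun h q
      rw [hΛ] at this
      exact this
  have hcomap : finrank ℝ ((LinearMap.ker Λ).comap (v : E →L[ℝ] E).toLinearMap) =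
      finrank ℝ (LinearMap.ker Λ) := by
    let w := LinearEquiv.ofBijective (v : E →L[ℝ] E).toLinearMap
      ⟨hvinj, LinearMap.injective_iff_surjective.1 hvinj⟩
    exact LinearEquiv.finrank_eq (w.ofSubmodule' (LinearMap.ker Λ))
  have r1 := LinearMap.finrank_range_add_finrank_ker (fderiv ℝ f x).toLinearMap
  have r2 := LinearMap.finrank_range_add_finrank_ker Λ
  rw [hker, hcomap] at r1
  omega

end OrbitDimension

end SignatureGroup

end

noncomputable section

namespace SignatureGroup

open Module Set Filter Topology Polynomial

/-! ### Commuting Lie elements in the tensor algebra. -/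

section TensorAlgebra

variable {d : ℕ}

/-- The tensor algebra of `ℝ^d`. -/
abbrev Tens (d : ℕ) : Type := TensorAlgebra ℝ (Fin d → ℝ)

/-- The tensors of degree `n`. -/
abbrev homog (d n : ℕ) : Submodule ℝ (Tens d) :=
  LinearMap.range (TensorAlgebra.ι ℝ : (Fin d → ℝ) →ₗ[ℝ] Tens d) ^ n

/-- The algebra homomorphism that multiplies tensors of degree `n` by the `n`-th power of a
variable. -/
def degHom (d : ℕ) : Tens d →ₐ[ℝ] (Tens d)[X] :=
  TensorAlgebra.lift ℝ
    (((LinearMap.mulLeft ℝ (X : (Tens d)[X])).comp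
      (Polynomial.CAlgHom (R := ℝ) (A := Tens d)).toLinearMap).comp (TensorAlgebra.ι ℝ))

theorem degHom_ι (v : Fin d → ℝ) : degHom d (TensorAlgebra.ι ℝ v) = C (TensorAlgebra.ι ℝ v) * X := by
  simp [degHom, X_mul_C]

theorem degHom_of_mem_homog {n : ℕ} {x : Tens d} (hx : x ∈ homog d n) :
    degHom d x = C x * X ^ n := by
  induction n generalizing x with
  | zero =>
    rw [homog, pow_zero, Submodule.mem_one] at hx
    obtain ⟨r, rfl⟩ := hx
    simp
  | succ n ih =>
    rw [homog, pow_succ] at hx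
    induction hx using Submodule.mul_induction_on' with
    | mem_mul_mem a ha b hb =>
      obtain ⟨v, rfl⟩ := hb
      rw [map_mul, ih ha, degHom_ι, C_mul, pow_succ, mul_assoc, ← mul_assoc (X ^ n) (C _) X,
        X_pow_mul_C]
      simp only [mul_assoc]
    | add a _ b _ iha ihb => rw [map_add, iha, ihb, C_add, add_mul]

theorem coeff_zero_degHom (x : Tens d) :
    (degHom d x).coeff 0 = algebraMap ℝ (Tens d) (TensorAlgebra.algebraMapInv x) := by
  let ev : (Tens d)[X] →+* Tens d := Polynomial.constantCoeff
  let evA : (Tens d)[X] →ₐ[ℝ] Tens d := { ev with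
    commutes' := fun r => by simp [ev, Polynomial.algebraMap_apply] }
  have h : evA.comp (degHom d) = (Algebra.ofId ℝ (Tens d)).comp TensorAlgebra.algebraMapInv := by
    ext v
    simp [evA, ev, degHom_ι, TensorAlgebra.algebraMapInv, Algebra.ofId_apply]
  exact DFunLike.congr_fun h x

/-- The constant coefficient of `degHom d b` is the augmentation of `b`, so each factor from the
augmentation ideal contributes one power of the variable. -/
theorem degHom_of_mem_augIdeal_pow {n : ℕ} {x : Tens d} (hx : x ∈ augIdeal d ^ n) :
    ∃ y, degHom d x = y * X ^ n := by
  induction n generalizing x with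
  | zero => exact ⟨degHom d x, by simp⟩
  | succ n ih =>
    rw [Submodule.pow_succ] at hx
    induction hx using Submodule.mul_induction_on' with
    | mem_mul_mem a ha b hb =>
      obtain ⟨y, hy⟩ := ih ha
      have h0 : (degHom d b).coeff 0 = 0 := by
        rw [coeff_zero_degHom, show TensorAlgebra.algebraMapInv b = 0 from hb, map_zero]
      obtain ⟨z, hz⟩ := X_dvd_iff.2 h0
      refine ⟨y * z, ?_⟩
      rw [map_mul, hy, hz, mul_assoc, ← mul_assoc (X ^ n), ← pow_succ, X_pow_mul, ← mul_assoc]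
    | add a _ b _ iha ihb =>
      obtain ⟨y, hy⟩ := iha
      obtain ⟨z, hz⟩ := ihb
      exact ⟨y + z, by rw [map_add, hy, hz, add_mul]⟩

/-- A tensor of degree `n` that vanishes modulo tensors of higher degree is zero. -/
theorem eq_zero_of_mem_homog_of_mem_augIdeal_pow {n N : ℕ} {x : Tens d} (hn : n < N)
    (hx : x ∈ homog d n) (hx' : x ∈ augIdeal d ^ N) : x = 0 := by
  obtain ⟨y, hy⟩ := degHom_of_mem_augIdeal_pow hx'
  have h := congrArg (fun p : (Tens d)[X] => p.coeff n) ((degHom_of_mem_homog hx).symm.trans hy)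
  simpa [coeff_C_mul_X_pow, coeff_mul_X_pow', not_le.2 hn] using h

theorem homog_le_augIdeal_pow {n : ℕ} {x : Tens d} (hx : x ∈ homog d n) : x ∈ augIdeal d ^ n := by
  induction n generalizing x with
  | zero => rw [Submodule.pow_zero, Ideal.one_eq_top]; trivial
  | succ n ih =>
    rw [homog, pow_succ] at hx
    rw [Submodule.pow_succ]
    induction hx using Submodule.mul_induction_on' with
    | mem_mul_mem a ha b hb =>
      obtain ⟨v, rfl⟩ := hb
      refine Ideal.mul_mem_mul (ih ha) ?_
      simp [augIdeal, RingHom.mem_ker, TensorAlgebra.algebraMapInv]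
    | add a _ b _ iha ihb => exact add_mem iha ihb

/-! ### Commuting tensors of the same degree -/

/-- Tensors as combinations of words. -/
def wordEquiv (d : ℕ) : Tens d ≃ₐ[ℝ] MonoidAlgebra ℝ (FreeMonoid (Fin d)) :=
  (TensorAlgebra.equivFreeAlgebra (Pi.basisFun ℝ (Fin d))).trans
    FreeAlgebra.equivMonoidAlgebraFreeMonoid

theorem exists_of_coeff_mul_ne_zero {M : Type*} [Mul M] {x y : MonoidAlgebra ℝ M} {w : M}
    (h : (x * y).coeff w ≠ 0) : ∃ u v, u * v = w ∧ x.coeff u ≠ 0 ∧ y.coeff v ≠ 0 := by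
  classical
  rw [MonoidAlgebra.coeff_mul] at h
  obtain ⟨u, hu, h⟩ := Finset.exists_ne_zero_of_sum_ne_zero h
  obtain ⟨v, hv, h⟩ := Finset.exists_ne_zero_of_sum_ne_zero h
  refine ⟨u, v, ?_, Finsupp.mem_support_iff.1 hu, Finsupp.mem_support_iff.1 hv⟩
  by_contra hne
  exact h (if_neg hne)

theorem length_of_coeff_ne_zero {n : ℕ} {x : Tens d} (hx : x ∈ homog d n)
    (w : FreeMonoid (Fin d)) (hw : (wordEquiv d x).coeff w ≠ 0) : w.length = n := by
  induction n generalizing x w with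
  | zero =>
    rw [homog, pow_zero, Submodule.mem_one] at hx
    obtain ⟨r, rfl⟩ := hx
    by_contra hne
    apply hw
    rw [AlgEquiv.commutes, MonoidAlgebra.coe_algebraMap]
    refine Finsupp.single_eq_of_ne fun h => hne ?_
    rw [h]; rfl
  | succ n ih =>
    rw [homog, pow_succ] at hx
    induction hx using Submodule.mul_induction_on' with
    | mem_mul_mem a ha b hb =>
      obtain ⟨v, rfl⟩ := hb
      rw [map_mul] at hw
      obtain ⟨u, v', rfl, hu, hv⟩ := exists_of_coeff_mul_ne_zero hw
      rw [FreeMonoid.length_mul, ih ha u hu]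
      congr 1
      have h1 : wordEquiv d (TensorAlgebra.ι ℝ v) =
          ∑ i, v i • MonoidAlgebra.single (FreeMonoid.of i) (1 : ℝ) := by
        conv_lhs => rw [← (Pi.basisFun ℝ (Fin d)).sum_repr v]
        simp only [map_sum, map_smul]
        refine Finset.sum_congr rfl fun i _ => ?_
        rw [wordEquiv, AlgEquiv.trans_apply, TensorAlgebra.equivFreeAlgebra_ι_apply]
        simp [FreeAlgebra.equivMonoidAlgebraFreeMonoid, MonoidAlgebra.of]
      rw [h1, MonoidAlgebra.coeff_sum, Finsupp.finsetSum_apply] at hv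
      obtain ⟨i, -, hi⟩ := Finset.exists_ne_zero_of_sum_ne_zero hv
      by_contra hne
      apply hi
      rw [MonoidAlgebra.coeff_smul_apply, MonoidAlgebra.coeff_single,
        Finsupp.single_eq_of_ne, smul_zero]
      rintro rfl
      exact hne (FreeMonoid.length_of i)
    | add a _ b _ iha ihb =>
      by_cases h : (wordEquiv d a).coeff w = 0
      · refine ihb fun h' => hw ?_
        rw [map_add, MonoidAlgebra.coeff_add, Finsupp.add_apply, h, h', add_zero]
      · exact iha h

/-- A word splits in only one way once the length of its prefix is prescribed, so the convolution
has a single term. -/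
theorem coeff_mul_of_length {n : ℕ} {x y : MonoidAlgebra ℝ (FreeMonoid (Fin d))}
    (hx : ∀ w, x.coeff w ≠ 0 → w.length = n) {u v : FreeMonoid (Fin d)} (hu : u.length = n) :
    (x * y).coeff (u * v) = x.coeff u * y.coeff v := by
  classical
  have key : ∀ u' v' : FreeMonoid (Fin d), x.coeff u' ≠ 0 → u' * v' = u * v → u' = u ∧ v' = v := by
    intro u' v' hu' h
    exact List.append_inj h ((hx u' hu').trans hu.symm)
  rw [MonoidAlgebra.coeff_mul, Finsupp.sum, Finset.sum_eq_single u, Finsupp.sum,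
    Finset.sum_eq_single v]
  · rw [if_pos rfl]
  · intro v' _ hne
    by_cases h0 : x.coeff u = 0
    · rw [h0, zero_mul, ite_self]
    · exact if_neg fun h => hne (key u v' h0 h).2
  · intro hv
    rw [Finsupp.notMem_support_iff.1 hv, mul_zero, ite_self]
  · intro u' hu' hne
    refine Finset.sum_eq_zero fun v' _ => if_neg fun h => hne ?_
    exact (key u' v' (Finsupp.mem_support_iff.1 hu') h).1
  · intro hu'
    refine Finset.sum_eq_zero fun v' _ => ?_
    simp only [Finsupp.notMem_support_iff.1 hu', zero_mul, ite_self]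

/-- Commuting tensors of the same degree are proportional. -/
theorem exists_smul_eq_of_commute {n : ℕ} {x y : Tens d} (hx : x ∈ homog d n)
    (hy : y ∈ homog d n) (hxy : x * y = y * x) (hx0 : x ≠ 0) : ∃ c : ℝ, y = c • x := by
  have hlx := length_of_coeff_ne_zero hx
  have hly := length_of_coeff_ne_zero hy
  have hx1 : (wordEquiv d x).coeff ≠ 0 := by
    rw [Ne, MonoidAlgebra.coeff_eq_zero]
    simpa using hx0
  obtain ⟨u, hu⟩ := Finsupp.ne_iff.1 hx1
  refine ⟨(wordEquiv d y).coeff u / (wordEquiv d x).coeff u, (wordEquiv d).injective ?_⟩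
  rw [map_smul, ← MonoidAlgebra.coeff_inj]
  ext w
  -- The coefficient of the word `u * w` on the two sides gives x_u y_w = y_u x_w for every `w`.
  have h := congrArg (fun z => (wordEquiv d z).coeff (u * w)) hxy
  simp only [map_mul] at h
  rw [coeff_mul_of_length hlx (hlx u hu), coeff_mul_of_length hly (hlx u hu)] at h
  rw [MonoidAlgebra.coeff_smul_apply, smul_eq_mul, div_mul_eq_mul_div, eq_div_iff hu, ← h, mul_comm]

/-! ### Lie elements of the tensor algebra -/

/-- The Lie elements of degree `k`. -/
def lieHomog (d : ℕ) : ℕ → Submodule ℝ (Tens d)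
  | 0 => ⊥
  | 1 => LinearMap.range (TensorAlgebra.ι ℝ)
  | k + 2 => Submodule.span ℝ {z | ∃ v : Fin d → ℝ, ∃ y ∈ lieHomog d (k + 1),
      z = TensorAlgebra.ι ℝ v * y - y * TensorAlgebra.ι ℝ v}

theorem lieHomog_induction {C : ℕ → Tens d → Prop} (h1 : ∀ v, C 1 (TensorAlgebra.ι ℝ v))
    (h0 : ∀ k, C k 0) (hadd : ∀ k x y, C k x → C k y → C k (x + y))
    (hsmul : ∀ k (c : ℝ) x, C k x → C k (c • x))
    (hlie : ∀ k v y, C k y → C (k + 1) (TensorAlgebra.ι ℝ v * y - y * TensorAlgebra.ι ℝ v))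
    {k : ℕ} {x : Tens d} (hx : x ∈ lieHomog d k) : C k x := by
  induction k using Nat.strong_induction_on generalizing x with
  | _ k ih =>
    match k, ih, hx with
    | 0, _, hx => rw [(Submodule.mem_bot ℝ).1 hx]; exact h0 0
    | 1, _, hx => obtain ⟨v, rfl⟩ := hx; exact h1 v
    | k + 2, ih, hx =>
      have key : ∀ z ∈ Submodule.span ℝ {z | ∃ v : Fin d → ℝ, ∃ y ∈ lieHomog d (k + 1),
          z = TensorAlgebra.ι ℝ v * y - y * TensorAlgebra.ι ℝ v}, C (k + 2) z := by
        intro z hz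
        induction hz using Submodule.span_induction with
        | mem z hz =>
          obtain ⟨v, y, hy, rfl⟩ := hz
          exact hlie (k + 1) v y (ih (k + 1) (by omega) hy)
        | zero => exact h0 _
        | add a b _ _ iha ihb => exact hadd _ _ _ iha ihb
        | smul c a _ iha => exact hsmul _ _ _ iha
      exact key x hx

theorem lieHomog_le_homog {k : ℕ} {x : Tens d} (hx : x ∈ lieHomog d k) : x ∈ homog d k := by
  refine lieHomog_induction (C := fun k x => x ∈ homog d k) ?_ (fun k => zero_mem _)
    (fun k x y => add_mem) (fun k c x => Submodule.smul_mem _ c) ?_ hx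
  · intro v
    rw [homog, pow_one]
    exact ⟨v, rfl⟩
  · intro k v y hy
    refine sub_mem ?_ ?_
    · rw [homog, pow_succ']
      exact Submodule.mul_mem_mul ⟨v, rfl⟩ hy
    · rw [homog, pow_succ]
      exact Submodule.mul_mem_mul hy ⟨v, rfl⟩

theorem layer_eq_map (d N : ℕ) : ∀ k, layer d N k =
    (lieHomog d k).map (Ideal.Quotient.mkₐ ℝ ((augIdeal d) ^ (N + 1))).toLinearMap
  | 0 => by rw [layer, lieHomog, Submodule.map_bot]
  | 1 => by rw [layer, lieHomog, incl, LinearMap.range_comp]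
  | k + 2 => by
    rw [layer, lieHomog, Submodule.map_span, layer_eq_map d N (k + 1)]
    congr 1
    ext z
    constructor
    · rintro ⟨v, _, ⟨y, hy, rfl⟩, rfl⟩
      exact ⟨_, ⟨v, y, hy, rfl⟩, by simp [incl, LieRing.of_associative_ring_bracket]⟩
    · rintro ⟨_, ⟨v, y, hy, rfl⟩, rfl⟩
      exact ⟨v, _, ⟨y, hy, rfl⟩, by simp [incl, LieRing.of_associative_ring_bracket]⟩

/-! ### The coproduct, truncated in the first factor -/

open scoped TensorProduct

/-- The coproduct `v ↦ v ⊗ 1 + 1 ⊗ v` with the first factor truncated. -/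
def truncCoproduct (d p : ℕ) : Tens d →ₐ[ℝ] TruncTensor d p ⊗[ℝ] Tens d :=
  TensorAlgebra.lift ℝ
    (((TensorProduct.mk ℝ (TruncTensor d p) (Tens d)).flip 1).comp (incl d p) +
      (TensorProduct.mk ℝ (TruncTensor d p) (Tens d) 1).comp (TensorAlgebra.ι ℝ))

/-- Lie elements are primitive. -/
theorem truncCoproduct_of_mem_lieHomog (p : ℕ) {k : ℕ} {x : Tens d} (hx : x ∈ lieHomog d k) :
    truncCoproduct d p x = Ideal.Quotient.mkₐ ℝ ((augIdeal d) ^ (p + 1)) x ⊗ₜ 1 + 1 ⊗ₜ x := by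
  have hι : ∀ v, truncCoproduct d p (TensorAlgebra.ι ℝ v) = Ideal.Quotient.mkₐ ℝ
      ((augIdeal d) ^ (p + 1)) (TensorAlgebra.ι ℝ v) ⊗ₜ 1 + 1 ⊗ₜ (TensorAlgebra.ι ℝ v) := by
    intro v
    simp [truncCoproduct, incl]
  refine lieHomog_induction (C := fun _ x => truncCoproduct d p x =
    Ideal.Quotient.mkₐ ℝ ((augIdeal d) ^ (p + 1)) x ⊗ₜ 1 + 1 ⊗ₜ x) hι ?_ ?_ ?_ ?_ hx
  · intro k; simp
  · intro k x y hx hy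
    rw [map_add, hx, hy, map_add, TensorProduct.add_tmul, TensorProduct.tmul_add]
    abel
  · intro k c x hx
    rw [map_smul, hx, map_smul, smul_add, TensorProduct.smul_tmul', TensorProduct.tmul_smul]
  · intro k v y hy
    rw [map_sub, map_mul, map_mul, hι, hy]
    simp only [map_sub, map_mul, add_mul, mul_add, Algebra.TensorProduct.tmul_mul_tmul, one_mul,
      mul_one, TensorProduct.sub_tmul, TensorProduct.tmul_sub]
    abel

/-- This is the binomial theorem for the commuting elements a ⊗ 1 and 1 ⊗ b, cut off after the
linear term by a² = 0. -/
theorem tmul_one_add_one_tmul_pow {A B : Type*} [Ring A] [Algebra ℝ A] [Ring B] [Algebra ℝ B]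
    {a : A} (ha : a * a = 0) (b : B) (n : ℕ) :
    (a ⊗ₜ[ℝ] (1 : B) + 1 ⊗ₜ b) ^ (n + 1) = 1 ⊗ₜ (b ^ (n + 1)) + ((n + 1 : ℕ) : ℝ) • (a ⊗ₜ (b ^ n)) := by
  induction n with
  | zero => simp [add_comm]
  | succ n ih =>
    rw [pow_succ, ih]
    simp only [mul_add, add_mul, Algebra.TensorProduct.tmul_mul_tmul, one_mul, mul_one,
      smul_mul_assoc, ha, TensorProduct.zero_tmul, smul_zero, ← pow_succ]
    push_cast
    module

theorem tmul_ne_zero {A B : Type*} [AddCommGroup A] [Module ℝ A] [AddCommGroup B] [Module ℝ B]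
    {a : A} {b : B} (ha : a ≠ 0) (hb : b ≠ 0) : a ⊗ₜ[ℝ] b ≠ 0 := by
  obtain ⟨φ, hφ⟩ := Module.Projective.exists_dual_ne_zero ℝ ha
  intro h
  have := congrArg ((TensorProduct.lid ℝ B).toLinearMap ∘ₗ TensorProduct.map φ LinearMap.id) h
  simp [hφ, hb] at this

/-- Commuting Lie elements of different degree: one of them vanishes. -/
theorem eq_zero_of_commute_of_lt {p q : ℕ} (hp : 1 ≤ p) (hpq : p < q) {x y : Tens d}
    (hx : x ∈ lieHomog d p) (hy : y ∈ lieHomog d q) (hxy : x * y = y * x) : x = 0 ∨ y = 0 := by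
  by_contra! hne
  obtain ⟨hx0, hy0⟩ := hne
  -- The powers x^q and y^p have the same degree and commute, hence are proportional.
  have hxq : x ^ q ∈ homog d (p * q) := by
    rw [homog, pow_mul]; exact Submodule.pow_mem_pow _ (lieHomog_le_homog hx) q
  have hyp : y ^ p ∈ homog d (p * q) := by
    rw [homog, mul_comm, pow_mul]; exact Submodule.pow_mem_pow _ (lieHomog_le_homog hy) p
  have hcomm : y ^ p * x ^ q = x ^ q * y ^ p := by
    have : Commute y x := hxy.symm
    exact (this.pow_pow p q)
  obtain ⟨c, hc⟩ := exists_smul_eq_of_commute hyp hxq hcomm (pow_ne_zero _ hy0)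
  -- Truncation above degree p kills y and x², but not x. The coproduct of x^q then contains q x ⊗
  -- x^(q-1), while that of y^p is just 1 ⊗ y^p; proportionality forces the extra term to vanish.
  set m := Ideal.Quotient.mkₐ ℝ ((augIdeal d) ^ (p + 1)) with hm
  have hmy : m y = 0 := by
    refine Ideal.Quotient.eq_zero_iff_mem.2 ?_
    have h := homog_le_augIdeal_pow (lieHomog_le_homog hy)
    exact Ideal.pow_le_pow_right (by omega : p + 1 ≤ q) h
  have hmx2 : m x * m x = 0 := by
    rw [← map_mul]
    refine Ideal.Quotient.eq_zero_iff_mem.2 ?_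
    have h : x * x ∈ homog d (p + p) := by
      rw [homog, pow_add]
      exact Submodule.mul_mem_mul (lieHomog_le_homog hx) (lieHomog_le_homog hx)
    exact Ideal.pow_le_pow_right (by omega : p + 1 ≤ p + p) (homog_le_augIdeal_pow h)
  have hmx : m x ≠ 0 := fun h => hx0 <|
    eq_zero_of_mem_homog_of_mem_augIdeal_pow (Nat.lt_succ_self p) (lieHomog_le_homog hx)
      (Ideal.Quotient.eq_zero_iff_mem.1 h)
  have hΔx := truncCoproduct_of_mem_lieHomog p hx
  have hΔy := truncCoproduct_of_mem_lieHomog p hy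
  rw [← hm] at hΔx hΔy
  rw [hmy, TensorProduct.zero_tmul, zero_add] at hΔy
  have h1 := congrArg (truncCoproduct d p) hc
  obtain ⟨n, rfl⟩ : ∃ n, q = n + 1 := ⟨q - 1, by omega⟩
  rw [map_smul, map_pow, map_pow, hΔx, hΔy] at h1
  have h2 := (tmul_one_add_one_tmul_pow hmx2 x n).symm.trans h1
  have h3 : c • ((1 : TruncTensor d p) ⊗ₜ[ℝ] y) ^ p = 1 ⊗ₜ (x ^ (n + 1)) := by
    rw [Algebra.TensorProduct.tmul_pow, one_pow, ← TensorProduct.tmul_smul, ← hc]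
  have h4 := add_eq_left.1 (h2.trans h3)
  rcases smul_eq_zero.1 h4 with h5 | h5
  · exact absurd h5 (by positivity)
  · exact tmul_ne_zero hmx (pow_ne_zero n hx0) h5

end TensorAlgebra

end SignatureGroup

end

noncomputable section

namespace SignatureGroup

open Module Set Filter Topology

/-! ### Commutation in the layers and comparison of their dimensions. -/

section Layers

variable {d N : ℕ}

theorem exists_lieHomog_of_mem_layer {k : ℕ} {x : TruncTensor d N} (hx : x ∈ layer d N k) :
    ∃ z ∈ lieHomog d k, Ideal.Quotient.mkₐ ℝ ((augIdeal d) ^ (N + 1)) z = x := by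
  rw [layer_eq_map] at hx
  obtain ⟨z, hz, rfl⟩ := hx
  exact ⟨z, hz, rfl⟩

theorem eq_zero_of_mk_eq_zero {k : ℕ} (hk : k ≤ N) {z : Tens d} (hz : z ∈ homog d k)
    (h : Ideal.Quotient.mkₐ ℝ ((augIdeal d) ^ (N + 1)) z = 0) : z = 0 :=
  eq_zero_of_mem_homog_of_mem_augIdeal_pow (Nat.lt_succ_of_le hk) hz
    (Ideal.Quotient.eq_zero_iff_mem.1 h)

theorem layer_eq_bot {k : ℕ} (hk : N < k) : layer d N k = ⊥ := by
  rw [eq_bot_iff]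
  intro x hx
  obtain ⟨z, hz, rfl⟩ := exists_lieHomog_of_mem_layer hx
  refine Ideal.Quotient.eq_zero_iff_mem.2 ?_
  exact Ideal.pow_le_pow_right (by omega : N + 1 ≤ k) (homog_le_augIdeal_pow (lieHomog_le_homog hz))

/-- The tensors representing two commuting elements of layers commute. -/
theorem exists_commute_of_lie_eq_zero {p q : ℕ} (hpq : p + q ≤ N) {x y : TruncTensor d N}
    (hx : x ∈ layer d N p) (hy : y ∈ layer d N q) (hxy : ⁅x, y⁆ = 0) :
    ∃ z ∈ lieHomog d p, ∃ w ∈ lieHomog d q, z * w = w * z ∧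
      Ideal.Quotient.mkₐ ℝ ((augIdeal d) ^ (N + 1)) z = x ∧
      Ideal.Quotient.mkₐ ℝ ((augIdeal d) ^ (N + 1)) w = y := by
  obtain ⟨z, hz, rfl⟩ := exists_lieHomog_of_mem_layer hx
  obtain ⟨w, hw, rfl⟩ := exists_lieHomog_of_mem_layer hy
  refine ⟨z, hz, w, hw, sub_eq_zero.1 (eq_zero_of_mk_eq_zero hpq ?_ ?_), rfl, rfl⟩
  · have h1 := Submodule.mul_mem_mul (lieHomog_le_homog hz) (lieHomog_le_homog hw)
    have h2 := Submodule.mul_mem_mul (lieHomog_le_homog hw) (lieHomog_le_homog hz)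
    rw [← pow_add] at h1 h2
    rw [add_comm q p] at h2
    exact sub_mem h1 h2
  · rw [map_sub, map_mul, map_mul]
    exact hxy

/-- Nonzero elements of different layers do not commute, unless their bracket is truncated. -/
theorem eq_zero_of_lie_eq_zero {p q : ℕ} (hp : 1 ≤ p) (hq : 1 ≤ q) (hpq : p + q ≤ N) (hne : p ≠ q)
    {x y : TruncTensor d N} (hx : x ∈ layer d N p) (hy : y ∈ layer d N q) (hxy : ⁅x, y⁆ = 0) :
    x = 0 ∨ y = 0 := by
  obtain ⟨z, hz, w, hw, hzw, rfl, rfl⟩ := exists_commute_of_lie_eq_zero hpq hx hy hxy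
  rcases lt_or_gt_of_ne hne with h | h
  · rcases eq_zero_of_commute_of_lt hp h hz hw hzw with rfl | rfl
    · exact Or.inl (map_zero _)
    · exact Or.inr (map_zero _)
  · rcases eq_zero_of_commute_of_lt hq h hw hz hzw.symm with rfl | rfl
    · exact Or.inr (map_zero _)
    · exact Or.inl (map_zero _)

/-- Commuting elements of the same layer are proportional, unless their bracket is truncated. -/
theorem exists_smul_of_lie_eq_zero {p : ℕ} (hp : p + p ≤ N) {x y : TruncTensor d N}
    (hx : x ∈ layer d N p) (hy : y ∈ layer d N p) (hxy : ⁅x, y⁆ = 0) (hx0 : x ≠ 0) :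
    ∃ c : ℝ, y = c • x := by
  obtain ⟨z, hz, w, hw, hzw, rfl, rfl⟩ := exists_commute_of_lie_eq_zero hp hx hy hxy
  have hz0 : z ≠ 0 := by rintro rfl; exact hx0 (map_zero _)
  obtain ⟨c, rfl⟩ := exists_smul_eq_of_commute (lieHomog_le_homog hz) (lieHomog_le_homog hw) hzw hz0
  exact ⟨c, map_smul _ _ _⟩

theorem incl_injective (hN : 1 ≤ N) : Function.Injective (incl d N) := by
  rw [← LinearMap.ker_eq_bot, LinearMap.ker_eq_bot']
  intro v hv
  have h1 : TensorAlgebra.ι ℝ v ∈ homog d 1 := by rw [homog, pow_one]; exact ⟨v, rfl⟩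
  exact (TensorAlgebra.ι_eq_zero_iff ℝ v).1 (eq_zero_of_mk_eq_zero hN h1 hv)

theorem finite_layer : ∀ k, Module.Finite ℝ (layer d N k)
  | 0 => by rw [layer]; infer_instance
  | 1 => by rw [layer]; infer_instance
  | k + 2 => by
    have h1 := finite_layer (k + 1)
    have h2 : layer d N (k + 2) = Submodule.map₂ (LinearMap.mk₂ ℝ
        (fun (v : Fin d → ℝ) (y : TruncTensor d N) => ⁅incl d N v, y⁆)
        (by simp) (by simp) (by simp) (by simp)) ⊤ (layer d N (k + 1)) := by
      rw [layer, Submodule.map₂_eq_span_image2]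
      congr 1
      ext z
      constructor
      · rintro ⟨v, y, hy, rfl⟩; exact ⟨v, trivial, y, hy, rfl⟩
      · rintro ⟨v, -, y, hy, rfl⟩; exact ⟨v, y, hy, rfl⟩
    rw [h2]
    exact Module.Finite.iff_fg.2 (Submodule.FG.map₂ _ Module.Finite.fg_top
      (Module.Finite.iff_fg.1 h1))

/-- Bracketing with a nonzero element of another layer is injective. -/
theorem layerDim_le_add {i j : ℕ} (hi : 1 ≤ i) (hj : 1 ≤ j) (hij : i + j ≤ N) (hne : i ≠ j)
    {u : TruncTensor d N} (hu : u ∈ layer d N i) (hu0 : u ≠ 0) :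
    layerDim d N j ≤ layerDim d N (i + j) := by
  have := finite_layer (d := d) (N := N) (i + j)
  have hmem : ∀ y ∈ layer d N j, LieAlgebra.ad ℝ (TruncTensor d N) u y ∈ layer d N (i + j) :=
    fun y hy => lie_mem_layer d N i j u y hu hy
  refine LinearMap.finrank_le_finrank_of_injective
    (f := (LieAlgebra.ad ℝ (TruncTensor d N) u).restrict hmem) ?_
  rw [← LinearMap.ker_eq_bot, LinearMap.ker_eq_bot']
  rintro ⟨y, hy⟩ h
  have h1 : ⁅u, y⁆ = 0 := congrArg Subtype.val h
  exact Subtype.ext ((eq_zero_of_lie_eq_zero hi hj hij hne hu hy h1).resolve_left hu0)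

theorem lie_incl_ne_zero (hN : 2 ≤ N) {v w : Fin d → ℝ} (hv : v ≠ 0) (hw : ∀ c : ℝ, w ≠ c • v) :
    ⁅incl d N v, incl d N w⁆ ≠ 0 := by
  intro h
  have hinj := incl_injective (d := d) (N := N) (by omega)
  obtain ⟨c, hc⟩ := exists_smul_of_lie_eq_zero (p := 1) hN ⟨v, rfl⟩ ⟨w, rfl⟩ h
    (fun h0 => hv (hinj (h0.trans (map_zero _).symm)))
  rw [← map_smul] at hc
  exact hw c (hinj hc)

theorem layerDim_one (hN : 1 ≤ N) : layerDim d N 1 = d := by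
  rw [layerDim, layer, LinearMap.finrank_range_of_inj (incl_injective hN)]
  simp

/-- The algebra endomorphism of the tensor algebra that sends `e_i` to `0`. -/
def killHom (i : Fin d) : Tens d →ₐ[ℝ] Tens d :=
  TensorAlgebra.lift ℝ ((TensorAlgebra.ι ℝ).comp
    (LinearMap.id - (LinearMap.single ℝ (fun _ => ℝ) i).comp (LinearMap.proj i)))

/-- The map v ↦ [e_0, v - v_0 e_0] + v_0 [e_1, e_2] is an injection of the first layer into the
second. The second term compensates for the kernel of the bracket with e_0 and needs a third
generator. -/
theorem layerDim_one_le_two (hd : 3 ≤ d) (hN : 2 ≤ N) : layerDim d N 1 ≤ layerDim d N 2 := by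
  have := finite_layer (d := d) (N := N) 2
  let i₀ : Fin d := ⟨0, by omega⟩
  let i₁ : Fin d := ⟨1, by omega⟩
  let i₂ : Fin d := ⟨2, by omega⟩
  have h10 : i₁ ≠ i₀ := by simp [i₀, i₁]
  have h20 : i₂ ≠ i₀ := by simp [i₀, i₂]
  have h21 : i₂ ≠ i₁ := by simp [i₁, i₂]
  let e : Fin d → Fin d → ℝ := fun i => Pi.single i 1
  let P : (Fin d → ℝ) →ₗ[ℝ] (Fin d → ℝ) :=
    LinearMap.id - (LinearMap.single ℝ (fun _ => ℝ) i₀).comp (LinearMap.proj i₀)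
  have hP0 : ∀ v, P v i₀ = 0 := fun v => by simp [P]
  let ι : (Fin d → ℝ) →ₗ[ℝ] Tens d := TensorAlgebra.ι ℝ
  let br : (Fin d → ℝ) → (Fin d → ℝ) → Tens d := fun v w => ι v * ι w - ι w * ι v
  let Ψ : (Fin d → ℝ) →ₗ[ℝ] TruncTensor d N :=
    (LieAlgebra.ad ℝ (TruncTensor d N) (incl d N (e i₀))).comp ((incl d N).comp P) +
      (LinearMap.proj i₀ : (Fin d → ℝ) →ₗ[ℝ] ℝ).smulRight ⁅incl d N (e i₁), incl d N (e i₂)⁆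
  have hΨ : ∀ v, Ψ v = ⁅incl d N (e i₀), incl d N (P v)⁆ +
      v i₀ • ⁅incl d N (e i₁), incl d N (e i₂)⁆ := fun v => rfl
  have hmem : ∀ v, Ψ v ∈ layer d N 2 := by
    intro v
    rw [hΨ]
    exact add_mem (lie_mem_layer d N 1 1 _ _ ⟨_, rfl⟩ ⟨_, rfl⟩)
      (Submodule.smul_mem _ _ (lie_mem_layer d N 1 1 _ _ ⟨_, rfl⟩ ⟨_, rfl⟩))
  have hker : ∀ v, Ψ v = 0 → v = 0 := by
    intro v hv
    have hv0 : v i₀ = 0 := by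
      have hbr : ∀ v w, br v w ∈ homog d 2 := by
        intro v w
        rw [homog, pow_two]
        exact sub_mem (Submodule.mul_mem_mul ⟨v, rfl⟩ ⟨w, rfl⟩)
          (Submodule.mul_mem_mul ⟨w, rfl⟩ ⟨v, rfl⟩)
      have h1 : br (e i₀) (P v) + v i₀ • br (e i₁) (e i₂) = 0 := by
        refine eq_zero_of_mk_eq_zero hN (add_mem (hbr _ _) (Submodule.smul_mem _ _ (hbr _ _))) ?_
        rw [hΨ] at hv
        simp only [map_add, map_smul, br, map_sub, map_mul]
        exact hv
      -- Setting e_0 to zero removes the first bracket and leaves v_0 [e_1, e_2].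
      have h2 := congrArg (killHom i₀) h1
      have hk : ∀ w, killHom i₀ (ι w) = ι (P w) := fun w => by
        simp only [killHom, ι, TensorAlgebra.lift_ι_apply]; rfl
      have hPe0 : P (e i₀) = 0 := by ext i; simp [P, e]
      have hPe : ∀ i, i ≠ i₀ → P (e i) = e i := fun i hi => by
        ext j; simp [P, e, Pi.single_eq_of_ne hi.symm]
      simp only [br, map_add, map_smul, map_sub, map_mul, hk, hPe0, hPe i₁ h10, hPe i₂ h20, map_zero,
        zero_mul, mul_zero, sub_zero, zero_add] at h2
      rcases smul_eq_zero.1 h2 with h3 | h3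
      · exact h3
      · exfalso
        refine lie_incl_ne_zero hN (v := e i₁) (w := e i₂) ?_ ?_ ?_
        · intro h; simpa [e] using congrFun h i₁
        · intro c h
          simpa [e, Pi.single_eq_of_ne h21] using congrFun h i₂
        · have h4 := congrArg (Ideal.Quotient.mkₐ ℝ ((augIdeal d) ^ (N + 1))) h3
          rw [map_sub, map_mul, map_mul, map_zero] at h4
          exact h4
    rw [hΨ, hv0, zero_smul, add_zero] at hv
    have hPv : P v = v := by ext i; simp [P, hv0]
    rw [hPv] at hv
    by_contra hne
    refine lie_incl_ne_zero hN (v := e i₀) (w := v) ?_ ?_ hv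
    · intro h; simpa [e] using congrFun h i₀
    · intro c h
      have hc : c = 0 := by simpa [e, hv0] using (congrFun h i₀).symm
      exact hne (by rw [h, hc, zero_smul])
  rw [layerDim_one (by omega), layerDim]
  have h := LinearMap.finrank_le_finrank_of_injective (f := Ψ.codRestrict (layer d N 2) hmem) (by
    rw [← LinearMap.ker_eq_bot, LinearMap.ker_eq_bot']
    intro v hv
    exact hker v (congrArg Subtype.val hv))
  simpa using h

/-- The dimensions of complementary layers are increasing. -/
theorem layerDim_le_layerDim_sub (hd : 1 ≤ d) (hexc : ¬ (N = 3 ∧ d = 2)) (hd1 : d = 1 → N ≤ 2)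
    {j : ℕ} (hj : 2 * j ≤ N) : layerDim d N j ≤ layerDim d N (N - j) := by
  rcases Nat.eq_zero_or_pos j with rfl | hj0
  · rw [layerDim, layer, finrank_bot]; exact Nat.zero_le _
  rcases hj.eq_or_lt with h | hlt
  · rw [show N - j = j by omega]
  have hd2 : 2 ≤ d := by
    by_contra h
    have := hd1 (by omega)
    omega
  let i₀ : Fin d := ⟨0, by omega⟩
  let i₁ : Fin d := ⟨1, by omega⟩
  have h10 : i₁ ≠ i₀ := by simp [i₀, i₁]
  let e : Fin d → Fin d → ℝ := fun i => Pi.single i 1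
  have he : e i₀ ≠ 0 := fun h => by simpa [e] using congrFun h i₀
  have hu1 : incl d N (e i₀) ≠ 0 := fun h => he
    (incl_injective (by omega) (h.trans (map_zero _).symm))
  -- The bracket with e_0 is injective only on layers other than the first, which is why the chain
  -- of inequalities starts at level 2.
  have hstep : ∀ i, 2 ≤ i → i + 1 ≤ N → layerDim d N i ≤ layerDim d N (i + 1) := by
    intro i hi hiN
    rw [add_comm i 1]
    exact layerDim_le_add le_rfl (by omega) (by omega) (by omega) ⟨_, rfl⟩ hu1
  have hmono : ∀ i k, 2 ≤ i → i + k ≤ N → layerDim d N i ≤ layerDim d N (i + k) := by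
    intro i k hi hk
    induction k with
    | zero => exact le_rfl
    | succ k ih => exact (ih (by omega)).trans (hstep (i + k) (by omega) hk)
  rcases Nat.lt_or_ge j 2 with hj2 | hj2
  -- For N ≥ 4, a degree 2 bracket carries level 1 to level 3, from where the chain climbs to N - 1.
  -- For N = 3 the target is level 2, and the exclusion of (3, 2) leaves d ≥ 3.
  · obtain rfl : j = 1 := by omega
    rcases Nat.lt_or_ge N 4 with hN | hN
    · obtain rfl : N = 3 := by omega
      exact layerDim_one_le_two (by omega) (by omega)
    · have hu2 : ⁅incl d N (e i₀), incl d N (e i₁)⁆ ≠ 0 := by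
        refine lie_incl_ne_zero (by omega) he fun c h => ?_
        simpa [e, Pi.single_eq_of_ne h10] using congrFun h i₁
      have h1 : layerDim d N 1 ≤ layerDim d N 3 :=
        layerDim_le_add (i := 2) (by omega) le_rfl (by omega) (by omega)
          (lie_mem_layer d N 1 1 _ _ ⟨_, rfl⟩ ⟨_, rfl⟩) hu2
      refine h1.trans ?_
      rw [show N - 1 = 3 + (N - 4) by omega]
      exact hmono 3 (N - 4) (by omega) (by omega)
  · rw [show N - j = j + (N - j - j) by omega]
    exact hmono j _ hj2 (by omega)

end Layers

end SignatureGroup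

end

noncomputable section

namespace SignatureGroup

open Module Set Filter Topology

/-! ### Layered bases and orbit dimension as a column rank. -/

section LayeredBasis

variable {d N : ℕ} {X : Module.Basis (Idx d N) ℝ (gN d N)}

theorem one_le_level (p : Idx d N) : 1 ≤ (p.1 : ℕ) := by
  rcases Nat.eq_zero_or_pos (p.1 : ℕ) with h | h
  · exfalso
    have h1 : layerDim d N p.1 = 0 := by rw [h, layerDim, layer, finrank_bot]
    exact absurd p.2.isLt (by omega)
  · exact h

theorem level_le (p : Idx d N) : (p.1 : ℕ) ≤ N := Nat.lt_succ_iff.1 p.1.isLt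

theorem IsLayered.mem_layer (hX : IsLayered X) (p : Idx d N) :
    (X p : TruncTensor d N) ∈ layer d N p.1 := by
  rw [← hX p.1]
  exact Submodule.subset_span ⟨p.2, rfl⟩

/-- The span of the layers from the `n`-th one on, in terms of the basis. -/
def levelFiltration (X : Module.Basis (Idx d N) ℝ (gN d N)) (n : ℕ) : Submodule ℝ (gN d N) :=
  Submodule.span ℝ (X '' {p | n ≤ (p.1 : ℕ)})

theorem mem_span_level (hX : IsLayered X) {k : ℕ} (hk : k ≤ N) {z : gN d N}
    (hz : (z : TruncTensor d N) ∈ layer d N k) :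
    z ∈ Submodule.span ℝ (X '' {p | (p.1 : ℕ) = k}) := by
  have h := hX ⟨k, Nat.lt_succ_of_le hk⟩
  simp only at h
  rw [← h] at hz
  have h2 : (range fun i => (X ⟨⟨k, Nat.lt_succ_of_le hk⟩, i⟩ : TruncTensor d N)) =
      (gN d N).toSubmodule.subtype '' (range fun i => X ⟨⟨k, Nat.lt_succ_of_le hk⟩, i⟩) := by
    rw [← range_comp]; rfl
  rw [h2, Submodule.span_image] at hz
  obtain ⟨w, hw, hwz⟩ := hz
  have : w = z := Subtype.ext hwz
  subst this
  refine Submodule.span_mono ?_ hw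
  rintro _ ⟨i, rfl⟩
  exact ⟨_, rfl, rfl⟩

theorem lie_eq_zero_of_lt (hX : IsLayered X) {p q : Idx d N} (h : N < (p.1 : ℕ) + q.1) :
    ⁅X p, X q⁆ = 0 := by
  have h1 := lie_mem_layer d N _ _ _ _ (hX.mem_layer p) (hX.mem_layer q)
  rw [layer_eq_bot h] at h1
  exact Subtype.ext ((Submodule.mem_bot ℝ).1 h1)

theorem lie_mem_levelFiltration (hX : IsLayered X) (z : gN d N) (q : Idx d N) :
    ⁅z, X q⁆ ∈ levelFiltration X (q.1 + 1) := by
  have hz : z ∈ Submodule.span ℝ (range X) := by rw [X.span_eq]; trivial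
  induction hz using Submodule.span_induction with
  | mem z hz =>
    obtain ⟨p, rfl⟩ := hz
    rcases Nat.lt_or_ge N (p.1 + q.1) with h | h
    · rw [lie_eq_zero_of_lt hX h]; exact zero_mem _
    · have h1 := mem_span_level (z := ⁅X p, X q⁆) hX h
        (lie_mem_layer d N _ _ _ _ (hX.mem_layer p) (hX.mem_layer q))
      refine Submodule.span_mono (image_mono fun r hr => ?_) h1
      have := one_le_level p
      simp only [mem_ofPred_eq] at hr ⊢
      omega
  | zero => rw [zero_lie]; exact zero_mem _
  | add a b _ _ iha ihb => rw [add_lie]; exact add_mem iha ihb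
  | smul c a _ iha => rw [smul_lie]; exact Submodule.smul_mem _ _ iha

theorem ad_pow_eq_zero (hX : IsLayered X) (z : gN d N) :
    LieAlgebra.ad ℝ (gN d N) z ^ (N + 1) = 0 := by
  have hstep : ∀ n, ∀ y ∈ levelFiltration X n,
      LieAlgebra.ad ℝ (gN d N) z y ∈ levelFiltration X (n + 1) := by
    intro n
    change levelFiltration X n ≤ (levelFiltration X (n + 1)).comap _
    rw [levelFiltration, Submodule.span_le]
    rintro _ ⟨q, hq, rfl⟩
    refine Submodule.span_mono (image_mono fun r hr => ?_) (lie_mem_levelFiltration hX z q)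
    simp only [mem_ofPred_eq] at hr hq ⊢
    omega
  have hpow : ∀ n y, (LieAlgebra.ad ℝ (gN d N) z ^ n) y ∈ levelFiltration X n := by
    intro n y
    induction n with
    | zero =>
      have h : levelFiltration X 0 = ⊤ := by simp [levelFiltration, X.span_eq]
      rw [h]; trivial
    | succ n ih => rw [pow_succ']; exact hstep n _ ih
  ext1 y
  have h := hpow (N + 1) y
  have h0 : levelFiltration X (N + 1) = ⊥ := by
    rw [levelFiltration, Submodule.span_eq_bot]
    rintro _ ⟨p, hp, rfl⟩
    have := level_le p
    simp only [mem_ofPred_eq] at hp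
    omega
  rw [h0] at h
  exact (Submodule.mem_bot ℝ).1 h

/-- The column of index `q` of the matrix of the form `ℓ [·, ·]`. -/
def formCol (X : Module.Basis (Idx d N) ℝ (gN d N)) (ℓ : Module.Dual ℝ (gN d N)) (q : Idx d N) :
    Idx d N → ℝ := fun p => ℓ ⁅X p, X q⁆

theorem map_truncExp {A B : Type*} [Ring A] [Algebra ℝ A] [Ring B] [Algebra ℝ B] (f : A →ₐ[ℝ] B)
    (P : ℕ) (x : A) : f (truncExp P x) = truncExp P (f x) := by
  simp [truncExp, map_sum]

/-- The dimension of the image of an orbit in the quotient defined by an initial segment is the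
rank of the corresponding columns of the matrix of the form `ℓ [·, ·]`. -/
theorem orbitDim_eq_finrank (hX : IsLayered X) (ℓ : Module.Dual ℝ (gN d N)) (s : Finset (Idx d N))
    (hs : ∀ q ∈ s, ∀ p : Idx d N, (q.1 : ℕ) < p.1 → p ∈ s) :
    orbitDim X ℓ s = finrank ℝ (Submodule.span ℝ (formCol X ℓ '' s)) := by
  -- The analytic result needs a normed space, so the adjoint representation is transported to
  -- coordinates.
  let E := Idx d N → ℝ
  let φ : gN d N ≃ₗ[ℝ] E := X.equivFun
  let Cj : Module.End ℝ (gN d N) ≃ₐ[ℝ] (E →L[ℝ] E) :=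
    (φ.conjAlgEquiv ℝ).trans (Module.End.toContinuousLinearMap E)
  have hC : ∀ (T : Module.End ℝ (gN d N)) (x : E), Cj T x = φ (T (φ.symm x)) := fun T x => rfl
  let ad : gN d N →ₗ[ℝ] Module.End ℝ (gN d N) :=
    { toFun := fun z => LieAlgebra.ad ℝ (gN d N) z
      map_add' := fun x y => map_add _ x y
      map_smul' := fun c x => map_smul _ c x }
  let a : E →L[ℝ] E →L[ℝ] E := LinearMap.toContinuousLinearMap
    (Cj.toLinearMap ∘ₗ ad ∘ₗ φ.symm.toLinearMap)
  have ha : ∀ x, a x = Cj (LieAlgebra.ad ℝ (gN d N) (φ.symm x)) := fun x => rfl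
  have hjac : ∀ x y, a (a x y) = a x * a y - a y * a x := by
    intro x y
    have h : LieAlgebra.ad ℝ (gN d N) ⁅φ.symm x, φ.symm y⁆ =
        LieAlgebra.ad ℝ (gN d N) (φ.symm x) * LieAlgebra.ad ℝ (gN d N) (φ.symm y) -
        LieAlgebra.ad ℝ (gN d N) (φ.symm y) * LieAlgebra.ad ℝ (gN d N) (φ.symm x) := by
      ext1 w
      exact lie_lie (φ.symm x) (φ.symm y) w
    rw [ha, ha, ha, hC, φ.symm_apply_apply, LieAlgebra.ad_apply, h, map_sub, map_mul, map_mul]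
  have hnil : ∀ x, a x ^ (N + 1) = 0 := by
    intro x
    rw [ha, ← map_pow, ad_pow_eq_zero hX, map_zero]
  let Y : s → E := fun q => φ (X q)
  -- A bracket with `X q` lies in strictly higher levels, all of whose indices belong to `s` by
  -- `hs`; so the span is an ideal.
  have hY : ∀ x q, a x (Y q) ∈ Submodule.span ℝ (range Y) := by
    intro x q
    have h1 := Submodule.mem_map_of_mem (f := φ.toLinearMap)
      (lie_mem_levelFiltration hX (φ.symm x) q)
    rw [levelFiltration, Submodule.map_span] at h1
    rw [ha, hC, φ.symm_apply_apply]
    refine Submodule.span_mono ?_ h1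
    rintro _ ⟨_, ⟨p, hp, rfl⟩, rfl⟩
    exact ⟨⟨p, hs q q.2 p hp⟩, rfl⟩
  let ℓ' : E →L[ℝ] ℝ := LinearMap.toContinuousLinearMap (ℓ ∘ₗ φ.symm.toLinearMap)
  let A : Matrix s (Idx d N) ℝ := Matrix.of fun q => formCol X ℓ q
  have hΛ : ∀ z q, A.mulVecLin z q = ℓ' (a z (Y q)) := by
    intro z q
    have h1 : ℓ' (a z (Y q)) = ℓ ⁅φ.symm z, X q⁆ := by
      change ℓ (φ.symm (Cj _ (φ (X q)))) = _
      rw [hC, φ.symm_apply_apply, φ.symm_apply_apply]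
      rfl
    rw [h1, show φ.symm z = ∑ p, z p • X p from X.equivFun_symm_apply z, sum_lie, map_sum,
      Matrix.mulVecLin_apply, Matrix.mulVec, dotProduct]
    refine Finset.sum_congr rfl fun p _ => ?_
    rw [smul_lie, map_smul, smul_eq_mul, mul_comm]
    rfl
  have h := dimH_range_orbit a (N + 1) hjac hnil Y hY ℓ' A.mulVecLin hΛ
  have hrank : finrank ℝ (LinearMap.range A.mulVecLin) =
      finrank ℝ (Submodule.span ℝ (formCol X ℓ '' s)) := by
    rw [← Matrix.rank, Matrix.rank_eq_finrank_span_row]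
    rw [image_eq_range]
    rfl
  rw [hrank] at h
  rw [← h, orbitDim, coadjointOrbit, ← range_comp, ← φ.surjective.range_comp]
  congr 2
  funext z q
  have h1 : truncExp (N + 1) (-a (φ z)) = Cj (AdExp (-z)) := by
    have h2 : -a (φ z) = Cj (LieAlgebra.ad ℝ (gN d N) (-z)) := by
      rw [ha, φ.symm_apply_apply, map_neg, map_neg]
    rw [h2]
    exact (map_truncExp Cj.toAlgHom (N + 1) _).symm
  change ℓ (AdExp (-z) (X q)) = ℓ (φ.symm (truncExp (N + 1) (-a (φ z)) (φ (X q))))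
  rw [h1, hC, φ.symm_apply_apply, φ.symm_apply_apply]

end LayeredBasis

end SignatureGroup

end

noncomputable section

namespace SignatureGroup

open Module Set Filter Topology

/-! ### Families of maximal rank and kernels of skew matrices. -/

section LinearAlgebra

theorem exists_forall_le_of_bounded {P : Type*} [Nonempty P] (f : P → ℕ) (C : ℕ)
    (hf : ∀ p, f p ≤ C) : ∃ p₀, ∀ p, f p ≤ f p₀ := by
  have hbdd : BddAbove (range f) := ⟨C, by rintro _ ⟨p, rfl⟩; exact hf p⟩
  obtain ⟨p₀, hp₀⟩ := Nat.sSup_mem (range_nonempty f) hbdd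
  exact ⟨p₀, fun p => hp₀ ▸ le_csSup hbdd ⟨p, rfl⟩⟩

/-- If `L p₀` has maximal rank in a linear family of linear maps, then all members of the family map
the kernel of `L p₀` into its range. -/
theorem apply_mem_range_of_maximal_rank {P W F : Type*} [AddCommGroup P] [Module ℝ P]
    [AddCommGroup W] [Module ℝ W] [NormedAddCommGroup F] [NormedSpace ℝ F]
    [FiniteDimensional ℝ F] (L : P →ₗ[ℝ] W →ₗ[ℝ] F) (p₀ : P)
    (hp₀ : ∀ p, finrank ℝ (LinearMap.range (L p)) ≤ finrank ℝ (LinearMap.range (L p₀)))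
    {b : W} (hb : L p₀ b = 0) (p : P) : L p b ∈ LinearMap.range (L p₀) := by
  by_contra hnot
  set R := LinearMap.range (L p₀) with hR
  let v := finBasis ℝ R
  have hw : ∀ i, ∃ w, L p₀ w = v i := fun i => (v i).2
  choose w hw using hw
  -- For t ≠ 0, the vector `L p b` equals `L (p₀ + t • p) (t⁻¹ • b)`, so all of `g t` lies in the
  -- range of `L (p₀ + t • p)`. At t = 0 the vectors are independent if `L p b` is outside `R`.
  -- Independence is an open condition, so for small t ≠ 0 the rank would exceed the maximum.
  let g : ℝ → Option (Fin (finrank ℝ R)) → F := fun t o =>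
    o.casesOn' (L p b) fun i => L (p₀ + t • p) (w i)
  have hv : LinearIndependent ℝ fun i => (v i : F) :=
    v.linearIndependent.map' R.subtype (Submodule.ker_subtype _)
  have hg0 : LinearIndependent ℝ (g 0) := by
    have hsp : Submodule.span ℝ (range fun i => (v i : F)) ≤ R := by
      rw [Submodule.span_le]; rintro _ ⟨i, rfl⟩; exact (v i).2
    have h := hv.option (x := L p b) (fun h => hnot (hsp h))
    have hg : g 0 = fun o => o.casesOn' (L p b) fun i => (v i : F) := by
      funext o
      cases o with
      | none => rfl
      | some i => simp [g, hw]
    rw [hg]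
    exact h
  have hcont : Continuous g := by
    refine continuous_pi fun o => ?_
    cases o with
    | none => exact continuous_const
    | some i =>
      have : (fun t => g t (some i)) = fun t : ℝ => L p₀ (w i) + t • L p (w i) := by
        funext t; simp [g]
      rw [this]
      fun_prop
  have hev : ∀ᶠ t in 𝓝 (0 : ℝ), LinearIndependent ℝ (g t) :=
    hcont.continuousAt.eventually hg0.eventually
  obtain ⟨t, ht, ht0⟩ := ((hev.filter_mono nhdsWithin_le_nhds).and
    (self_mem_nhdsWithin (a := (0 : ℝ)) (s := {0}ᶜ))).exists
  have hmem : ∀ o, g t o ∈ LinearMap.range (L (p₀ + t • p)) := by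
    intro o
    cases o with
    | none =>
      refine ⟨t⁻¹ • b, ?_⟩
      have ht0' : t ≠ 0 := ht0
      simp [g, hb, ht0']
    | some i => exact ⟨w i, rfl⟩
  have h1 := (LinearIndependent.of_comp (LinearMap.range (L (p₀ + t • p))).subtype
    (v := fun o => ⟨g t o, hmem o⟩) ht).fintype_card_le_finrank
  have h2 := hp₀ (p₀ + t • p)
  simp only [Fintype.card_option, Fintype.card_fin] at h1
  omega

variable {ι κ : Type*} [Fintype ι] [Fintype κ]

theorem exists_mulVec_eq_zero_of_skew_of_odd {M : Matrix ι ι ℝ}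
    (hM : ∀ i j, M i j = - M j i) (hodd : Odd (Fintype.card ι)) : ∃ x ≠ 0, M.mulVec x = 0 := by
  classical
  rw [Matrix.exists_mulVec_eq_zero_iff]
  have h : M.transpose = -M := by ext i j; exact hM j i
  have h1 := M.det_transpose
  rw [h, Matrix.det_neg, hodd.neg_one_pow] at h1
  linarith

/-- The kernel of a skew-symmetric matrix of even size is not one-dimensional. -/
theorem exists_mulVec_eq_zero_of_skew_of_even {M : Matrix ι ι ℝ}
    (hM : ∀ i j, M i j = - M j i) (heven : Even (Fintype.card ι)) {b : ι → ℝ} (hb : b ≠ 0)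
    (hMb : M.mulVec b = 0) : ∃ x, M.mulVec x = 0 ∧ ∀ c : ℝ, x ≠ c • b := by
  classical
  obtain ⟨i₀, hi₀⟩ := Function.ne_iff.1 hb
  have hcard : Odd (Fintype.card {i // i ≠ i₀}) := by
    have h1 : Fintype.card {i // i ≠ i₀} = Fintype.card ι - 1 := by
      simp [Fintype.card_subtype_compl]
    have h2 : 0 < Fintype.card ι := Fintype.card_pos_iff.2 ⟨i₀⟩
    rw [h1]
    exact Nat.Even.sub_odd h2 heven odd_one
  -- Without row and column `i₀` the size is odd, which gives a kernel vector, extended by 0 at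
  -- `i₀`. The missing equation in row `i₀` follows by pairing with `b`: b · Mx = -Mb · x = 0 and b
  -- is nonzero at `i₀`.
  obtain ⟨x', hx'0, hx'⟩ := exists_mulVec_eq_zero_of_skew_of_odd
    (M := M.submatrix (Subtype.val : {i // i ≠ i₀} → ι) Subtype.val) (fun i j => hM _ _) hcard
  let x : ι → ℝ := fun i => if h : i ≠ i₀ then x' ⟨i, h⟩ else 0
  have hxi₀ : x i₀ = 0 := by simp [x]
  have hxi : ∀ i : {i // i ≠ i₀}, x i = x' i := fun i => by simp [x, i.2]
  have hsum : ∀ i, M.mulVec x i = ∑ j : {i // i ≠ i₀}, M i j * x' j := by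
    intro i
    rw [Matrix.mulVec, dotProduct, ← Fintype.sum_subtype_add_sum_subtype (fun j => j ≠ i₀)]
    have : ∑ j : {j // ¬ j ≠ i₀}, M i j * x j = 0 := Finset.sum_eq_zero fun j _ => by
      rw [not_not.1 j.2, hxi₀, mul_zero]
    rw [this, add_zero]
    exact Finset.sum_congr rfl fun j _ => by rw [hxi]
  have hne : ∀ i, i ≠ i₀ → M.mulVec x i = 0 := fun i hi => by
    rw [hsum]; exact congrFun hx' ⟨i, hi⟩
  refine ⟨x, ?_, ?_⟩
  · have hz : ∑ i, b i * M.mulVec x i = 0 := by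
      have h1 : ∑ i, b i * M.mulVec x i = - ∑ j, M.mulVec b j * x j := by
        simp only [Matrix.mulVec, dotProduct, Finset.mul_sum, Finset.sum_mul]
        rw [Finset.sum_comm, ← Finset.sum_neg_distrib]
        refine Finset.sum_congr rfl fun j _ => ?_
        rw [← Finset.sum_neg_distrib]
        refine Finset.sum_congr rfl fun i _ => ?_
        rw [hM i j]; ring
      rw [h1, hMb]; simp
    rw [Finset.sum_eq_single i₀ (fun i _ hi => by rw [hne i hi, mul_zero]) (by simp)] at hz
    funext i
    by_cases hi : i = i₀
    · rw [hi]; exact (mul_eq_zero.1 hz).resolve_left hi₀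
    · exact hne i hi
  · intro c hc
    have h1 := congrFun hc i₀
    rw [hxi₀, Pi.smul_apply, smul_eq_mul] at h1
    have hc0 : c = 0 := (mul_eq_zero.1 h1.symm).resolve_right hi₀
    apply hx'0
    funext i
    rw [← hxi, hc, hc0, zero_smul]
    rfl

/-- A matrix with a nontrivial kernel has a large left kernel. -/
theorem card_lt_finrank_ker_transpose_add_card (C : Matrix ι κ ℝ) {b : κ → ℝ} (hb : b ≠ 0)
    (hCb : C.mulVec b = 0) :
    Fintype.card ι < finrank ℝ (LinearMap.ker C.transpose.mulVecLin) + Fintype.card κ := by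
  have h1 := LinearMap.finrank_range_add_finrank_ker C.mulVecLin
  have h2 := LinearMap.finrank_range_add_finrank_ker C.transpose.mulVecLin
  have h3 : C.transpose.rank = C.rank := Matrix.rank_transpose C
  rw [Matrix.rank, Matrix.rank] at h3
  have h4 : 0 < finrank ℝ (LinearMap.ker C.mulVecLin) := by
    rw [Module.finrank_pos_iff_exists_ne_zero]
    exact ⟨⟨b, hCb⟩, fun h => hb (congrArg Subtype.val h)⟩
  rw [finrank_fintype_fun_eq_card] at h1 h2
  omega

end LinearAlgebra

end SignatureGroup

end

noncomputable section

namespace SignatureGroup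

open Module Set Filter Topology

/-! ### The candidate jump indices and a functional with independent jump columns. -/

section JumpIndices

variable {d N : ℕ} {X : Module.Basis (Idx d N) ℝ (gN d N)}

/-- The number of jump indices in the `k`-th layer. -/
def jumpCount (d N k : ℕ) : ℕ :=
  if 2 * k < N then layerDim d N k
  else if N < 2 * k then layerDim d N (N - k) else 2 * (layerDim d N k / 2)

open Classical in
/-- The explicit set of jump indices. -/
def jumpIdx (d N : ℕ) : Finset (Idx d N) :=
  Finset.univ.filter fun p => (p.2 : ℕ) < jumpCount d N p.1

theorem mem_jumpIdx {p : Idx d N} : p ∈ jumpIdx d N ↔ (p.2 : ℕ) < jumpCount d N p.1 := by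
  simp [jumpIdx]

theorem jumpCount_le (hm : ∀ j, 2 * j ≤ N → layerDim d N j ≤ layerDim d N (N - j)) {k : ℕ}
    (hk : k ≤ N) : jumpCount d N k ≤ layerDim d N k := by
  unfold jumpCount
  split_ifs with h1 h2
  · exact le_rfl
  · have := hm (N - k) (by omega)
    rwa [show N - (N - k) = k by omega] at this
  · omega

theorem jumpCount_le_sub (hm : ∀ j, 2 * j ≤ N → layerDim d N j ≤ layerDim d N (N - j)) {k : ℕ} :
    jumpCount d N k ≤ layerDim d N (N - k) := by
  unfold jumpCount
  split_ifs with h1 h2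
  · exact hm k (by omega)
  · exact le_rfl
  · rw [show N - k = k by omega]; omega

theorem layerDim_zero : layerDim d N 0 = 0 := by rw [layerDim, layer, finrank_bot]

theorem jumpCount_self (d N : ℕ) : jumpCount d N N = 0 := by
  unfold jumpCount
  split_ifs with h1 h2
  · omega
  · rw [Nat.sub_self, layerDim_zero]
  · rw [show N = 0 by omega, layerDim_zero]

/-- The indices `(k, 1), …, (k, n)`. -/
def levelEquiv {k n : ℕ} (hk : k ≤ N) (hn : n ≤ layerDim d N k) :
    Fin n ≃ {q : Idx d N // (q.1 : ℕ) = k ∧ (q.2 : ℕ) < n} where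
  toFun i := ⟨⟨⟨k, Nat.lt_succ_of_le hk⟩, ⟨i, i.2.trans_le hn⟩⟩, rfl, i.2⟩
  invFun q := ⟨q.1.2, q.2.2⟩
  left_inv i := rfl
  right_inv := by
    rintro ⟨⟨⟨k', hk'⟩, ⟨i, hi⟩⟩, rfl, h⟩
    rfl

theorem card_level {k : ℕ} (hk : k ≤ N) :
    Fintype.card {q : Idx d N // (q.1 : ℕ) = k} = layerDim d N k := by
  rw [← Fintype.card_fin (layerDim d N k)]
  refine Fintype.card_congr (((levelEquiv hk le_rfl).trans (Equiv.subtypeEquivRight ?_)).symm)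
  intro q
  refine ⟨fun h => h.1, fun h => ⟨h, ?_⟩⟩
  exact (congrArg (layerDim d N) h) ▸ q.2.isLt

theorem card_jumpIdx_level (hm : ∀ j, 2 * j ≤ N → layerDim d N j ≤ layerDim d N (N - j)) {k : ℕ}
    (hk : k ≤ N) :
    Fintype.card {q : Idx d N // q ∈ jumpIdx d N ∧ (q.1 : ℕ) = k} = jumpCount d N k := by
  rw [← Fintype.card_fin (jumpCount d N k)]
  refine Fintype.card_congr
    (((levelEquiv hk (jumpCount_le hm hk)).trans (Equiv.subtypeEquivRight ?_)).symm)
  intro q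
  rw [mem_jumpIdx]
  constructor
  · rintro ⟨h1, h2⟩; exact ⟨h2.trans_eq (congrArg (jumpCount d N) h1.symm), h1⟩
  · rintro ⟨h1, h2⟩; exact ⟨h2, h1.trans_eq (congrArg (jumpCount d N) h2)⟩

/-- The matrix of the form `ℓ [·, ·]`. -/
def formMatrix (X : Module.Basis (Idx d N) ℝ (gN d N)) (ℓ : Module.Dual ℝ (gN d N)) :
    Matrix (Idx d N) (Idx d N) ℝ := Matrix.of fun p q => ℓ ⁅X p, X q⁆

theorem formMatrix_apply (ℓ : Module.Dual ℝ (gN d N)) (p q : Idx d N) :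
    formMatrix X ℓ p q = ℓ ⁅X p, X q⁆ := rfl

theorem formMatrix_skew (ℓ : Module.Dual ℝ (gN d N)) (p q : Idx d N) :
    formMatrix X ℓ p q = - formMatrix X ℓ q p := by
  rw [formMatrix_apply, formMatrix_apply, ← lie_skew, map_neg]

theorem formMatrix_eq_zero (hX : IsLayered X) (ℓ : Module.Dual ℝ (gN d N)) {p q : Idx d N}
    (h : N < (p.1 : ℕ) + q.1) : formMatrix X ℓ p q = 0 := by
  rw [formMatrix_apply, lie_eq_zero_of_lt hX h, map_zero]

theorem sum_mul_formMatrix_mulVec (ℓ : Module.Dual ℝ (gN d N)) (a b : Idx d N → ℝ) :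
    ∑ p, a p * (formMatrix X ℓ).mulVec b p = ℓ ⁅∑ p, a p • X p, ∑ q, b q • X q⁆ := by
  rw [sum_lie, map_sum]
  refine Finset.sum_congr rfl fun p _ => ?_
  rw [lie_sum, map_sum, Matrix.mulVec, dotProduct, Finset.mul_sum]
  refine Finset.sum_congr rfl fun q _ => ?_
  rw [smul_lie, lie_smul, map_smul, map_smul, smul_eq_mul, smul_eq_mul, formMatrix_apply]
  ring

/-- The columns of the form `ℓ [·, ·]` at the jump indices are linearly independent. -/
def JumpColsIndependent (X : Module.Basis (Idx d N) ℝ (gN d N)) (ℓ : Module.Dual ℝ (gN d N)) :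
    Prop :=
  ∀ b : Idx d N → ℝ, (∀ q ∉ jumpIdx d N, b q = 0) → (formMatrix X ℓ).mulVec b = 0 → b = 0

/-- The restriction of a functional to the last layer, extended by zero. -/
def topPart (X : Module.Basis (Idx d N) ℝ (gN d N)) :
    Module.Dual ℝ (gN d N) →ₗ[ℝ] Module.Dual ℝ (gN d N) :=
  (X.constr ℝ fun p => if (p.1 : ℕ) = N then X p else 0 : gN d N →ₗ[ℝ] gN d N).dualMap

theorem topPart_apply_basis (ℓ : Module.Dual ℝ (gN d N)) (p : Idx d N) :
    topPart X ℓ (X p) = if (p.1 : ℕ) = N then ℓ (X p) else 0 := by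
  rw [topPart, LinearMap.dualMap_apply, Basis.constr_basis, apply_ite ℓ, map_zero]

theorem topPart_of_mem_last (hX : IsLayered X) (ℓ : Module.Dual ℝ (gN d N)) {z : gN d N}
    (hz : (z : TruncTensor d N) ∈ layer d N N) : topPart X ℓ z = ℓ z := by
  have h := mem_span_level hX le_rfl hz
  refine LinearMap.eqOn_span (f := topPart X ℓ) (g := ℓ) ?_ h
  rintro _ ⟨p, hp, rfl⟩
  rw [topPart_apply_basis, if_pos (show (p.1 : ℕ) = N from hp)]

theorem topPart_of_mem_layer (hX : IsLayered X) (ℓ : Module.Dual ℝ (gN d N)) {k : ℕ} (hk : k < N)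
    {z : gN d N} (hz : (z : TruncTensor d N) ∈ layer d N k) : topPart X ℓ z = 0 := by
  have h := mem_span_level hX hk.le hz
  refine LinearMap.eqOn_span (f := topPart X ℓ) (g := 0) ?_ h
  rintro _ ⟨p, hp, rfl⟩
  have hp' : (p.1 : ℕ) ≠ N := by
    have : (p.1 : ℕ) = k := hp
    omega
  rw [topPart_apply_basis, if_neg hp', LinearMap.zero_apply]

/-- For functionals supported on the last layer only the antidiagonal blocks survive, so kernel
vectors can be cut into homogeneous parts. -/
theorem formMatrix_topPart_eq_zero (hX : IsLayered X) (ℓ : Module.Dual ℝ (gN d N)) {p q : Idx d N}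
    (h : (p.1 : ℕ) + q.1 ≠ N) : formMatrix X (topPart X ℓ) p q = 0 := by
  rcases lt_or_gt_of_ne h with h | h
  · exact topPart_of_mem_layer hX ℓ h
      (lie_mem_layer d N _ _ _ _ (hX.mem_layer p) (hX.mem_layer q))
  · exact formMatrix_eq_zero hX _ h

theorem sum_mem_layer (hX : IsLayered X) {k : ℕ} {a : Idx d N → ℝ}
    (ha : ∀ p : Idx d N, (p.1 : ℕ) ≠ k → a p = 0) :
    ((∑ p, a p • X p : gN d N) : TruncTensor d N) ∈ layer d N k := by
  change (gN d N).toSubmodule.subtype (∑ p, a p • X p) ∈ _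
  rw [map_sum]
  refine Submodule.sum_mem _ fun p _ => ?_
  rw [map_smul]
  by_cases h : (p.1 : ℕ) = k
  · exact Submodule.smul_mem _ _ (h ▸ hX.mem_layer p)
  · rw [ha p h, zero_smul]; exact zero_mem _

theorem eq_zero_of_sum_eq_zero {a : Idx d N → ℝ} (h : ∑ p, a p • X p = 0) : a = 0 := by
  rw [← X.equivFun_symm_apply] at h
  exact (LinearEquiv.map_eq_zero_iff X.equivFun.symm).1 h

theorem sum_dite_mul {ι : Type*} [Fintype ι] (P : ι → Prop) [DecidablePred P]
    (a : {i // P i} → ℝ) (g : ι → ℝ) :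
    ∑ i, (if h : P i then a ⟨i, h⟩ else 0) * g i = ∑ i : {i // P i}, a i * g i := by
  rw [← Fintype.sum_subtype_add_sum_subtype P]
  have h0 : ∑ i : {i // ¬ P i}, (if h : P i then a ⟨i, h⟩ else 0) * g i = 0 :=
    Finset.sum_eq_zero fun i _ => by rw [dif_neg i.2, zero_mul]
  rw [h0, add_zero]
  exact Finset.sum_congr rfl fun i _ => by rw [dif_pos i.2]

/-- There is a functional for which the columns at the jump indices are linearly independent. -/
theorem exists_jumpColsIndependent (hX : IsLayered X)
    (hm : ∀ j, 2 * j ≤ N → layerDim d N j ≤ layerDim d N (N - j)) :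
    ∃ ℓ, JumpColsIndependent X ℓ := by
  classical
  let W : Submodule ℝ (Idx d N → ℝ) :=
    { carrier := {b | ∀ q ∉ jumpIdx d N, b q = 0}
      add_mem' := fun {a b} ha hb q hq => by simp [ha q hq, hb q hq]
      zero_mem' := fun q _ => rfl
      smul_mem' := fun c b hb q hq => by simp [hb q hq] }
  -- The jump columns form a family of maps depending linearly on ℓ; the functional sought is one of
  -- maximal rank in this family.
  let L : Module.Dual ℝ (gN d N) →ₗ[ℝ] W →ₗ[ℝ] (Idx d N → ℝ) :=
    LinearMap.mk₂ ℝ (fun ℓ b => (formMatrix X (topPart X ℓ)).mulVec b.1)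
      (fun ℓ ℓ' b => by
        rw [← Matrix.add_mulVec]; congr 1)
      (fun c ℓ b => by
        rw [← Matrix.smul_mulVec]; congr 1)
      (fun ℓ b b' => Matrix.mulVec_add _ _ _)
      (fun c ℓ b => Matrix.mulVec_smul _ _ _)
  have hL : ∀ ℓ b, L ℓ b = (formMatrix X (topPart X ℓ)).mulVec b.1 := fun ℓ b => rfl
  obtain ⟨ℓ₀, hmax⟩ := exists_forall_le_of_bounded
    (fun ℓ => finrank ℝ (LinearMap.range (L ℓ))) _ (fun ℓ => Submodule.finrank_le _)
  refine ⟨topPart X ℓ₀, ?_⟩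
  set M := formMatrix X (topPart X ℓ₀) with hM
  have hM0 : ∀ p q : Idx d N, (p.1 : ℕ) + q.1 ≠ N → M p q = 0 := fun p q h =>
    formMatrix_topPart_eq_zero hX ℓ₀ h
  intro b' hb'S hMb'
  by_contra hb'0
  -- reduction to a homogeneous vector
  obtain ⟨q₀, hq₀⟩ := Function.ne_iff.1 hb'0
  replace hq₀ : b' q₀ ≠ 0 := hq₀
  set k : ℕ := ((q₀.1 : Fin (N + 1)) : ℕ) with hk
  have hkN : k ≤ N := level_le q₀
  have hk1 : 1 ≤ k := one_le_level q₀
  have hq₀S : q₀ ∈ jumpIdx d N := by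
    by_contra h
    exact hq₀ (hb'S q₀ h)
  have hkN' : k ≠ N := by
    intro h
    have h1 := (mem_jumpIdx.1 hq₀S).trans_eq (congrArg (jumpCount d N) h)
    rw [jumpCount_self] at h1
    omega
  let b : Idx d N → ℝ := fun q => if (q.1 : ℕ) = k then b' q else 0
  have hbk : ∀ q : Idx d N, (q.1 : ℕ) ≠ k → b q = 0 := fun q hq => if_neg hq
  have hbS : ∀ q ∉ jumpIdx d N, b q = 0 := fun q hq => by
    simp only [b]; rw [hb'S q hq, ite_self]
  have hbq₀ : b q₀ ≠ 0 := by
    simp only [b]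
    rwa [if_pos hk.symm]
  have hMb : M.mulVec b = 0 := by
    funext p
    by_cases hp : (p.1 : ℕ) + k = N
    · refine Eq.trans ?_ (congrFun hMb' p)
      refine Finset.sum_congr rfl fun q _ => ?_
      by_cases hq : (q.1 : ℕ) = k
      · simp only [b]; rw [if_pos hq]
      · change M p q * b q = M p q * b' q
        rw [hM0 p q (by omega), zero_mul, zero_mul]
    · refine Finset.sum_eq_zero fun q _ => ?_
      change M p q * b q = 0
      by_cases hq : (q.1 : ℕ) = k
      · rw [hM0 p q (by omega), zero_mul]
      · rw [hbk q hq, mul_zero]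
  let C : Matrix {p : Idx d N // (p.1 : ℕ) = N - k} {q : Idx d N // q ∈ jumpIdx d N ∧ (q.1 : ℕ) = k}
    ℝ := M.submatrix Subtype.val Subtype.val
  have hsumb : ∀ g : Idx d N → ℝ, ∑ q : {q : Idx d N // q ∈ jumpIdx d N ∧ (q.1 : ℕ) = k},
      g q * b q = ∑ q, g q * b q := by
    intro g
    rw [← Fintype.sum_subtype_add_sum_subtype
      (fun q : Idx d N => q ∈ jumpIdx d N ∧ (q.1 : ℕ) = k) (fun q => g q * b q)]
    refine (add_eq_left.2 (Finset.sum_eq_zero fun q _ => ?_)).symm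
    rcases not_and_or.1 q.2 with h | h
    · rw [hbS _ h, mul_zero]
    · rw [hbk _ h, mul_zero]
  have hCb : C.mulVec (fun q => b q) = 0 := by
    funext p
    exact (hsumb (fun q => M p q)).trans (congrFun hMb p)
  have hbC0 : (fun q : {q : Idx d N // q ∈ jumpIdx d N ∧ (q.1 : ℕ) = k} => b q) ≠ 0 := fun h =>
    hbq₀ (congrFun h ⟨q₀, hq₀S, rfl⟩)
  have hcard := card_lt_finrank_ker_transpose_add_card C hbC0 hCb
  rw [card_level (by omega), card_jumpIdx_level hm hkN] at hcard
  -- elements of the left kernel commute with `b`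
  let ext : ({p : Idx d N // (p.1 : ℕ) = N - k} → ℝ) → Idx d N → ℝ := fun a p =>
    if h : (p.1 : ℕ) = N - k then a ⟨p, h⟩ else 0
  have hext : ∀ a, ∀ p : Idx d N, (p.1 : ℕ) ≠ N - k → ext a p = 0 := fun a p hp => dif_neg hp
  have hext' : ∀ a (p : {p : Idx d N // (p.1 : ℕ) = N - k}), ext a p = a p := fun a p =>
    dif_pos p.2
  have hy0 : ((∑ q, b q • X q : gN d N) : TruncTensor d N) ≠ 0 := by
    intro h
    exact hbq₀ (congrFun (eq_zero_of_sum_eq_zero (Subtype.ext h)) q₀)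
  have hcomm : ∀ a, C.transpose.mulVec a = 0 →
      ⁅(∑ p, ext a p • X p : gN d N), (∑ q, b q • X q : gN d N)⁆ = 0 := by
    intro a ha
    -- `a`, extended by zero, annihilates the whole range: the jump columns of level `k` by the
    -- choice of `a`, and those of other levels because they vanish on the rows of level `N - k`.
    have hrange : ∀ f ∈ LinearMap.range (L ℓ₀), ∑ p, ext a p * f p = 0 := by
      rintro _ ⟨w, rfl⟩
      rw [hL, sum_dite_mul (fun p : Idx d N => (p.1 : ℕ) = N - k) a]
      simp only [Matrix.mulVec, dotProduct, Finset.mul_sum]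
      rw [Finset.sum_comm]
      refine Finset.sum_eq_zero fun q _ => ?_
      by_cases hqS : q ∈ jumpIdx d N
      · by_cases hqk : (q.1 : ℕ) = k
        · have h1 := congrFun ha ⟨q, hqS, hqk⟩
          simp only [Matrix.mulVec, dotProduct, Pi.zero_apply] at h1
          calc _ = (∑ p : {p : Idx d N // (p.1 : ℕ) = N - k}, M p q * a p) * w.1 q := by
                rw [Finset.sum_mul]
                exact Finset.sum_congr rfl fun p _ => by rw [← hM]; ring
            _ = 0 := by
                rw [show ∑ p : {p : Idx d N // (p.1 : ℕ) = N - k}, M p q * a p = 0 from h1,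
                  zero_mul]
        · refine Finset.sum_eq_zero fun p _ => ?_
          have := p.2
          rw [← hM, hM0 p q (by omega)]
          ring
      · refine Finset.sum_eq_zero fun p _ => ?_
        rw [w.2 q hqS]
        ring
    refine (Module.forall_dual_apply_eq_zero_iff ℝ _).1 fun ℓ => ?_
    -- By maximality the image of `b` under every member of the family lies in that range. The
    -- pairing with `a` is the value of `ℓ` at the bracket, so the bracket is zero.
    have h1 := hrange _ (apply_mem_range_of_maximal_rank L ℓ₀ hmax (b := ⟨b, hbS⟩) hMb ℓ)
    rw [hL, sum_mul_formMatrix_mulVec] at h1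
    rwa [topPart_of_mem_last hX] at h1
    have h2 := lie_mem_layer d N _ _ _ _ (sum_mem_layer hX (hext a)) (sum_mem_layer hX hbk)
    rwa [show N - k + k = N by omega] at h2
  by_cases hkk : N - k = k
  · -- the middle layer
    have hkk2 : 2 * k = N := by omega
    have hprop : ∀ a, C.transpose.mulVec a = 0 → ∃ c : ℝ, ext a = c • b := by
      intro a ha
      have h1 := sum_mem_layer hX (hext a)
      rw [hkk] at h1
      obtain ⟨c, hc⟩ := exists_smul_of_lie_eq_zero (p := k) (by omega) (sum_mem_layer hX hbk) h1
        (by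
          have h2 := hcomm a ha
          rw [← lie_skew, neg_eq_zero] at h2
          exact congrArg Subtype.val h2) hy0
      refine ⟨c, ?_⟩
      have h3 : (∑ p, ext a p • X p : gN d N) = c • ∑ q, b q • X q := Subtype.ext hc
      rw [← sub_eq_zero]
      refine eq_zero_of_sum_eq_zero (X := X) ?_
      simp only [Pi.sub_apply, Pi.smul_apply, sub_smul, Finset.sum_sub_distrib, smul_assoc,
        ← Finset.smul_sum]
      rw [h3, sub_self]
    let b₁ : {p : Idx d N // (p.1 : ℕ) = N - k} → ℝ := fun p => b p
    have hprop' : ∀ a, C.transpose.mulVec a = 0 → ∃ c : ℝ, a = c • b₁ := by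
      intro a ha
      obtain ⟨c, hc⟩ := hprop a ha
      refine ⟨c, funext fun p => ?_⟩
      rw [← hext' a p, hc]
      rfl
    have hker : finrank ℝ (LinearMap.ker C.transpose.mulVecLin) ≤ 1 := by
      have h1 : LinearMap.ker C.transpose.mulVecLin ≤ Submodule.span ℝ {b₁} := by
        intro a ha
        obtain ⟨c, rfl⟩ := hprop' a ha
        exact Submodule.smul_mem _ _ (Submodule.mem_span_singleton_self _)
      exact (Submodule.finrank_mono h1).trans ((finrank_span_le_card _).trans (by simp))
    have hdim : layerDim d N (N - k) = layerDim d N k := by rw [hkk]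
    have hc : jumpCount d N k = 2 * (layerDim d N k / 2) := by
      rw [jumpCount, if_neg (by omega), if_neg (by omega)]
    -- With a left kernel of dimension at most 1, `hcard` gives m_k < 1 + 2⌊m_k/2⌋, so m_k is even.
    -- The block is then a full skew matrix of even size, whose kernel cannot be just the line of
    -- `b`.
    have heven : Even (layerDim d N k) := ⟨layerDim d N k / 2, by omega⟩
    have hck : jumpCount d N k = layerDim d N k := by omega
    obtain ⟨a, ha, hane⟩ := exists_mulVec_eq_zero_of_skew_of_even
      (M := M.submatrix (Subtype.val : {p : Idx d N // (p.1 : ℕ) = N - k} → _) Subtype.val)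
      (fun i j => formMatrix_skew (topPart X ℓ₀) i.1 j.1) (by rw [card_level (by omega), hdim]; exact heven)
      (b := b₁) (fun h => hbq₀ (congrFun h ⟨q₀, by omega⟩)) (by
        funext p
        refine Eq.trans ?_ (congrFun hMb p)
        simp only [Matrix.mulVec, dotProduct, b₁]
        rw [← Fintype.sum_subtype_add_sum_subtype
          (fun q : Idx d N => (q.1 : ℕ) = N - k) (fun q => M p q * b q)]
        refine (add_eq_left.2 (Finset.sum_eq_zero fun q _ => ?_)).symm
        rw [hbk _ (by have := q.2; omega), mul_zero])
    obtain ⟨c, hc⟩ := hprop' a (by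
      funext q
      have h1 := congrFun ha ⟨q.1, by have := q.2.2; omega⟩
      simp only [Matrix.mulVec, dotProduct, Pi.zero_apply] at h1 ⊢
      rw [← neg_eq_zero, ← Finset.sum_neg_distrib] at h1
      refine Eq.trans (Finset.sum_congr rfl fun p _ => ?_) h1
      rw [← neg_mul]
      congr 1
      exact formMatrix_skew (topPart X ℓ₀) p.1 q.1)
    exact hane c hc
  · -- the other layers
    -- There are at least as many rows as jump columns, so a right kernel forces a nonzero left
    -- kernel, that is, nonzero commuting elements of different degrees.
    have h1 := jumpCount_le_sub hm (k := k)
    have h2 : 0 < finrank ℝ (LinearMap.ker C.transpose.mulVecLin) := by omega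
    obtain ⟨⟨a, ha⟩, ha0⟩ := Module.finrank_pos_iff_exists_ne_zero.1 h2
    rcases eq_zero_of_lie_eq_zero (by omega) hk1 (by omega) hkk (sum_mem_layer hX (hext a))
      (sum_mem_layer hX hbk) (congrArg Subtype.val (hcomm a ha)) with h3 | h3
    · refine ha0 (Subtype.ext (funext fun p => ?_))
      refine (hext' a p).symm.trans ?_
      rw [eq_zero_of_sum_eq_zero (X := X) (Subtype.ext h3)]
      rfl
    · exact hy0 h3

end JumpIndices

end SignatureGroup

end

noncomputable section

namespace SignatureGroup

open Module Set Filter Topology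

/-! ### The order of the indices and its initial segments. -/

section Order

variable {d N : ℕ}

/-- The position of an index in the list of indices (up to gaps). -/
def position (p : Idx d N) : ℕ :=
  (N - p.1) * (∑ k ∈ Finset.range (N + 1), layerDim d N k) + p.2

theorem snd_lt_sum (p : Idx d N) : (p.2 : ℕ) < ∑ k ∈ Finset.range (N + 1), layerDim d N k :=
  p.2.isLt.trans_le (Finset.single_le_sum (f := fun k => layerDim d N k)
    (fun _ _ => Nat.zero_le _) (Finset.mem_range.2 p.1.isLt))

theorem position_lt_of_level_lt {p q : Idx d N} (h : (p.1 : ℕ) < q.1) :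
    position q < position p := by
  have h1 := snd_lt_sum q
  have h2 := level_le q
  unfold position
  set D := ∑ k ∈ Finset.range (N + 1), layerDim d N k
  have h3 : (N - q.1 + 1) * D ≤ (N - p.1) * D := Nat.mul_le_mul_right D (by omega)
  rw [add_mul, one_mul] at h3
  omega

theorem before_iff_position_lt {p q : Idx d N} : Before q p ↔ position q < position p := by
  constructor
  · rintro (h | ⟨h1, h2⟩)
    · exact position_lt_of_level_lt h
    · have h3 := congrArg (fun k : Fin (N + 1) => (N - (k : ℕ)) *
        ∑ k ∈ Finset.range (N + 1), layerDim d N k) h1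
      unfold position
      omega
  · intro h
    rcases lt_trichotomy (p.1 : ℕ) q.1 with h1 | h1 | h1
    · exact Or.inl h1
    · refine Or.inr ⟨Fin.ext h1.symm, ?_⟩
      have h3 := congrArg (fun k : ℕ => (N - k) * ∑ k ∈ Finset.range (N + 1), layerDim d N k) h1
      unfold position at h
      omega
    · exact absurd (position_lt_of_level_lt h1) (by omega)

theorem Idx.ext_of_val {p q : Idx d N} (h1 : (p.1 : ℕ) = q.1) (h2 : (p.2 : ℕ) = q.2) : p = q := by
  obtain ⟨⟨k, hk⟩, ⟨i, hi⟩⟩ := p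
  obtain ⟨⟨k', hk'⟩, ⟨i', hi'⟩⟩ := q
  obtain rfl : k = k' := h1
  obtain rfl : i = i' := h2
  rfl

theorem position_injective : Function.Injective (position : Idx d N → ℕ) := by
  intro p q h
  have h1 : (p.1 : ℕ) = q.1 := by
    rcases lt_trichotomy (p.1 : ℕ) q.1 with h1 | h1 | h1
    · exact absurd (position_lt_of_level_lt h1) (by omega)
    · exact h1
    · exact absurd (position_lt_of_level_lt h1) (by omega)
  refine Idx.ext_of_val h1 ?_
  have h3 := congrArg (fun k : ℕ => (N - k) * ∑ k ∈ Finset.range (N + 1), layerDim d N k) h1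
  unfold position at h
  omega

theorem mem_strictlyBefore {p q : Idx d N} : q ∈ strictlyBefore p ↔ position q < position p := by
  rw [← before_iff_position_lt]
  simp [strictlyBefore]

theorem mem_upTo {p q : Idx d N} : q ∈ upTo p ↔ position q ≤ position p := by
  rw [upTo, Finset.mem_insert, mem_strictlyBefore, le_iff_lt_or_eq, or_comm,
    position_injective.eq_iff]

theorem level_le_of_mem_upTo {p q : Idx d N} (h : q ∈ upTo p) : (p.1 : ℕ) ≤ q.1 := by
  by_contra hlt
  have := position_lt_of_level_lt (not_le.1 hlt)
  rw [mem_upTo] at h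
  omega

/-- `s` is an initial segment of the list of indices. -/
def IsInitial (s : Finset (Idx d N)) : Prop :=
  ∀ p ∈ s, ∀ q, position q < position p → q ∈ s

theorem isInitial_upTo (p : Idx d N) : IsInitial (upTo p) := by
  intro q hq r hr
  rw [mem_upTo] at hq ⊢
  omega

theorem isInitial_strictlyBefore (p : Idx d N) : IsInitial (strictlyBefore p) := by
  intro q hq r hr
  rw [mem_strictlyBefore] at hq ⊢
  omega

end Order

/-! ### Ranks of initial segments of columns. -/

section ColumnRank

variable {d N : ℕ} {X : Module.Basis (Idx d N) ℝ (gN d N)}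

theorem finrank_le_card_of_support {ι : Type*} [Fintype ι] (P : ι → Prop) [DecidablePred P]
    (A : Submodule ℝ (ι → ℝ)) (hA : ∀ f ∈ A, ∀ i, ¬ P i → f i = 0) :
    finrank ℝ A = finrank ℝ (A.map (LinearMap.funLeft ℝ ℝ (Subtype.val : {i // P i} → ι))) := by
  have hinj : Function.Injective
      ((LinearMap.funLeft ℝ ℝ (Subtype.val : {i // P i} → ι)).domRestrict A) := by
    rw [← LinearMap.ker_eq_bot, LinearMap.ker_eq_bot']
    rintro ⟨f, hf⟩ h
    refine Subtype.ext (funext fun i => ?_)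
    by_cases hi : P i
    · exact congrFun h ⟨i, hi⟩
    · exact hA f hf i hi
  rw [← LinearMap.finrank_range_of_inj hinj, LinearMap.range_domRestrict]

/-- The subspace cannot fill all functions supported on `P`, since `a` does not annihilate the
indicator of `i₀`. -/
theorem finrank_lt_card_of_support {ι : Type*} [Fintype ι] (P : ι → Prop) [DecidablePred P]
    (A : Submodule ℝ (ι → ℝ)) (hA : ∀ f ∈ A, ∀ i, ¬ P i → f i = 0) (a : ι → ℝ) {i₀ : ι}
    (hi₀ : P i₀) (ha : a i₀ ≠ 0) (haA : ∀ f ∈ A, ∑ i, a i * f i = 0) :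
    finrank ℝ A < Fintype.card {i // P i} := by
  classical
  rw [finrank_le_card_of_support P A hA, ← finrank_fintype_fun_eq_card ℝ]
  refine Submodule.finrank_lt fun htop => ha ?_
  obtain ⟨f, hf, hfs⟩ : (Pi.single ⟨i₀, hi₀⟩ 1 : {i // P i} → ℝ) ∈
    A.map (LinearMap.funLeft ℝ ℝ (Subtype.val : {i // P i} → ι)) := by rw [htop]; trivial
  have h := haA f hf
  rw [Finset.sum_eq_single i₀] at h
  · have h1 : f i₀ = 1 := by simpa using congrFun hfs ⟨i₀, hi₀⟩
    simpa [h1] using h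
  · intro i _ hi
    by_cases hP : P i
    · have h1 := congrFun hfs ⟨i, hP⟩
      rw [Pi.single_eq_of_ne (fun h => hi (congrArg Subtype.val h))] at h1
      rw [show f i = 0 from h1, mul_zero]
    · rw [hA f hf i hP, mul_zero]
  · simp

-- The reflection (k, i) ↦ (N - k, i) sends the rows on which the columns up to `p` can be nonzero
-- to jump indices up to `p`. The only possible exception is `p` itself, in the middle layer.
open Classical in
theorem card_low_le (hm : ∀ j, 2 * j ≤ N → layerDim d N j ≤ layerDim d N (N - j)) {p : Idx d N}
    (hp : p ∉ jumpIdx d N) (hpN : N ≤ 2 * (p.1 : ℕ)) :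
    Fintype.card {r : Idx d N // (r.1 : ℕ) ≤ N - p.1} ≤
      (upTo p ∩ jumpIdx d N).card + if N < 2 * (p.1 : ℕ) then 0 else 1 := by
  have hpc : jumpCount d N p.1 ≤ p.2 := not_lt.1 fun h => hp (mem_jumpIdx.2 h)
  have hlt : ∀ r : Idx d N, (r.1 : ℕ) ≤ N - p.1 → (r.2 : ℕ) < layerDim d N (r.1.rev : Fin _) := by
    intro r hr
    refine r.2.isLt.trans_le ((hm r.1 (by omega)).trans_eq ?_)
    rw [Fin.val_rev]
    congr 1
    omega
  let σ : {r : Idx d N // (r.1 : ℕ) ≤ N - p.1} → Idx d N := fun r =>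
    ⟨r.1.1.rev, ⟨r.1.2, hlt r.1 r.2⟩⟩
  have hσ1 : ∀ r, ((σ r).1 : ℕ) = N - r.1.1 := fun r => by
    simp only [σ, Fin.val_rev]; omega
  have hσ2 : ∀ r, ((σ r).2 : ℕ) = r.1.2 := fun r => rfl
  have hσinj : Function.Injective σ := by
    intro r r' h
    have h1 := hσ1 r
    have h2 := hσ2 r
    rw [h] at h1 h2
    rw [hσ1] at h1
    rw [hσ2] at h2
    have h3 := level_le r.1
    have h4 := level_le r'.1
    exact Subtype.ext (Idx.ext_of_val (by omega) h2.symm)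
  have hmem : ∀ r, σ r ∈ upTo p ∩ jumpIdx d N ∨ (¬ N < 2 * (p.1 : ℕ) ∧ σ r = p) := by
    intro r
    have hr := r.2
    have hrN := level_le r.1
    have hpN' := level_le p
    rcases Nat.lt_or_ge r.1.1 (N - p.1) with h | h
    · left
      rw [Finset.mem_inter, mem_jumpIdx, mem_upTo]
      refine ⟨(position_lt_of_level_lt (by rw [hσ1]; omega)).le, ?_⟩
      have h1 : jumpCount d N (N - r.1.1) = layerDim d N r.1.1 := by
        rw [jumpCount, if_neg (by omega), if_pos (by omega),
          show N - (N - (r.1.1 : ℕ)) = r.1.1 by omega]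
      exact r.1.2.isLt.trans_eq (h1.symm.trans (congrArg (jumpCount d N) (hσ1 r).symm))
    · have hrp : (r.1.1 : ℕ) = N - p.1 := by omega
      have hlev : ((σ r).1 : ℕ) = p.1 := by rw [hσ1]; omega
      have hup : (r.1.2 : ℕ) < jumpCount d N p.1 → σ r ∈ upTo p ∩ jumpIdx d N := by
        intro hlt
        rw [Finset.mem_inter, mem_jumpIdx, mem_upTo, hσ2]
        refine ⟨(before_iff_position_lt.1 (Or.inr ⟨Fin.ext hlev, ?_⟩)).le, ?_⟩
        · rw [hσ2]; omega
        · exact hlt.trans_eq (congrArg (jumpCount d N) hlev.symm)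
      have hr2 : (r.1.2 : ℕ) < layerDim d N (N - p.1) :=
        r.1.2.isLt.trans_eq (congrArg (layerDim d N) hrp)
      by_cases hN : N < 2 * (p.1 : ℕ)
      · left
        refine hup ?_
        rwa [jumpCount, if_neg (by omega), if_pos hN]
      · have hpp : N - p.1 = p.1 := by omega
        have hc : jumpCount d N p.1 = 2 * (layerDim d N p.1 / 2) := by
          rw [jumpCount, if_neg (by omega), if_neg hN]
        have hp2 := p.2.isLt
        have hr2' : (r.1.2 : ℕ) < layerDim d N p.1 := hr2.trans_eq (congrArg (layerDim d N) hpp)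
        by_cases hlt : (r.1.2 : ℕ) < jumpCount d N p.1
        · exact Or.inl (hup hlt)
        · exact Or.inr ⟨hN, Idx.ext_of_val hlev (by rw [hσ2]; omega)⟩
  split_ifs with hN
  · rw [add_zero, ← Finset.card_univ]
    exact Finset.card_le_card_of_injOn σ
      (fun r _ => (hmem r).resolve_right fun h => h.1 hN) hσinj.injOn
  · rw [← Finset.card_univ]
    refine (Finset.card_le_card_of_injOn σ (t := insert p (upTo p ∩ jumpIdx d N)) (fun r _ => ?_)
      hσinj.injOn).trans (Finset.card_insert_le _ _)
    rcases hmem r with h | h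
    · exact Finset.mem_insert_of_mem h
    · simp [h.2]

-- The columns up to `p` live on the rows of level at most N minus the level of `p`, and
-- `card_low_le` counts these. In the middle layer a non-jump index exists only if the dimension is
-- odd; a kernel vector of the skew middle block then supplies one more relation.
open Classical in
theorem finrank_span_formCol_upTo_le (hX : IsLayered X)
    (hm : ∀ j, 2 * j ≤ N → layerDim d N j ≤ layerDim d N (N - j)) (ℓ : Module.Dual ℝ (gN d N))
    {p : Idx d N} (hp : p ∉ jumpIdx d N) :
    finrank ℝ (Submodule.span ℝ (formCol X ℓ '' upTo p)) ≤ (upTo p ∩ jumpIdx d N).card := by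
  have hpc : jumpCount d N p.1 ≤ p.2 := not_lt.1 fun h => hp (mem_jumpIdx.2 h)
  have hp2 := p.2.isLt
  have hpN' := level_le p
  have hpN : N ≤ 2 * (p.1 : ℕ) := by
    by_contra h
    rw [jumpCount, if_pos (by omega)] at hpc
    omega
  have hcard := card_low_le hm hp hpN
  have hsub : ∀ (P : (Idx d N → ℝ) → Prop) (_ : ∀ q ∈ upTo p, P (formCol X ℓ q))
      (_ : P 0) (_ : ∀ f g, P f → P g → P (f + g)) (_ : ∀ (c : ℝ) f, P f → P (c • f)),
      ∀ f ∈ Submodule.span ℝ (formCol X ℓ '' upTo p), P f := by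
    intro P h1 h2 h3 h4 f hf
    induction hf using Submodule.span_induction with
    | mem f hf => obtain ⟨q, hq, rfl⟩ := hf; exact h1 q hq
    | zero => exact h2
    | add f g _ _ hf hg => exact h3 f g hf hg
    | smul c f _ hf => exact h4 c f hf
  have hsupp : ∀ f ∈ Submodule.span ℝ (formCol X ℓ '' upTo p), ∀ r : Idx d N,
      ¬ ((r.1 : ℕ) ≤ N - p.1) → f r = 0 := by
    refine hsub _ ?_ (fun r _ => rfl) ?_ ?_
    · intro q hq r hr
      have := level_le_of_mem_upTo hq
      exact formMatrix_eq_zero hX ℓ (by omega)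
    · intro f g hf hg r hr
      rw [Pi.add_apply, hf r hr, hg r hr, add_zero]
    · intro c f hf r hr
      rw [Pi.smul_apply, hf r hr, smul_zero]
  by_cases hN : N < 2 * (p.1 : ℕ)
  · rw [if_pos hN, add_zero] at hcard
    rw [finrank_le_card_of_support _ _ hsupp]
    refine (Submodule.finrank_le _).trans ?_
    rw [finrank_fintype_fun_eq_card]
    exact (Fintype.card_congr (Equiv.refl _)).trans_le hcard
  · rw [if_neg hN] at hcard
    have hc : jumpCount d N p.1 = 2 * (layerDim d N p.1 / 2) := by
      rw [jumpCount, if_neg (by omega), if_neg hN]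
    obtain ⟨x, hx0, hx⟩ := exists_mulVec_eq_zero_of_skew_of_odd
      (M := (formMatrix X ℓ).submatrix
        (Subtype.val : {r : Idx d N // (r.1 : ℕ) = p.1} → _) Subtype.val)
      (fun i j => formMatrix_skew ℓ i.1 j.1) (by
        rw [card_level hpN']
        exact ⟨layerDim d N p.1 / 2, by omega⟩)
    obtain ⟨r₀, hr₀⟩ := Function.ne_iff.1 hx0
    let a : Idx d N → ℝ := fun r => if h : (r.1 : ℕ) = p.1 then x ⟨r, h⟩ else 0
    have har₀ : a r₀ ≠ 0 := by
      simp only [a]; rw [dif_pos r₀.2]; exact hr₀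
    have hlt := finrank_lt_card_of_support _ _ hsupp a (i₀ := r₀)
      (by have := r₀.2; omega) har₀ (by
        refine hsub _ ?_ (by simp) ?_ ?_
        · intro q hq
          rw [sum_dite_mul (fun r : Idx d N => (r.1 : ℕ) = p.1) x]
          rcases (level_le_of_mem_upTo hq).eq_or_lt with h | h
          · have h1 := congrFun hx ⟨q, h.symm⟩
            simp only [Matrix.mulVec, dotProduct, Pi.zero_apply] at h1
            rw [← neg_eq_zero, ← Finset.sum_neg_distrib] at h1
            refine Eq.trans (Finset.sum_congr rfl fun r _ => ?_) h1
            rw [mul_comm, ← neg_mul]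
            congr 1
            exact formMatrix_skew ℓ r.1 q
          · refine Finset.sum_eq_zero fun r _ => ?_
            have h1 : formCol X ℓ q r = 0 := formMatrix_eq_zero hX ℓ (by have := r.2; omega)
            rw [h1, mul_zero]
        · intro f g hf hg
          simp only [Pi.add_apply, mul_add, Finset.sum_add_distrib, hf, hg, add_zero]
        · intro c f hf
          simp only [Pi.smul_apply, smul_eq_mul, mul_left_comm _ c, ← Finset.mul_sum, hf, mul_zero])
    have hcard' : Fintype.card {r : Idx d N // (r.1 : ℕ) ≤ N - p.1} ≤
      (upTo p ∩ jumpIdx d N).card + 1 :=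
        (Fintype.card_congr (Equiv.refl _)).trans_le hcard
    omega

open Classical in
/-- The rank of the columns in an initial segment is at most the number of jump indices in it. -/
theorem finrank_span_formCol_le (hX : IsLayered X)
    (hm : ∀ j, 2 * j ≤ N → layerDim d N j ≤ layerDim d N (N - j)) (ℓ : Module.Dual ℝ (gN d N))
    {s : Finset (Idx d N)} (hs : IsInitial s) :
    finrank ℝ (Submodule.span ℝ (formCol X ℓ '' s)) ≤ (s ∩ jumpIdx d N).card := by
  induction hn : s.card generalizing s with
  | zero =>
    rw [Finset.card_eq_zero] at hn
    subst hn
    simp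
  | succ n ih =>
    -- Remove the last index. A jump index raises the rank by at most one; at any other index the
    -- bound holds directly, without the induction hypothesis.
    obtain ⟨p, hps, hmax⟩ := s.exists_max_image position
      (Finset.card_pos.1 (by omega))
    by_cases hp : p ∈ jumpIdx d N
    · have hs' : IsInitial (s.erase p) := by
        intro q hq r hr
        rw [Finset.mem_erase] at hq ⊢
        refine ⟨?_, hs q hq.2 r hr⟩
        rintro rfl
        have := hmax q hq.2
        omega
      have h1 := ih hs' (by rw [Finset.card_erase_of_mem hps]; omega)
      have h2 : (s ∩ jumpIdx d N).card = (s.erase p ∩ jumpIdx d N).card + 1 := by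
        rw [Finset.erase_inter, Finset.card_erase_add_one (Finset.mem_inter.2 ⟨hps, hp⟩)]
      have h3 : (s : Set (Idx d N)) = insert p (s.erase p : Set (Idx d N)) := by
        rw [← Finset.coe_insert, Finset.insert_erase hps]
      rw [h2, h3, image_insert_eq, Submodule.span_insert]
      refine (Submodule.finrank_add_le_finrank_add_finrank _ _).trans ?_
      have h4 : finrank ℝ (Submodule.span ℝ {formCol X ℓ p}) ≤ 1 :=
        (finrank_span_le_card _).trans (by simp)
      omega
    · have h : s = upTo p := by
        ext q
        rw [mem_upTo]
        refine ⟨fun hq => hmax q hq, fun hq => ?_⟩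
        rcases hq.eq_or_lt with h | h
        · rwa [position_injective h]
        · exact hs p hps q h
      rw [h]
      exact finrank_span_formCol_upTo_le hX hm ℓ hp

theorem formMatrix_mulVec_eq_sum (ℓ : Module.Dual ℝ (gN d N)) (b : Idx d N → ℝ) :
    (formMatrix X ℓ).mulVec b = ∑ q, b q • formCol X ℓ q := by
  funext p
  rw [Finset.sum_apply]
  exact Finset.sum_congr rfl fun q _ => mul_comm _ _

open Classical in
theorem JumpColsIndependent.finrank_eq (hX : IsLayered X)
    (hm : ∀ j, 2 * j ≤ N → layerDim d N j ≤ layerDim d N (N - j)) {ℓ : Module.Dual ℝ (gN d N)}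
    (hℓ : JumpColsIndependent X ℓ) {s : Finset (Idx d N)} (hs : IsInitial s) :
    finrank ℝ (Submodule.span ℝ (formCol X ℓ '' s)) = (s ∩ jumpIdx d N).card := by
  refine le_antisymm (finrank_span_formCol_le hX hm ℓ hs) ?_
  have hli : LinearIndependent ℝ fun q : {q // q ∈ s ∩ jumpIdx d N} => formCol X ℓ q := by
    rw [Fintype.linearIndependent_iff]
    intro g hg q
    let b : Idx d N → ℝ := fun q => if h : q ∈ s ∩ jumpIdx d N then g ⟨q, h⟩ else 0
    have hb : b = 0 := by
      refine hℓ b (fun q hq => dif_neg fun h => hq (Finset.mem_inter.1 h).2) ?_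
      rw [← hg]
      funext p
      rw [formMatrix_mulVec_eq_sum, Finset.sum_apply, Finset.sum_apply]
      refine (sum_dite_mul (fun q => q ∈ s ∩ jumpIdx d N) g fun q => formCol X ℓ q p).trans ?_
      exact Finset.sum_congr (by ext; simp) fun _ _ => rfl
    have h1 := congrFun hb q
    simp only [b] at h1
    rwa [dif_pos q.2] at h1
  have h1 := finrank_span_eq_card hli
  rw [Fintype.card_coe] at h1
  rw [← h1]
  refine Submodule.finrank_mono (Submodule.span_mono ?_)
  rintro _ ⟨q, rfl⟩
  exact ⟨q, (Finset.mem_inter.1 q.2).1, rfl⟩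

-- In a relation among jump columns the last column involved depends on earlier ones. The rank would
-- then not grow at that jump index, against the count.
open Classical in
theorem jumpColsIndependent_of_finrank_eq (hX : IsLayered X)
    (hm : ∀ j, 2 * j ≤ N → layerDim d N j ≤ layerDim d N (N - j)) {ℓ : Module.Dual ℝ (gN d N)}
    (h : ∀ p, finrank ℝ (Submodule.span ℝ (formCol X ℓ '' upTo p)) =
      (upTo p ∩ jumpIdx d N).card) : JumpColsIndependent X ℓ := by
  intro b hbS hb
  by_contra hb0
  obtain ⟨q₀, hq₀⟩ := Function.ne_iff.1 hb0
  obtain ⟨p, hp, hmax⟩ := (Finset.univ.filter fun q => b q ≠ 0).exists_max_image position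
    ⟨q₀, by simpa using hq₀⟩
  have hbp : b p ≠ 0 := by simpa using hp
  have hpS : p ∈ jumpIdx d N := by
    by_contra hn
    exact hbp (hbS p hn)
  rw [formMatrix_mulVec_eq_sum, ← Finset.add_sum_erase _ _ (Finset.mem_univ p)] at hb
  have hmem : formCol X ℓ p ∈ Submodule.span ℝ (formCol X ℓ '' strictlyBefore p) := by
    have h1 : b p • formCol X ℓ p ∈ Submodule.span ℝ (formCol X ℓ '' strictlyBefore p) := by
      rw [eq_neg_of_add_eq_zero_left hb]
      refine neg_mem (Submodule.sum_mem _ fun q hq => ?_)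
      by_cases hbq : b q = 0
      · rw [hbq, zero_smul]; exact zero_mem _
      · refine Submodule.smul_mem _ _ (Submodule.subset_span ⟨q, ?_, rfl⟩)
        rw [Finset.mem_coe, mem_strictlyBefore]
        exact lt_of_le_of_ne (hmax q (by simpa using hbq))
          fun h => (Finset.mem_erase.1 hq).1 (position_injective h)
    have h2 := Submodule.smul_mem _ (b p)⁻¹ h1
    rwa [smul_smul, inv_mul_cancel₀ hbp, one_smul] at h2
  have hle : Submodule.span ℝ (formCol X ℓ '' upTo p) ≤
      Submodule.span ℝ (formCol X ℓ '' strictlyBefore p) := by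
    rw [Submodule.span_le]
    rintro _ ⟨q, hq, rfl⟩
    rw [Finset.mem_coe, upTo, Finset.mem_insert] at hq
    rcases hq with rfl | hq
    · exact hmem
    · exact Submodule.subset_span ⟨q, hq, rfl⟩
  have h1 := Submodule.finrank_mono hle
  rw [h p] at h1
  have h2 := finrank_span_formCol_le hX hm ℓ (isInitial_strictlyBefore p)
  have h3 : (strictlyBefore p ∩ jumpIdx d N).card < (upTo p ∩ jumpIdx d N).card := by
    refine Finset.card_lt_card (Finset.ssubset_iff_of_subset ?_ |>.2 ⟨p, ?_, ?_⟩)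
    · refine Finset.inter_subset_inter_right fun q hq => ?_
      rw [mem_strictlyBefore] at hq
      rw [mem_upTo]
      omega
    · simp [mem_upTo, hpS]
    · simp [mem_strictlyBefore]
  omega

end ColumnRank

end SignatureGroup

end

noncomputable section

namespace SignatureGroup

open Module Set Filter Topology

/-! ### Splitting independence into antidiagonal blocks. -/

section Blocks

variable {d N : ℕ} {X : Module.Basis (Idx d N) ℝ (gN d N)}

/-- The columns at the jump indices of level `k`, restricted to the rows of level `N - k`, are
linearly independent. -/
def BlockIndependent (X : Module.Basis (Idx d N) ℝ (gN d N)) (ℓ : Module.Dual ℝ (gN d N)) (k : ℕ) :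
    Prop :=
  ∀ b : Idx d N → ℝ, (∀ q ∉ jumpIdx d N, b q = 0) → (∀ q : Idx d N, (q.1 : ℕ) ≠ k → b q = 0) →
    (∀ p : Idx d N, (p.1 : ℕ) + k = N → (formMatrix X ℓ).mulVec b p = 0) → b = 0

theorem formMatrix_mulVec_eq_zero (hX : IsLayered X) (ℓ : Module.Dual ℝ (gN d N))
    {b : Idx d N → ℝ} {p : Idx d N} (h : ∀ q : Idx d N, b q ≠ 0 → N < (p.1 : ℕ) + q.1) :
    (formMatrix X ℓ).mulVec b p = 0 := by
  refine Finset.sum_eq_zero fun q _ => ?_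
  change formMatrix X ℓ p q * b q = 0
  by_cases hq : b q = 0
  · rw [hq, mul_zero]
  · rw [formMatrix_eq_zero hX ℓ (h q hq), zero_mul]

/-- Let k be the lowest level on which a kernel vector is nonzero. The rows of level N - k see only
its part of level k, as higher levels pair to zero with them. -/
theorem jumpColsIndependent_of_blockIndependent (hX : IsLayered X) {ℓ : Module.Dual ℝ (gN d N)}
    (h : ∀ k ≤ N, BlockIndependent X ℓ k) : JumpColsIndependent X ℓ := by
  classical
  intro b hbS hb
  by_contra hb0
  obtain ⟨q₀, hq₀⟩ := Function.ne_iff.1 hb0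
  obtain ⟨p, hp, hmin⟩ := (Finset.univ.filter fun q => b q ≠ 0).exists_min_image
    (fun q => (q.1 : ℕ)) ⟨q₀, by simpa using hq₀⟩
  have hbp : b p ≠ 0 := by simpa using hp
  replace hmin : ∀ q, b q ≠ 0 → (p.1 : ℕ) ≤ q.1 := fun q hq => hmin q (by simpa using hq)
  have hpN := level_le p
  have h0 := h p.1 hpN (fun q => if (q.1 : ℕ) = p.1 then b q else 0)
    (fun q hq => by rw [hbS q hq, ite_self]) (fun q hq => if_neg hq) (by
      intro r hr
      refine Eq.trans ?_ (congrFun hb r)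
      refine Finset.sum_congr rfl fun q _ => ?_
      change formMatrix X ℓ r q * (if (q.1 : ℕ) = p.1 then b q else 0) = formMatrix X ℓ r q * b q
      split_ifs with hq
      · rfl
      · by_cases hbq : b q = 0
        · rw [hbq]
        · have := hmin q hbq
          rw [formMatrix_eq_zero hX ℓ (by omega), zero_mul, zero_mul])
  have h1 := congrFun h0 p
  rw [if_pos rfl] at h1
  exact hbp h1

/-- The reflection (k, i) ↦ (N - k, i) again. The bound makes the system in
`JumpColsIndependent.blockIndependent` square. -/
theorem card_level_lt_le (hm : ∀ j, 2 * j ≤ N → layerDim d N j ≤ layerDim d N (N - j)) {k : ℕ}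
    (hk : N ≤ 2 * k) :
    Fintype.card {p : Idx d N // (p.1 : ℕ) + k < N} ≤
      Fintype.card {q : Idx d N // q ∈ jumpIdx d N ∧ k < (q.1 : ℕ)} := by
  have hc : ∀ p : Idx d N, (p.1 : ℕ) + k < N →
      layerDim d N p.1 = jumpCount d N (p.1.rev : Fin _) := by
    intro p hp
    rw [Fin.val_rev, jumpCount, if_neg (by omega), if_pos (by omega)]
    congr 1
    omega
  have hlt : ∀ p : Idx d N, (p.1 : ℕ) + k < N → (p.2 : ℕ) < layerDim d N (p.1.rev : Fin _) :=
    fun p hp => p.2.isLt.trans_le ((hc p hp).trans_le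
      (jumpCount_le hm (Nat.lt_succ_iff.1 p.1.rev.isLt)))
  refine Fintype.card_le_of_injective
    (fun p => ⟨⟨p.1.1.rev, ⟨p.1.2, hlt p.1 p.2⟩⟩, ?_, ?_⟩) ?_
  · exact mem_jumpIdx.2 (p.1.2.isLt.trans_eq (hc p.1 p.2))
  · have := p.2
    change k < ((p.1.1.rev : Fin (N + 1)) : ℕ)
    rw [Fin.val_rev]
    omega
  · intro p p' h
    have h1 := congrArg Subtype.val h
    have h2 : p.1.1.rev = p'.1.1.rev := congrArg Sigma.fst h1
    have h3 : (p.1.2 : ℕ) = p'.1.2 := congrArg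
      (fun q : {q : Idx d N // q ∈ jumpIdx d N ∧ k < (q.1 : ℕ)} => (q.1.2 : ℕ)) h
    exact Subtype.ext (Idx.ext_of_val (congrArg Fin.val (Fin.rev_injective h2)) h3)

/-- On rows of level below N - k, the jump columns of level above k form an invertible square
system, and they vanish on all other rows. A kernel vector of the block can thus be corrected by
higher levels to a kernel vector of the whole matrix. -/
theorem JumpColsIndependent.blockIndependent (hX : IsLayered X)
    (hm : ∀ j, 2 * j ≤ N → layerDim d N j ≤ layerDim d N (N - j)) {ℓ : Module.Dual ℝ (gN d N)}
    (hℓ : JumpColsIndependent X ℓ) {k : ℕ} (hk : N ≤ 2 * k) : BlockIndependent X ℓ k := by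
  classical
  let J := {q : Idx d N // q ∈ jumpIdx d N ∧ k < (q.1 : ℕ)}
  let R := {p : Idx d N // (p.1 : ℕ) + k < N}
  let ext : (J → ℝ) → Idx d N → ℝ := fun c q =>
    if h : q ∈ jumpIdx d N ∧ k < (q.1 : ℕ) then c ⟨q, h⟩ else 0
  have hext : ∀ c q, ext c q ≠ 0 → q ∈ jumpIdx d N ∧ k < (q.1 : ℕ) := fun c q hq => by
    by_contra h
    exact hq (dif_neg h)
  let T : (J → ℝ) →ₗ[ℝ] (R → ℝ) :=
    ((formMatrix X ℓ).submatrix (Subtype.val : R → _) (Subtype.val : J → _)).mulVecLin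
  have hT : ∀ c (r : R), T c r = (formMatrix X ℓ).mulVec (ext c) r := by
    intro c r
    have h1 := sum_dite_mul (fun q : Idx d N => q ∈ jumpIdx d N ∧ k < (q.1 : ℕ)) c
      (fun q => formMatrix X ℓ r q)
    refine Eq.trans ?_ (h1.symm.trans ?_)
    · exact Finset.sum_congr rfl fun q _ => mul_comm _ _
    · exact Finset.sum_congr rfl fun q _ => mul_comm _ _
  have hker : ∀ c, T c = 0 → c = 0 := by
    intro c hc
    have h0 : ext c = 0 := by
      refine hℓ _ (fun q hq => by_contra fun h => hq (hext c q h).1) (funext fun p => ?_)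
      by_cases hp : (p.1 : ℕ) + k < N
      · rw [← hT c ⟨p, hp⟩, hc]; rfl
      · exact formMatrix_mulVec_eq_zero hX ℓ fun q hq => by have := (hext c q hq).2; omega
    funext q
    have h1 := congrFun h0 q
    simp only [ext] at h1
    rwa [dif_pos q.2] at h1
  have hinj : Function.Injective T := by
    rw [← LinearMap.ker_eq_bot, LinearMap.ker_eq_bot']
    exact hker
  have hsurj : Function.Surjective T := by
    refine (LinearMap.injective_iff_surjective_of_finrank_eq_finrank ?_).1 hinj
    refine le_antisymm (LinearMap.finrank_le_finrank_of_injective hinj) ?_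
    rw [finrank_fintype_fun_eq_card, finrank_fintype_fun_eq_card]
    exact card_level_lt_le hm hk
  intro b hbS hbk hb
  obtain ⟨c, hc⟩ := hsurj fun r => (formMatrix X ℓ).mulVec b r
  have h0 : b - ext c = 0 := by
    refine hℓ _ (fun q hq => ?_) (funext fun p => ?_)
    · rw [Pi.sub_apply, hbS q hq, show ext c q = 0 from by_contra fun h => hq (hext c q h).1,
        sub_zero]
    · rw [Matrix.mulVec_sub, Pi.sub_apply, Pi.zero_apply, sub_eq_zero]
      by_cases hp : (p.1 : ℕ) + k < N
      · rw [← hT c ⟨p, hp⟩, hc]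
      · rw [formMatrix_mulVec_eq_zero hX ℓ (b := ext c)
          fun q hq => by have := (hext c q hq).2; omega]
        rcases (not_lt.1 hp).eq_or_lt with h | h
        · exact hb p h.symm
        · refine formMatrix_mulVec_eq_zero hX ℓ fun q hq => ?_
          have : (q.1 : ℕ) = k := by_contra fun h => hq (hbk q h)
          omega
  funext q
  by_cases hq : (q.1 : ℕ) = k
  · have h1 := congrFun h0 q
    rw [Pi.sub_apply, show ext c q = 0 from by_contra fun h => by
      have := (hext c q h).2; omega, sub_zero] at h1
    exact h1
  · exact hbk q hq

end Blocks

end SignatureGroup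

end

noncomputable section

namespace SignatureGroup

open Module Set Filter Topology

/-! ### Rank criteria by rows and columns. -/

section MatrixRank

variable {ι κ : Type*} [Fintype ι]

theorem rank_eq_card_rows_iff [Fintype κ] (A : Matrix ι κ ℝ) :
    A.rank = Fintype.card ι ↔ ∀ a : ι → ℝ, Matrix.vecMul a A = 0 → a = 0 := by
  rw [Matrix.rank_eq_finrank_span_row, eq_comm, ← Set.finrank,
    ← linearIndependent_iff_card_eq_finrank_span, ← Matrix.vecMul_injective_iff,
    ← Matrix.coe_vecMulLinear, ← LinearMap.ker_eq_bot, LinearMap.ker_eq_bot']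
  rfl

theorem rank_eq_card_cols_iff [Fintype κ] (A : Matrix ι κ ℝ) :
    A.rank = Fintype.card κ ↔ ∀ b : κ → ℝ, A.mulVec b = 0 → b = 0 := by
  rw [← Matrix.rank_transpose, rank_eq_card_rows_iff]
  simp only [Matrix.vecMul_transpose]

theorem linearIndependent_rows_iff (A : Matrix ι κ ℝ) (P : ι → Prop) :
    LinearIndependent ℝ (fun i : {i // P i} => A i.1) ↔
      ∀ a : ι → ℝ, (∀ i, ¬ P i → a i = 0) → Matrix.vecMul a A = 0 → a = 0 := by
  classical
  rw [Fintype.linearIndependent_iff]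
  constructor
  · intro h a ha h0
    have h1 := h (fun i => a i) (by
      rw [← h0, Matrix.vecMul_eq_sum, ← Fintype.sum_subtype_add_sum_subtype P, left_eq_add]
      exact Finset.sum_eq_zero fun i _ => by rw [ha i i.2, zero_smul])
    funext i
    by_cases hi : P i
    · exact h1 ⟨i, hi⟩
    · exact ha i hi
  · intro h g hg i
    have h1 := h (fun i => if hi : P i then g ⟨i, hi⟩ else 0) (fun i hi => dif_neg hi) (by
      rw [← hg, Matrix.vecMul_eq_sum]
      funext j
      rw [Finset.sum_apply, Finset.sum_apply]
      exact sum_dite_mul P g fun i => A i j)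
    have h2 := congrFun h1 i.1
    simp only [i.2, dite_true] at h2
    exact h2

theorem card_le_rank_of_rows [Fintype κ] (A : Matrix ι κ ℝ) (P : ι → Prop) [DecidablePred P]
    (h : ∀ a : ι → ℝ, (∀ i, ¬ P i → a i = 0) → Matrix.vecMul a A = 0 → a = 0) :
    Fintype.card {i // P i} ≤ A.rank := by
  have h1 := finrank_span_eq_card ((linearIndependent_rows_iff A P).2 h)
  rw [← h1, Matrix.rank_eq_finrank_span_row]
  refine Submodule.finrank_mono (Submodule.span_mono ?_)
  rintro _ ⟨i, rfl⟩
  exact ⟨i.1, rfl⟩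

end MatrixRank

/-! ### From blocks to the ranks of the bracket matrices. -/

section BracketMatrix

variable {d N : ℕ} {X : Module.Basis (Idx d N) ℝ (gN d N)}

theorem exists_level_extension (k : Fin (N + 1)) (a : Fin (layerDim d N k) → ℝ) :
    ∃ b : Idx d N → ℝ, (∀ i, b ⟨k, i⟩ = a i) ∧ ∀ q : Idx d N, (q.1 : ℕ) ≠ k → b q = 0 := by
  refine ⟨fun q => if h : (q.1 : ℕ) = k then
    a ⟨q.2, q.2.isLt.trans_eq (congrArg (layerDim d N) h)⟩ else 0, fun i => ?_, fun q hq => ?_⟩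
  · exact dif_pos rfl
  · exact dif_neg hq

theorem formMatrix_mulVec_of_level (ℓ : Module.Dual ℝ (gN d N)) {k : Fin (N + 1)}
    {b : Idx d N → ℝ} (hb : ∀ q : Idx d N, (q.1 : ℕ) ≠ k → b q = 0) (p : Idx d N) :
    (formMatrix X ℓ).mulVec b p = ∑ i, ℓ ⁅X p, X ⟨k, i⟩⁆ * b ⟨k, i⟩ := by
  have h1 : (formMatrix X ℓ).mulVec b p = ∑ q, ℓ ⁅X p, X q⁆ * b q := rfl
  rw [h1, Fintype.sum_sigma, Finset.sum_eq_single k]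
  · intro k' _ hk'
    exact Finset.sum_eq_zero fun i _ => by
      rw [hb ⟨k', i⟩ fun h => hk' (Fin.ext h), mul_zero]
  · simp

theorem vecMul_bracketMatrix (ℓ : Module.Dual ℝ (gN d N)) {k : Fin (N + 1)} {m : ℕ}
    {b : Idx d N → ℝ} (hb : ∀ q : Idx d N, (q.1 : ℕ) ≠ k → b q = 0)
    (j : {j : Fin (layerDim d N k.rev) // (j : ℕ) < m}) :
    Matrix.vecMul (fun i => b ⟨k, i⟩) (bracketMatrix X ℓ k m) j =
      - (formMatrix X ℓ).mulVec b ⟨k.rev, j.1⟩ := by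
  have h1 : Matrix.vecMul (fun i => b ⟨k, i⟩) (bracketMatrix X ℓ k m) j =
    ∑ i, b ⟨k, i⟩ * ℓ ⁅X ⟨k, i⟩, X ⟨k.rev, j.1⟩⁆ := rfl
  rw [h1, formMatrix_mulVec_of_level ℓ hb, ← Finset.sum_neg_distrib]
  refine Finset.sum_congr rfl fun i _ => ?_
  rw [← lie_skew, map_neg]
  ring

theorem eq_of_level_eq {k : Fin (N + 1)} {p : Idx d N} (h : (p.1 : ℕ) = k) :
    ∃ i, p = ⟨k, i⟩ := by
  obtain ⟨k', i⟩ := p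
  obtain rfl : k' = k := Fin.ext h
  exact ⟨i, rfl⟩

theorem blockIndependent_of_rows {ℓ : Module.Dual ℝ (gN d N)} {k : Fin (N + 1)} {m : ℕ}
    (h : ∀ a : Fin (layerDim d N k) → ℝ, (∀ i : Fin (layerDim d N k), ¬ (i : ℕ) < jumpCount d N k → a i = 0) →
      Matrix.vecMul a (bracketMatrix X ℓ k m) = 0 → a = 0) : BlockIndependent X ℓ k := by
  intro b hbS hbk hb
  have h1 := h (fun i => b ⟨k, i⟩) (fun i hi => hbS _ fun hS => hi (mem_jumpIdx.1 hS)) (by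
    funext j
    rw [vecMul_bracketMatrix ℓ hbk, hb _ (by
      change ((k.rev : Fin (N + 1)) : ℕ) + k = N
      have := k.isLt
      rw [Fin.val_rev]; omega), neg_zero]
    rfl)
  funext q
  by_cases hq : (q.1 : ℕ) = k
  · obtain ⟨i, rfl⟩ := eq_of_level_eq hq
    exact congrFun h1 i
  · exact hbk q hq

theorem BlockIndependent.rows {ℓ : Module.Dual ℝ (gN d N)} {k : Fin (N + 1)} {m : ℕ}
    (h : BlockIndependent X ℓ k) (hm : layerDim d N k.rev ≤ m) (a : Fin (layerDim d N k) → ℝ)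
    (ha : ∀ i : Fin (layerDim d N k), ¬ (i : ℕ) < jumpCount d N k → a i = 0)
    (h0 : Matrix.vecMul a (bracketMatrix X ℓ k m) = 0) : a = 0 := by
  obtain ⟨b, hba, hbk⟩ := exists_level_extension k a
  obtain rfl : a = fun i => b ⟨k, i⟩ := funext fun i => (hba i).symm
  have h1 := h b (fun q hq => by
    by_cases hqk : (q.1 : ℕ) = k
    · obtain ⟨i, rfl⟩ := eq_of_level_eq hqk
      exact ha i fun hi => hq (mem_jumpIdx.2 hi)
    · exact hbk q hqk) hbk (fun p hp => by
      obtain ⟨j, rfl⟩ := eq_of_level_eq (k := k.rev) (p := p) (by rw [Fin.val_rev]; omega)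
      have h2 := congrFun h0 ⟨j, j.isLt.trans_le hm⟩
      rw [vecMul_bracketMatrix ℓ hbk] at h2
      exact neg_eq_zero.1 h2)
  rw [h1]
  rfl

theorem layerDim_rev_sub (k : Fin (N + 1)) : layerDim d N (N - (k.rev : Fin _)) = layerDim d N k := by
  have := k.isLt
  rw [Fin.val_rev]
  congr 1
  omega

/-- Below the middle, the jump indices of the complementary level N - k are its first m_k indices,
and these are exactly the columns kept in the bracket matrix. -/
theorem blockIndependent_rev_iff {ℓ : Module.Dual ℝ (gN d N)} {k : Fin (N + 1)} (hk : 2 * (k : ℕ) < N) :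
    BlockIndependent X ℓ k.rev ↔
      ∀ b, (bracketMatrix X ℓ k (layerDim d N k)).mulVec b = 0 → b = 0 := by
  have hc : jumpCount d N (k.rev : Fin (N + 1)) = layerDim d N k := by
    rw [jumpCount, if_neg (by rw [Fin.val_rev]; omega), if_pos (by rw [Fin.val_rev]; omega),
      layerDim_rev_sub]
  have hmul : ∀ (b : Idx d N → ℝ), (∀ q ∉ jumpIdx d N, b q = 0) →
      (∀ q : Idx d N, (q.1 : ℕ) ≠ (k.rev : Fin (N + 1)) → b q = 0) → ∀ i,
      (bracketMatrix X ℓ k (layerDim d N k)).mulVec (fun j => b ⟨k.rev, j.1⟩) i =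
        (formMatrix X ℓ).mulVec b ⟨k, i⟩ := by
    intro b hbS hbk i
    rw [formMatrix_mulVec_of_level ℓ hbk,
      ← Fintype.sum_subtype_add_sum_subtype (fun j : Fin (layerDim d N k.rev) =>
        (j : ℕ) < layerDim d N k)]
    refine (add_eq_left.2 (Finset.sum_eq_zero fun j _ => ?_)).symm
    rw [hbS _ fun hS => j.2 ((mem_jumpIdx.1 hS).trans_eq hc), mul_zero]
  have hkk : (k : ℕ) + (k.rev : Fin (N + 1)) = N := by rw [Fin.val_rev]; omega
  constructor
  · intro h b hb
    obtain ⟨b', hb', hbk⟩ := exists_level_extension k.rev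
      fun j => if hj : (j : ℕ) < layerDim d N k then b ⟨j, hj⟩ else 0
    obtain rfl : b = fun j => b' ⟨k.rev, j.1⟩ := funext fun j => by rw [hb', dif_pos j.2]
    have hS : ∀ q ∉ jumpIdx d N, b' q = 0 := by
      intro q hq
      by_cases hqk : (q.1 : ℕ) = (k.rev : Fin (N + 1))
      · obtain ⟨j, rfl⟩ := eq_of_level_eq hqk
        rw [hb', dif_neg fun hj => hq (mem_jumpIdx.2 (hj.trans_eq hc.symm))]
      · exact hbk q hqk
    have h1 := h b' hS hbk (fun p hp => by
      obtain ⟨i, rfl⟩ := eq_of_level_eq (k := k) (p := p) (by omega)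
      rw [← hmul b' hS hbk, hb]
      rfl)
    rw [h1]
    rfl
  · intro h b hbS hbk hb
    have h1 := h (fun j => b ⟨k.rev, j.1⟩) (funext fun i => by
      rw [hmul b hbS hbk, hb _ hkk]
      rfl)
    funext q
    by_cases hqk : (q.1 : ℕ) = (k.rev : Fin (N + 1))
    · obtain ⟨j, rfl⟩ := eq_of_level_eq hqk
      by_cases hj : (j : ℕ) < layerDim d N k
      · exact congrFun h1 ⟨j, hj⟩
      · exact hbS _ fun hS => hj ((mem_jumpIdx.1 hS).trans_eq hc)
    · exact hbk q hqk

theorem card_fin_subtype_lt {m n : ℕ} (h : n ≤ m) : Fintype.card {j : Fin m // (j : ℕ) < n} = n := by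
  rw [Fintype.card_subtype, Fin.card_filter_val_lt, min_eq_right h]

/-- The bound comes from the number of rows below the middle and the number of columns above it. In
the middle the matrix is skew, so full rank is impossible in odd size. -/
theorem rank_bracketMatrix_le_jumpCount (ℓ : Module.Dual ℝ (gN d N)) (k : Fin (N + 1)) :
    (bracketMatrix X ℓ k (layerDim d N k)).rank ≤ jumpCount d N k := by
  have hrow : (bracketMatrix X ℓ k (layerDim d N k)).rank ≤ layerDim d N k :=
    (Matrix.rank_le_card_height _).trans_eq (Fintype.card_fin _)
  unfold jumpCount
  split_ifs with h1 h2
  · exact hrow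
  · refine (Matrix.rank_le_card_width _).trans ((Fintype.card_subtype_le _).trans_eq ?_)
    rw [Fintype.card_fin, Fin.val_rev]
    congr 1
    omega
  · by_contra hlt
    have hk : 2 * (k : ℕ) = N := by omega
    have hrank : (bracketMatrix X ℓ k (layerDim d N k)).rank =
        Fintype.card (Fin (layerDim d N k)) := by rw [Fintype.card_fin]; omega
    rw [rank_eq_card_rows_iff] at hrank
    obtain ⟨x, hx0, hx⟩ := exists_mulVec_eq_zero_of_skew_of_odd
      (M := (formMatrix X ℓ).submatrix (fun i : Fin (layerDim d N k) => (⟨k, i⟩ : Idx d N))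
        fun i => ⟨k, i⟩)
      (fun i j => formMatrix_skew ℓ _ _) (by
        rw [Fintype.card_fin, ← Nat.not_even_iff_odd, even_iff_two_dvd]
        omega)
    obtain ⟨b, hb, hbk⟩ := exists_level_extension k x
    obtain rfl : x = fun i => b ⟨k, i⟩ := funext fun i => (hb i).symm
    refine hx0 (hrank _ (funext fun j => ?_))
    rw [vecMul_bracketMatrix ℓ hbk]
    obtain ⟨i, hi⟩ := eq_of_level_eq (k := k) (p := (⟨k.rev, j.1⟩ : Idx d N)) (by
      change ((k.rev : Fin (N + 1)) : ℕ) = k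
      rw [Fin.val_rev]; omega)
    rw [hi, formMatrix_mulVec_of_level ℓ hbk]
    exact neg_eq_zero.2 (congrFun hx i)

theorem layerDim_rev_le (hm : ∀ j, 2 * j ≤ N → layerDim d N j ≤ layerDim d N (N - j))
    {k : Fin (N + 1)} (hk : N ≤ 2 * (k : ℕ)) :
    layerDim d N (k.rev : Fin (N + 1)) ≤ layerDim d N k := by
  have := hm (k.rev : Fin (N + 1)) (by rw [Fin.val_rev]; omega)
  rwa [layerDim_rev_sub] at this

theorem le_layerDim_rev (hm : ∀ j, 2 * j ≤ N → layerDim d N j ≤ layerDim d N (N - j))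
    {k : Fin (N + 1)} (hk : 2 * (k : ℕ) ≤ N) :
    layerDim d N k ≤ layerDim d N (k.rev : Fin (N + 1)) :=
  (hm k hk).trans_eq (congrArg (layerDim d N) (by rw [Fin.val_rev]; omega))

theorem JumpColsIndependent.rank_eq (hX : IsLayered X)
    (hm : ∀ j, 2 * j ≤ N → layerDim d N j ≤ layerDim d N (N - j)) {ℓ : Module.Dual ℝ (gN d N)}
    (hℓ : JumpColsIndependent X ℓ) (k : Fin (N + 1)) :
    (bracketMatrix X ℓ k (layerDim d N k)).rank = jumpCount d N k := by
  refine le_antisymm (rank_bracketMatrix_le_jumpCount ℓ k) ?_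
  rcases Nat.lt_or_ge (2 * (k : ℕ)) N with hk | hk
  · have h1 := (blockIndependent_rev_iff hk).1
      (hℓ.blockIndependent hX hm (k := (k.rev : Fin (N + 1))) (by rw [Fin.val_rev]; omega))
    rw [← rank_eq_card_cols_iff, card_fin_subtype_lt (le_layerDim_rev hm hk.le)] at h1
    rw [h1, jumpCount, if_pos hk]
  · have h1 := card_le_rank_of_rows (bracketMatrix X ℓ k (layerDim d N k))
      (fun i => (i : ℕ) < jumpCount d N k)
      ((hℓ.blockIndependent hX hm hk).rows (layerDim_rev_le hm hk))
    rwa [card_fin_subtype_lt (jumpCount_le hm (Nat.lt_succ_iff.1 k.isLt))] at h1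

theorem maxRank_eq_jumpCount (hX : IsLayered X)
    (hm : ∀ j, 2 * j ≤ N → layerDim d N j ≤ layerDim d N (N - j)) (k : Fin (N + 1)) :
    maxRank X k (layerDim d N k) = jumpCount d N k := by
  obtain ⟨ℓ₀, hℓ₀⟩ := exists_jumpColsIndependent hX hm
  refine le_antisymm (ciSup_le fun ℓ => rank_bracketMatrix_le_jumpCount ℓ k) ?_
  rw [← hℓ₀.rank_eq hX hm k]
  exact le_ciSup (f := fun ℓ => (bracketMatrix X ℓ k (layerDim d N k)).rank)
    ⟨jumpCount d N k, by rintro _ ⟨ℓ, rfl⟩; exact rank_bracketMatrix_le_jumpCount ℓ k⟩ ℓ₀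

/-- The blocks of k and N - k are transposes of each other up to sign, so k ≤ N/2 suffices. Maximal
rank is full rank except in a middle layer of odd dimension. There rank m - 1 does not say which
rows are independent, hence the separate condition on the first m - 1 rows. -/
theorem jumpColsIndependent_iff (hX : IsLayered X)
    (hm : ∀ j, 2 * j ≤ N → layerDim d N j ≤ layerDim d N (N - j)) {ℓ : Module.Dual ℝ (gN d N)} :
    JumpColsIndependent X ℓ ↔
      (∀ k : Fin (N + 1), 1 ≤ (k : ℕ) → (k : ℕ) ≤ N / 2 →
        (bracketMatrix X ℓ k (layerDim d N k)).rank = maxRank X k (layerDim d N k)) ∧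
      ∀ k : Fin (N + 1), 2 * (k : ℕ) = N → Odd (layerDim d N k) →
        LinearIndependent ℝ
          (fun i : {i : Fin (layerDim d N k) // (i : ℕ) + 1 < layerDim d N k} =>
            bracketMatrix X ℓ k (layerDim d N k) i.1) := by
  have hodd : ∀ k : Fin (N + 1), 2 * (k : ℕ) = N → Odd (layerDim d N k) → ∀ i : ℕ,
      i + 1 < layerDim d N k ↔ i < jumpCount d N k := by
    rintro k hk ⟨c, hc⟩ i
    rw [jumpCount, if_neg (by omega), if_neg (by omega)]
    omega
  constructor
  · intro h
    refine ⟨fun k _ _ => ?_, fun k hk ho => ?_⟩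
    · rw [maxRank_eq_jumpCount hX hm, h.rank_eq hX hm]
    · rw [linearIndependent_rows_iff _ fun i : Fin (layerDim d N k) => (i : ℕ) + 1 < layerDim d N k]
      intro a ha
      exact (h.blockIndependent hX hm hk.ge).rows (layerDim_rev_le hm hk.ge) a
        fun i hi => ha i fun h => hi ((hodd k hk ho i).1 h)
  · rintro ⟨h1, h2⟩
    have hfull : ∀ k : Fin (N + 1), 1 ≤ (k : ℕ) → (k : ℕ) ≤ N / 2 →
        jumpCount d N k = layerDim d N k →
        (bracketMatrix X ℓ k (layerDim d N k)).rank = layerDim d N k := fun k hk1 hk hc => by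
      rw [h1 k hk1 hk, maxRank_eq_jumpCount hX hm, hc]
    have hrows : ∀ k : Fin (N + 1), 1 ≤ (k : ℕ) → (k : ℕ) ≤ N / 2 →
        jumpCount d N k = layerDim d N k → BlockIndependent X ℓ k := fun k hk1 hk hc => by
      have h3 := hfull k hk1 hk hc
      have h4 := (rank_eq_card_rows_iff _).1 (h3.trans (Fintype.card_fin _).symm)
      exact blockIndependent_of_rows fun a _ => h4 a
    refine jumpColsIndependent_of_blockIndependent hX fun k hkN => ?_
    lift k to Fin (N + 1) using Nat.lt_succ_of_le hkN
    rcases Nat.eq_zero_or_pos (k : ℕ) with hk0 | hk1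
    · intro b _ hbk _
      funext q
      exact hbk q (by have := one_le_level q; omega)
    rcases lt_trichotomy (2 * (k : ℕ)) N with hk | hk | hk
    · exact hrows k hk1 (by omega) (by rw [jumpCount, if_pos hk])
    · by_cases ho : Odd (layerDim d N k)
      · have h3 := h2 k hk ho
        rw [linearIndependent_rows_iff _ fun i : Fin (layerDim d N k) =>
          (i : ℕ) + 1 < layerDim d N k] at h3
        exact blockIndependent_of_rows fun a ha =>
          h3 a fun i hi => ha i fun h => hi ((hodd k hk ho i).2 h)
      · refine hrows k hk1 (by omega) ?_
        rw [jumpCount, if_neg (by omega), if_neg (by omega)]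
        rw [Nat.not_odd_iff_even, even_iff_two_dvd] at ho
        omega
    · by_cases hkN' : (k : ℕ) = N
      · intro b hbS hbk _
        funext q
        by_cases hq : (q.1 : ℕ) = k
        · refine hbS q fun hS => ?_
          have h3 := (mem_jumpIdx.1 hS).trans_eq
            ((congrArg (jumpCount d N) (hq.trans hkN')).trans (jumpCount_self d N))
          omega
        · exact hbk q hq
      -- Above the middle, full rank at the complementary level means independent columns there,
      -- since that bracket matrix is square.
      · have hr : ((k.rev : Fin (N + 1)) : ℕ) = N - k := by rw [Fin.val_rev]; omega
        have hk2 : 2 * ((k.rev : Fin (N + 1)) : ℕ) < N := by omega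
        have h3 := hfull k.rev (by omega) (by omega) (by rw [jumpCount, if_pos hk2])
        have h4 := (rank_eq_card_cols_iff (bracketMatrix X ℓ k.rev (layerDim d N k.rev))).1
          (h3.trans (card_fin_subtype_lt (le_layerDim_rev hm hk2.le)).symm)
        have h5 := (blockIndependent_rev_iff hk2).2 h4
        rwa [Fin.rev_rev] at h5

end BracketMatrix

end SignatureGroup

end

noncomputable section

namespace SignatureGroup

open Module Set Filter Topology

/-! ### Jump indices and general position. -/

section JumpSet

variable {d N : ℕ} {X : Module.Basis (Idx d N) ℝ (gN d N)}

theorem IsInitial.orbitDim_eq (hX : IsLayered X) (ℓ : Module.Dual ℝ (gN d N))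
    {s : Finset (Idx d N)} (hs : IsInitial s) :
    orbitDim X ℓ s = finrank ℝ (Submodule.span ℝ (formCol X ℓ '' s)) :=
  orbitDim_eq_finrank hX ℓ s fun q hq p hp => hs q hq p (position_lt_of_level_lt hp)

open Classical in
theorem IsInitial.maxOrbitDim_eq (hX : IsLayered X)
    (hm : ∀ j, 2 * j ≤ N → layerDim d N j ≤ layerDim d N (N - j))
    {s : Finset (Idx d N)} (hs : IsInitial s) :
    maxOrbitDim X s = (s ∩ jumpIdx d N).card := by
  obtain ⟨ℓ₀, hℓ₀⟩ := exists_jumpColsIndependent hX hm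
  refine le_antisymm (iSup_le fun ℓ => ?_) ?_
  · rw [hs.orbitDim_eq hX]
    exact_mod_cast finrank_span_formCol_le hX hm ℓ hs
  · rw [← hℓ₀.finrank_eq hX hm hs, ← hs.orbitDim_eq hX]
    exact le_iSup (fun ℓ => orbitDim X ℓ s) ℓ₀

theorem jumpSet_eq (hX : IsLayered X)
    (hm : ∀ j, 2 * j ≤ N → layerDim d N j ≤ layerDim d N (N - j)) :
    jumpSet X = {p | (p.2 : ℕ) < jumpCount d N p.1} := by
  classical
  ext p
  rw [mem_ofPred_eq, ← mem_jumpIdx, jumpSet, mem_ofPred_eq,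
    (isInitial_strictlyBefore p).maxOrbitDim_eq hX hm, (isInitial_upTo p).maxOrbitDim_eq hX hm,
    Nat.cast_lt, upTo]
  have hp : p ∉ strictlyBefore p ∩ jumpIdx d N := fun h =>
    lt_irrefl _ (mem_strictlyBefore.1 (Finset.mem_inter.1 h).1)
  by_cases h : p ∈ jumpIdx d N
  · rw [Finset.insert_inter_of_mem h, Finset.card_insert_of_notMem hp]
    exact iff_of_true (Nat.lt_succ_self _) h
  · rw [Finset.insert_inter_of_notMem h]
    exact iff_of_false (lt_irrefl _) h

theorem inGeneralPosition_iff (hX : IsLayered X)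
    (hm : ∀ j, 2 * j ≤ N → layerDim d N j ≤ layerDim d N (N - j)) {ℓ : Module.Dual ℝ (gN d N)} :
    InGeneralPosition X ℓ ↔ JumpColsIndependent X ℓ := by
  classical
  constructor
  · intro h
    obtain ⟨ℓ₀, hℓ₀⟩ := exists_jumpColsIndependent hX hm
    refine jumpColsIndependent_of_finrank_eq hX hm fun p =>
      le_antisymm (finrank_span_formCol_le hX hm ℓ (isInitial_upTo p)) ?_
    have h1 := h p ℓ₀
    rw [(isInitial_upTo p).orbitDim_eq hX, (isInitial_upTo p).orbitDim_eq hX,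
      hℓ₀.finrank_eq hX hm (isInitial_upTo p)] at h1
    exact_mod_cast h1
  · intro h p ℓ'
    rw [(isInitial_upTo p).orbitDim_eq hX, (isInitial_upTo p).orbitDim_eq hX,
      h.finrank_eq hX hm (isInitial_upTo p)]
    exact_mod_cast finrank_span_formCol_le hX hm ℓ' (isInitial_upTo p)

end JumpSet

end SignatureGroup

end

theorem mainTheorem5 (d N : ℕ) (hd : 1 ≤ d) (hN : 1 ≤ N)
    (hexc : ¬ (N = 3 ∧ d = 2)) (hd1 : d = 1 → N ≤ 2)
    (X : Module.Basis (SignatureGroup.Idx d N) ℝ (SignatureGroup.gN d N))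
    (hX : SignatureGroup.IsLayered X) :
    -- the set of jump indices
    SignatureGroup.jumpSet X =
        {p | 1 ≤ (p.1 : ℕ) ∧ (p.1 : ℕ) ≤ N - 1 ∧
          (p.2 : ℕ) + 1 ≤ SignatureGroup.maxRank X p.1 (SignatureGroup.layerDim d N p.1)} ∧
    -- its complement, in the two cases
    ((¬ Even N ∨ Even (SignatureGroup.layerDim d N (N / 2))) →
      SignatureGroup.nonJumpSet X =
        {p | N < 2 * (p.1 : ℕ) ∧
          SignatureGroup.layerDim d N (N - (p.1 : ℕ)) + 1 ≤ (p.2 : ℕ) + 1}) ∧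
    ((Even N ∧ Odd (SignatureGroup.layerDim d N (N / 2))) →
      SignatureGroup.nonJumpSet X =
        {p | N < 2 * (p.1 : ℕ) ∧
          SignatureGroup.layerDim d N (N - (p.1 : ℕ)) + 1 ≤ (p.2 : ℕ) + 1} ∪
        {p | (p.1 : ℕ) = N / 2 ∧ (p.2 : ℕ) + 1 = SignatureGroup.layerDim d N (N / 2)}) ∧
    -- the functionals in general position
    {ℓ : Module.Dual ℝ (SignatureGroup.gN d N) | SignatureGroup.InGeneralPosition X ℓ} =
      {ℓ | (∀ k : Fin (N + 1), 1 ≤ (k : ℕ) → (k : ℕ) ≤ N / 2 →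
            (SignatureGroup.bracketMatrix X ℓ k (SignatureGroup.layerDim d N k)).rank =
              SignatureGroup.maxRank X k (SignatureGroup.layerDim d N k)) ∧
          (∀ k : Fin (N + 1), 2 * (k : ℕ) = N → Odd (SignatureGroup.layerDim d N k) →
            LinearIndependent ℝ
              (fun i : {i : Fin (SignatureGroup.layerDim d N k) //
                  (i : ℕ) + 1 < SignatureGroup.layerDim d N k} =>
                SignatureGroup.bracketMatrix X ℓ k (SignatureGroup.layerDim d N k) i.1))} := by
  have hm : ∀ j, 2 * j ≤ N →
      SignatureGroup.layerDim d N j ≤ SignatureGroup.layerDim d N (N - j) :=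
    fun j hj => SignatureGroup.layerDim_le_layerDim_sub hd hexc hd1 hj
  have hS := SignatureGroup.jumpSet_eq hX hm
  have hT : ∀ p, p ∈ SignatureGroup.nonJumpSet X ↔ SignatureGroup.jumpCount d N p.1 ≤ p.2 := by
    intro p
    rw [SignatureGroup.nonJumpSet, hS, Set.mem_compl_iff, Set.mem_ofPred_eq, not_lt]
  refine ⟨?_, fun hcase => ?_, fun hcase => ?_, ?_⟩
  · rw [hS]
    ext p
    rw [Set.mem_ofPred_eq, Set.mem_ofPred_eq, SignatureGroup.maxRank_eq_jumpCount hX hm]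
    refine ⟨fun h => ⟨SignatureGroup.one_le_level p, ?_, h⟩, fun h => h.2.2⟩
    -- The last layer carries no jump, because the complementary dimension m_0 is zero.
    by_contra hlt
    have h1 := SignatureGroup.level_le p
    have h2 := h.trans_eq ((congrArg (SignatureGroup.jumpCount d N)
      (show (p.1 : ℕ) = N by omega)).trans (SignatureGroup.jumpCount_self d N))
    omega
  · ext p
    have hp := p.2.isLt
    rw [hT, Set.mem_ofPred_eq, SignatureGroup.jumpCount]
    split_ifs with h1 h2
    · omega
    · omega
    · have h3 : (p.1 : ℕ) = N / 2 := by omega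
      -- In the middle layer N is even, so the case assumption makes the dimension even and every
      -- index there is a jump.
      rw [or_iff_right (not_not.2 ⟨N / 2, by omega⟩), ← h3, even_iff_two_dvd] at hcase
      omega
  · ext p
    have hp := p.2.isLt
    rw [hT, Set.mem_union, Set.mem_ofPred_eq, Set.mem_ofPred_eq, SignatureGroup.jumpCount]
    obtain ⟨⟨n, hn⟩, c, hc⟩ := hcase
    split_ifs with h1 h2
    · omega
    · omega
    · have h3 : (p.1 : ℕ) = N / 2 := by omega
      have h4 := congrArg (SignatureGroup.layerDim d N) h3
      omega
  · ext ℓ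
    exact (SignatureGroup.inGeneralPosition_iff hX hm).trans
      (SignatureGroup.jumpColsIndependent_iff hX hm)
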